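/- Let $M$ be a compact Hausdorff smooth ($C^\infty$) manifold of positive dimension with (possibly empty) boundary $\partial M$, and let $\omega$ be a symplectic form on $M$, i.e. a smooth, closed, nondegenerate $2$-form. Suppose that $\partial M$ is either of contact type or of cosymplectic type, i.e. that there are an open neighbourhood $U$ of $\partial M$ in $M$ and a smooth vector field $X$ on $U$, pointing outwards (strictly, in particular transversely) at every point of $\partial M$, such that \[ \text{either}\quad \mathcal L_X\omega=\omega \text{ on } U,\qquad\text{or}\quad \mathcal L_X\omega=0\text{ on } U . \] Let $N = M\cup_{\partial M}\bigl(\partial M\times[0,\infty)\bigr)$ be the manifold obtained by gluing $M$ and $\partial M\times[0,\infty)$ along $\partial M=\partial M\times\{0\}$, with any Hausdorff smooth structure (without boundary) for which the inclusions of $M$ and of $\partial M\times[0,\infty)$ into $N$ are smooth embeddings. Then $\omega$ extends to a Poisson structure on $N$ with compact support: there is a smooth bivector field $\tilde\pi$ on $N$ whose bracket $\{f,g\}=\tilde\pi(df,dg)$ satisfies the Jacobi identity, such that the closure of $\{x\in N:\tilde\pi_x\neq0\}$ is compact and such that at every point of $M$ (including $\partial M$) $\tilde\pi$ equals $\omega^{-1}$,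 i.e. the map $\alpha\mapsto\tilde\pi(\alpha,\cdot)$ from covectors to vectors is the inverse of $v\mapsto\omega(v,\cdot)$. -/

import Mathlib

open Set Topology Manifold Bundle VectorField
open scoped ContDiff

set_option maxSynthPendingDepth 3

noncomputable section

namespace PoissonExtension

section General

variable {E : Type*} [NormedAddCommGroup E] [NormedSpace ℝ E]
  {H : Type*} [TopologicalSpace H] (I : ModelWithCorners ℝ E H)
  {M : Type*} [TopologicalSpace M] [ChartedSpace H M]

/-- The vector field `X` is of class `C^∞` on `s`. -/
def SmoothFieldOn [IsManifold I ∞ M] (X : Π x : M, TangentSpace I x) (s : Set M) : Prop :=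
  ContMDiffOn I I.tangent ∞ (fun x ↦ (⟨x, X x⟩ : TangentBundle I M)) s

/-- The Lie derivative `L_X Ω` of a field of bilinear forms, evaluated on vector fields `Y`, `Z`:
`(L_X Ω)(Y, Z) = X(Ω(Y, Z)) - Ω([X, Y], Z) - Ω(Y, [X, Z])`. -/
def lieDerivForm (Ω : Π x : M, TangentSpace I x →L[ℝ] TangentSpace I x →L[ℝ] ℝ)
    (X Y Z : Π x : M, TangentSpace I x) (x : M) : ℝ :=
  mvfderiv I (fun y ↦ Ω y (Y y) (Z y)) x (X x)
    - Ω x (mlieBracket I X Y x) (Z x) - Ω x (Y x) (mlieBracket I X Z x)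

/-- The exterior derivative `dΩ` of a 2-form, evaluated on vector fields `X`, `Y`, `Z`. -/
def extDerivForm (Ω : Π x : M, TangentSpace I x →L[ℝ] TangentSpace I x →L[ℝ] ℝ)
    (X Y Z : Π x : M, TangentSpace I x) (x : M) : ℝ :=
  mvfderiv I (fun y ↦ Ω y (Y y) (Z y)) x (X x)
    - mvfderiv I (fun y ↦ Ω y (X y) (Z y)) x (Y x)
    + mvfderiv I (fun y ↦ Ω y (X y) (Y y)) x (Z x)
    - Ω x (mlieBracket I X Y x) (Z x)
    + Ω x (mlieBracket I X Z x) (Y x)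
    - Ω x (mlieBracket I Y Z x) (X x)

variable (M) in
/-- A symplectic form on a manifold, possibly with boundary: a smooth, closed, nondegenerate
differential 2-form. -/
structure SymplecticForm [IsManifold I ∞ M] where
  /-- the value of the form at a point -/
  form : Π x : M, TangentSpace I x →L[ℝ] TangentSpace I x →L[ℝ] ℝ
  alternating : ∀ (x : M) (v : TangentSpace I x), form x v v = 0
  nondegenerate : ∀ (x : M) (v : TangentSpace I x), (∀ w, form x v w = 0) → v = 0
  smooth : ContMDiff I (I.prod 𝓘(ℝ, E →L[ℝ] E →L[ℝ] ℝ)) ∞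
    (fun x ↦ TotalSpace.mk' (E →L[ℝ] E →L[ℝ] ℝ)
      (E := fun x : M ↦ TangentSpace I x →L[ℝ] TangentSpace I x →L[ℝ] ℝ) x (form x))
  closed : ∀ X Y Z : Π x : M, TangentSpace I x,
    SmoothFieldOn I X univ → SmoothFieldOn I Y univ → SmoothFieldOn I Z univ →
      ∀ x, extDerivForm I form X Y Z x = 0

/-- The bracket `{f, g} = P(df, dg)` of a bivector field `P`. -/
def bivectorBracket
    (P : Π x : M, (TangentSpace I x →L[ℝ] ℝ) →L[ℝ] (TangentSpace I x →L[ℝ] ℝ) →L[ℝ] ℝ)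
    (f g : M → ℝ) (x : M) : ℝ :=
  P x (mvfderiv I f x) (mvfderiv I g x)

variable (M) in
/-- A Poisson structure: a smooth bivector field `P` whose bracket `{f, g} = P(df, dg)` satisfies
the Jacobi identity on smooth functions. -/
structure PoissonStructure [IsManifold I ∞ M] where
  /-- the value of the bivector field at a point, as a bilinear form on the cotangent space -/
  bivector : Π x : M, (TangentSpace I x →L[ℝ] ℝ) →L[ℝ] (TangentSpace I x →L[ℝ] ℝ) →L[ℝ] ℝ
  alternating : ∀ (x : M) (α : TangentSpace I x →L[ℝ] ℝ), bivector x α α = 0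
  smooth : ContMDiff I (I.prod 𝓘(ℝ, (E →L[ℝ] ℝ) →L[ℝ] (E →L[ℝ] ℝ) →L[ℝ] ℝ)) ∞
    (fun x ↦ TotalSpace.mk' ((E →L[ℝ] ℝ) →L[ℝ] (E →L[ℝ] ℝ) →L[ℝ] ℝ)
      (E := fun x : M ↦
        (TangentSpace I x →L[ℝ] ℝ) →L[ℝ] (TangentSpace I x →L[ℝ] ℝ) →L[ℝ] ℝ) x (bivector x))
  jacobi : ∀ f g h : M → ℝ, ContMDiff I 𝓘(ℝ, ℝ) ∞ f → ContMDiff I 𝓘(ℝ, ℝ) ∞ g →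
    ContMDiff I 𝓘(ℝ, ℝ) ∞ h → ∀ x,
      bivectorBracket I bivector f (bivectorBracket I bivector g h) x
        + bivectorBracket I bivector g (bivectorBracket I bivector h f) x
        + bivectorBracket I bivector h (bivectorBracket I bivector f g) x = 0

variable {I} in
/-- The Poisson structure has compact support: the closure of the set of points where the bivector
field does not vanish is compact. -/
def PoissonStructure.HasCompactSupport [IsManifold I ∞ M] (P : PoissonStructure I M) : Prop :=
  IsCompact (closure {x : M | P.bivector x ≠ 0})

end General

section Extends

variable {E : Type*} [NormedAddCommGroup E] [NormedSpace ℝ E]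
  {H : Type*} [TopologicalSpace H] {I : ModelWithCorners ℝ E H}
  {M : Type*} [TopologicalSpace M] [ChartedSpace H M] [IsManifold I ∞ M]
  {E' : Type*} [NormedAddCommGroup E'] [NormedSpace ℝ E']
  {H' : Type*} [TopologicalSpace H'] {J : ModelWithCorners ℝ E' H'}
  {N : Type*} [TopologicalSpace N] [ChartedSpace H' N] [IsManifold J ∞ N]

/-- For an embedding `j : M → N` of codimension zero: at the points of `M`, `P` is the inverse
`Ω⁻¹` of `Ω`, that is, the map `P♯ : α ↦ P(α, ·)` from covectors to vectors is inverse to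
`Ω♭ : v ↦ Ω(v, ·)`, where the tangent spaces of `M` and `N` are identified by `dj`.
(With the opposite sign convention for `Ω⁻¹` one replaces `P` by `-P`.) -/
def PoissonStructure.ExtendsSymplectic (P : PoissonStructure J N) (Ω : SymplecticForm I M)
    (j : M → N) : Prop :=
  ∀ (x : M) (v : TangentSpace I x) (α : TangentSpace J (j x) →L[ℝ] ℝ),
    (∀ w : TangentSpace I x, α (mfderiv I J j x w) = Ω.form x v w) →
      ∀ β : TangentSpace J (j x) →L[ℝ] ℝ, P.bivector (j x) α β = β (mfderiv I J j x v)

end Extends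

section Boundary

variable {n : ℕ} {M : Type*} [TopologicalSpace M] [ChartedSpace (EuclideanHalfSpace (n + 1)) M]

/-- The vector `v` at `x` points outwards: the half space is given by `0 ≤ x₀`, and the zeroth
coordinate of `v` is negative in the chart at `x`. (Used at boundary points `x` only.) -/
def PointsOutward (x : M) (v : TangentSpace (𝓡∂ (n + 1)) x) : Prop :=
  (mvfderiv (𝓡∂ (n + 1)) (extChartAt (𝓡∂ (n + 1)) x) x v) 0 < 0

variable [IsManifold (𝓡∂ (n + 1)) ∞ M]

/-- There is a smooth vector field `X` on an open neighbourhood `U` of `∂M`, pointing outwards along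
`∂M`, with `L_X Ω = c Ω` on `U`. -/
def HasOutwardHomogeneousField (Ω : SymplecticForm (𝓡∂ (n + 1)) M) (c : ℝ) : Prop :=
  ∃ (U : Set M) (X : Π x : M, TangentSpace (𝓡∂ (n + 1)) x),
    IsOpen U ∧ (𝓡∂ (n + 1)).boundary M ⊆ U ∧ SmoothFieldOn (𝓡∂ (n + 1)) X U ∧
    (∀ x ∈ (𝓡∂ (n + 1)).boundary M, PointsOutward x (X x)) ∧
    ∀ Y Z : Π x : M, TangentSpace (𝓡∂ (n + 1)) x,
      SmoothFieldOn (𝓡∂ (n + 1)) Y univ → SmoothFieldOn (𝓡∂ (n + 1)) Z univ →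
        ∀ x ∈ U, lieDerivForm (𝓡∂ (n + 1)) Ω.form X Y Z x = c * Ω.form x (Y x) (Z x)

/-- The boundary is of contact type: `L_X Ω = Ω` for an outward pointing `X` near `∂M`. -/
def SymplecticForm.HasContactBoundary (Ω : SymplecticForm (𝓡∂ (n + 1)) M) : Prop :=
  HasOutwardHomogeneousField Ω 1

/-- The boundary is of cosymplectic type: `L_X Ω = 0` for an outward pointing `X` near `∂M`. -/
def SymplecticForm.HasCosymplecticBoundary (Ω : SymplecticForm (𝓡∂ (n + 1)) M) : Prop :=
  HasOutwardHomogeneousField Ω 0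

end Boundary

/-- `N`, with the maps `j : M → N` and `κ : ∂M × [0, ∞) → N`, is the smooth manifold
`M ∪ ∂M × [0, ∞)` obtained by gluing `M` and `∂M × [0, ∞)` along `∂M = ∂M × {0}`. The boundary of
`M` is presented as a smooth manifold `B` without boundary with a smooth embedding `ι : B → M` onto
`∂M`, and the half line `[0, ∞)` is the half space of dimension 1. The smooth structure of the glued
manifold near `∂M` depends on the choice of a collar; every choice is allowed here. -/
structure IsCylindricalExtension (n : ℕ)
    {M : Type*} [TopologicalSpace M] [ChartedSpace (EuclideanHalfSpace (n + 1)) M]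
    {B : Type*} [TopologicalSpace B] [ChartedSpace (EuclideanSpace ℝ (Fin n)) B]
    {N : Type*} [TopologicalSpace N] [ChartedSpace (EuclideanSpace ℝ (Fin (n + 1))) N]
    (ι : B → M) (j : M → N) (κ : B × EuclideanHalfSpace 1 → N) : Prop where
  boundary_embedding : IsSmoothEmbedding (𝓡 n) (𝓡∂ (n + 1)) ∞ ι
  range_boundary : range ι = (𝓡∂ (n + 1)).boundary M
  inner_embedding : IsSmoothEmbedding (𝓡∂ (n + 1)) (𝓡 (n + 1)) ∞ j
  outer_embedding : IsSmoothEmbedding ((𝓡 n).prod (𝓡∂ 1)) (𝓡 (n + 1)) ∞ κ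
  covers : range j ∪ range κ = univ
  glued : ∀ (x : M) (b : B) (t : EuclideanHalfSpace 1),
    j x = κ (b, t) ↔ ι b = x ∧ t.1 0 = 0

end PoissonExtension

end

/-!
The extension is built in coordinates near `∂M`, on a short piece of the cylindrical end.

*The local formula.* Let `η` be a symplectic form with inverse bivector `π`, let `α` be a 1-form
with `dα = c η`, and let `X` be the vector field dual to `α`, so that `L_X η = c η`. Let `ℓ` be a
function with dual field `Y`, and put `h = ℓ(X)`. Then `g (π - w X ∧ Y)`, where `g` is a function of
`ℓ`, satisfies the Jacobi identity as soon as `dw = -w² dh` modulo `dℓ` and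
`g' (1 - w h) = -c w g`; this is `FlatSymplectic.flatPoisson_deformed`, an algebraic consequence of
the Jacobi identities of `π` for `α`, `dℓ` and exact forms. The first condition holds for
`w = p / (r + p h)` with functions `p`, `r` of `ℓ`, and the second one becomes `r g' = -c p g`. If
`h > 0`, the functions `p`, `r` and `g` can be chosen so that `w = 0` and `g = 1` for `ℓ ≤ 0` and
`g = 0` for `ℓ ≥ δ`: for `c = 1`, `g` is essentially `exp (-1 / (1 - ℓ / δ))`; for `c = 0`, `g` may
be any cut-off function which is constant outside the set where `r = 0`, that is, `w = 1 / h`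
(`exists_isProfile_one`, `exists_isProfile_zero`). The resulting bivector is `π` on `M` and vanishes
beyond a small height.

*Continuing the form.* The smooth structure of the glued manifold need not be related to the flow of
`X`, so the form is first extended to an arbitrary smooth 2-form on the glued manifold, which uses
Seeley's extension theorem (`exists_contDiff_eq_on_halfSpace`, `exists_extension_form`), and
likewise `X` (`exists_extension_field`). The 2-form is then made closed along the end: if `t` is the
height and `pr` the projection of the end to `∂M`, it is replaced by `pr^* η + d(∫ η(∂_t, ·) dt)`
(`collarForm`). The result agrees with `η` on `M` and is closed on the end since `η` is closed along
`∂M`; if `da = c η` on `∂M`, where `a = η(X, ·)`, then `pr^* a + c ∫ η(∂_t, ·) dt` is a primitive of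
`c` times this form (`collarOneForm`). Since `X` points outwards, the condition `h > 0` holds near
`∂M`.

*Globalization.* These constructions only involve `η`, `a`, the height and the projection, which
makes them independent of the coordinates on the end (`IsCollarChart.pushBivector_deformed_eq`).
Compactness of `∂M` yields a common height `δ`, and the local Poisson structures are glued with
`π` on `M` and with `0` outside a compact set.
-/

noncomputable section

namespace PoissonExtension

/-! ### Smooth extension across a hyperplane -/

section Seeley

open Filter

/-- The Taylor coefficients of the entire function `∏ (1 - z / 2 ^ k)`, `k ≥ 0`. -/
def seeleyCoeff : ℕ → ℝ
  | 0 => 1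
  | k + 1 => -2 * seeleyCoeff k / (2 ^ (k + 1) - 1)

lemma one_lt_two_pow_succ (k : ℕ) : (1 : ℝ) < 2 ^ (k + 1) :=
  one_lt_pow₀ one_lt_two (Nat.succ_ne_zero k)

lemma seeleyCoeff_ne_zero (k : ℕ) : seeleyCoeff k ≠ 0 := by
  induction k with
  | zero => simp [seeleyCoeff]
  | succ k ih =>
    have := one_lt_two_pow_succ k
    rw [seeleyCoeff]
    exact div_ne_zero (mul_ne_zero (by norm_num) ih) (by linarith)

lemma seeleyCoeff_succ_mul (k : ℕ) :
    seeleyCoeff (k + 1) * 2 ^ (k + 1) = seeleyCoeff (k + 1) - 2 * seeleyCoeff k := by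
  have := one_lt_two_pow_succ k
  have h : (2 : ℝ) ^ (k + 1) - 1 ≠ 0 := by linarith
  rw [seeleyCoeff]
  field_simp
  ring

lemma summable_seeleyCoeff_mul_pow {y : ℝ} (hy : 0 < y) :
    Summable fun k ↦ seeleyCoeff k * y ^ k := by
  refine summable_of_ratio_test_tendsto_lt_one (l := 0) one_pos
    (Eventually.of_forall fun k ↦ mul_ne_zero (seeleyCoeff_ne_zero k) (pow_ne_zero k hy.ne')) ?_
  have h : ∀ k : ℕ, ‖seeleyCoeff (k + 1) * y ^ (k + 1)‖ / ‖seeleyCoeff k * y ^ k‖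
      = 2 * y * (2 ^ (k + 1) - 1)⁻¹ := by
    intro k
    have h1 := one_lt_two_pow_succ k
    have h2 : (0 : ℝ) < 2 ^ (k + 1) - 1 := by linarith
    rw [← norm_div, seeleyCoeff]
    have h3 := seeleyCoeff_ne_zero k
    have : (-2 * seeleyCoeff k / (2 ^ (k + 1) - 1)) * y ^ (k + 1) / (seeleyCoeff k * y ^ k)
        = -(2 * y * (2 ^ (k + 1) - 1)⁻¹) := by
      field_simp
      ring
    rw [this, norm_neg, Real.norm_of_nonneg (by positivity)]
  simp_rw [h]
  have h4 : Tendsto (fun k : ℕ ↦ (2 : ℝ) ^ (k + 1) - 1) atTop atTop :=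
    tendsto_atTop_add_const_right _ _
      ((tendsto_pow_atTop_atTop_of_one_lt (one_lt_two : (1 : ℝ) < 2)).comp (tendsto_add_atTop_nat 1))
  simpa using (tendsto_inv_atTop_zero.comp h4).const_mul (2 * y)

lemma tsum_seeleyCoeff_mul_two_mul_pow {y : ℝ} (hy : 0 < y) :
    ∑' k, seeleyCoeff k * (2 * y) ^ k = (1 - 2 * y) * ∑' k, seeleyCoeff k * y ^ k := by
  have h1 := summable_seeleyCoeff_mul_pow hy
  have h2 := summable_seeleyCoeff_mul_pow (show 0 < 2 * y by positivity)
  rw [sub_mul, one_mul, ← tsum_mul_left, h2.tsum_eq_zero_add, h1.tsum_eq_zero_add]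
  have h3 := (summable_nat_add_iff 1).2 h1
  have h4 : ∀ k : ℕ, seeleyCoeff (k + 1) * (2 * y) ^ (k + 1)
      = seeleyCoeff (k + 1) * y ^ (k + 1) - 2 * y * (seeleyCoeff k * y ^ k) := by
    intro k
    rw [mul_pow, ← mul_assoc, seeleyCoeff_succ_mul]
    ring
  simp_rw [h4]
  rw [h3.tsum_sub (h1.mul_left _)]
  simp only [pow_zero, mul_one]
  ring

/-- The entire function with Taylor coefficients `seeleyCoeff` vanishes at the powers of two. -/
lemma tsum_seeleyCoeff_mul_pow_eq_zero (m : ℕ) :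
    ∑' k, seeleyCoeff k * ((2 : ℝ) ^ m) ^ k = 0 := by
  induction m with
  | zero =>
    have := tsum_seeleyCoeff_mul_two_mul_pow (show (0 : ℝ) < 1 / 2 by norm_num)
    norm_num at this
    simpa using this
  | succ m ih =>
    have := tsum_seeleyCoeff_mul_two_mul_pow (show (0 : ℝ) < 2 ^ m by positivity)
    rw [ih, mul_zero] at this
    rwa [pow_succ', ]

variable {E : Type*} [NormedAddCommGroup E] [NormedSpace ℝ E]
  {F : Type*} [NormedAddCommGroup F] [NormedSpace ℝ F]

/-- The linear map that fixes the hyperplane `ℓ = 0` and multiplies the transverse vector `e₀`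
by `2 - 2 ^ k`. It is the identity for `k = 0` and maps `ℓ ≤ 0` to `ℓ ≥ 0` for `k ≥ 1`. -/
def seeleyMap (ℓ : E →L[ℝ] ℝ) (e₀ : E) (k : ℕ) : E →L[ℝ] E :=
  ContinuousLinearMap.id ℝ E + (1 - 2 ^ k : ℝ) • ℓ.smulRight e₀

variable {ℓ : E →L[ℝ] ℝ} {e₀ : E}

lemma seeleyMap_apply (k : ℕ) (x : E) :
    seeleyMap ℓ e₀ k x = x + (1 - 2 ^ k : ℝ) • ℓ x • e₀ := by
  simp [seeleyMap]

lemma apply_seeleyMap (h₀ : ℓ e₀ = 1) (k : ℕ) (x : E) :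
    ℓ (seeleyMap ℓ e₀ k x) = (2 - 2 ^ k) * ℓ x := by
  simp [seeleyMap_apply, h₀]
  ring

lemma seeleyMap_of_apply_eq_zero {x : E} (hx : ℓ x = 0) (k : ℕ) : seeleyMap ℓ e₀ k x = x := by
  simp [seeleyMap_apply, hx]

lemma norm_seeleyMap_le (k : ℕ) :
    ‖seeleyMap ℓ e₀ k‖ ≤ (1 + ‖ℓ.smulRight e₀‖) * 2 ^ k := by
  have h1 : (1 : ℝ) ≤ 2 ^ k := one_le_pow₀ one_le_two
  calc ‖seeleyMap ℓ e₀ k‖ ≤ ‖ContinuousLinearMap.id ℝ E‖ + ‖(1 - 2 ^ k : ℝ) • ℓ.smulRight e₀‖ :=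
        norm_add_le _ _
    _ ≤ 1 * 2 ^ k + 2 ^ k * ‖ℓ.smulRight e₀‖ := by
        gcongr
        · exact ContinuousLinearMap.norm_id_le.trans (by linarith)
        · rw [norm_smul, Real.norm_eq_abs, abs_sub_comm, abs_of_nonneg (by linarith)]
          gcongr
          linarith
    _ = _ := by ring

/-- The reflected terms of the extension formula, applied to `m`-linear maps, are dominated by a
summable sequence. -/
lemma norm_smul_compContinuousLinearMap_seeleyMap_le (m : ℕ) {C : ℝ}
    {φ : E [×m]→L[ℝ] F} (hφ : ‖φ‖ ≤ C) (k : ℕ) :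
    ‖seeleyCoeff k • φ.compContinuousLinearMap (fun _ ↦ seeleyMap ℓ e₀ k)‖
      ≤ C * (1 + ‖ℓ.smulRight e₀‖) ^ m * ‖seeleyCoeff k * ((2 : ℝ) ^ m) ^ k‖ := by
  have hC : 0 ≤ C := (norm_nonneg _).trans hφ
  have h1 : ‖φ.compContinuousLinearMap (fun _ ↦ seeleyMap ℓ e₀ k)‖
      ≤ C * ((1 + ‖ℓ.smulRight e₀‖) * 2 ^ k) ^ m := by
    refine (ContinuousMultilinearMap.norm_compContinuousLinearMap_le _ _).trans ?_
    simp only [Finset.prod_const, Finset.card_univ, Fintype.card_fin]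
    gcongr
    exact norm_seeleyMap_le k
  rw [norm_smul]
  refine (mul_le_mul_of_nonneg_left h1 (norm_nonneg _)).trans (le_of_eq ?_)
  rw [norm_mul, Real.norm_of_nonneg (show (0 : ℝ) ≤ (2 ^ m) ^ k by positivity), mul_pow,
    ← pow_mul, ← pow_mul, mul_comm k m]
  ring

lemma summable_seeley_bound (m : ℕ) (C : ℝ) :
    Summable fun k ↦ C * (1 + ‖ℓ.smulRight e₀‖) ^ m * ‖seeleyCoeff k * ((2 : ℝ) ^ m) ^ k‖ :=
  ((summable_seeleyCoeff_mul_pow (by positivity)).norm).mul_left _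

/-- The extension formula is compatible with all jets along the hyperplane: `m`-linear maps are
reproduced, since `k ↦ φ (seeleyMap k v)` is a polynomial in `2 ^ k`. -/
lemma tsum_seeley_compContinuousLinearMap [CompleteSpace F] (m : ℕ) (φ : E [×m]→L[ℝ] F) :
    ∑' k, -seeleyCoeff (k + 1) •
      φ.compContinuousLinearMap (fun _ ↦ seeleyMap ℓ e₀ (k + 1)) = φ := by
  have hs : Summable fun k ↦
      seeleyCoeff k • φ.compContinuousLinearMap (fun _ ↦ seeleyMap ℓ e₀ k) :=
    Summable.of_norm_bounded (summable_seeley_bound m ‖φ‖)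
      (norm_smul_compContinuousLinearMap_seeleyMap_le m le_rfl)
  have h0 : ∑' k, seeleyCoeff k • φ.compContinuousLinearMap (fun _ ↦ seeleyMap ℓ e₀ k) = 0 := by
    ext v
    rw [ContinuousMultilinearMap.tsum_eval hs]
    -- expand `φ` as a polynomial in `2 ^ k`
    have h1 : ∀ k : ℕ, φ (fun i ↦ seeleyMap ℓ e₀ k (v i))
        = ∑ s : Finset (Fin m), ((2 : ℝ) ^ s.card) ^ k •
          φ (s.piecewise (fun i ↦ -ℓ (v i) • e₀) (fun i ↦ v i + ℓ (v i) • e₀)) := by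
      intro k
      have h2 : (fun i ↦ seeleyMap ℓ e₀ k (v i))
          = (fun i ↦ (2 : ℝ) ^ k • (-ℓ (v i) • e₀)) + (fun i ↦ v i + ℓ (v i) • e₀) := by
        ext i
        simp only [seeleyMap_apply, Pi.add_apply]
        module
      rw [h2]
      have h3 := φ.toMultilinearMap.map_add_univ
        (fun i ↦ (2 : ℝ) ^ k • (-ℓ (v i) • e₀)) (fun i ↦ v i + ℓ (v i) • e₀)
      simp only [ContinuousMultilinearMap.coe_coe] at h3
      rw [h3]
      refine Finset.sum_congr rfl fun s _ ↦ ?_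
      have h4 := φ.toMultilinearMap.map_piecewise_smul (fun _ ↦ (2 : ℝ) ^ k)
        (s.piecewise (fun i ↦ -ℓ (v i) • e₀) (fun i ↦ v i + ℓ (v i) • e₀)) s
      simp only [ContinuousMultilinearMap.coe_coe, Finset.prod_const] at h4
      rw [pow_right_comm, ← h4]
      congr 1
      ext i
      by_cases hi : i ∈ s <;> simp [hi]
    simp only [smul_apply,
      ContinuousMultilinearMap.compContinuousLinearMap_apply, zero_apply,
      h1, Finset.smul_sum]
    rw [Summable.tsum_finsetSum]
    · refine Finset.sum_eq_zero fun s _ ↦ ?_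
      simp_rw [smul_smul]
      rw [(summable_seeleyCoeff_mul_pow (by positivity)).tsum_smul_const,
        tsum_seeleyCoeff_mul_pow_eq_zero, zero_smul]
    · intro s _
      simp_rw [smul_smul]
      exact (summable_seeleyCoeff_mul_pow (by positivity)).smul_const _
  rw [hs.tsum_eq_zero_add] at h0
  have h5 : seeleyCoeff 0 • φ.compContinuousLinearMap (fun _ ↦ seeleyMap ℓ e₀ 0) = φ := by
    ext v
    simp [seeleyCoeff, seeleyMap_apply]
  rw [h5] at h0
  simp_rw [neg_smul]
  rw [tsum_neg]
  exact (eq_neg_of_add_eq_zero_left h0).symm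

lemma closure_setOf_apply_lt (h₀ : ℓ e₀ = 1) : closure {x : E | ℓ x < 0} = {x | ℓ x ≤ 0} := by
  refine subset_antisymm (closure_lt_subset_le ℓ.continuous continuous_const) fun x hx ↦ ?_
  have h1 : Tendsto (fun t : ℝ ↦ x - t • e₀) (𝓝[>] 0) (𝓝 x) := by
    have : Tendsto (fun t : ℝ ↦ x - t • e₀) (𝓝 0) (𝓝 (x - (0 : ℝ) • e₀)) :=
      Continuous.tendsto (by fun_prop) 0
    rw [zero_smul, sub_zero] at this
    exact this.mono_left nhdsWithin_le_nhds
  refine mem_closure_of_tendsto h1 ?_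
  filter_upwards [self_mem_nhdsWithin] with t ht
  simp only [mem_ofPred_eq, map_sub, map_smul, h₀, smul_eq_mul, mul_one] at hx ⊢
  have : (0 : ℝ) < t := ht
  linarith

/-- A continuous function that is differentiable off a hyperplane, with a derivative that extends
continuously, is differentiable. -/
lemma hasFDerivAt_of_hasFDerivAt_off_hyperplane (h₀ : ℓ e₀ = 1) {f : E → F} {f' : E → E →L[ℝ] F}
    (hf : Continuous f) (hf' : Continuous f') (h : ∀ x, ℓ x ≠ 0 → HasFDerivAt f (f' x) x) (x : E) :
    HasFDerivAt f (f' x) x := by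
  have key : ∀ (ℓ' : E →L[ℝ] ℝ) (e₁ : E), ℓ' e₁ = 1 → (∀ y, ℓ' y < 0 → ℓ y ≠ 0) →
      HasFDerivWithinAt f (f' x) {y | ℓ' y ≤ 0} x := by
    intro ℓ' e₁ h₁ hn
    rw [← closure_setOf_apply_lt h₁]
    refine hasFDerivWithinAt_closure_of_tendsto_fderiv
      (fun y hy ↦ (h y (hn y hy)).differentiableAt.differentiableWithinAt) ?_
      (isOpen_lt ℓ'.continuous continuous_const) (fun y _ ↦ hf.continuousWithinAt) ?_
    · exact (convex_Iio (0 : ℝ)).is_linear_preimage ℓ'.isBoundedLinearMap.toIsLinearMap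
    · have h2 : Tendsto f' (𝓝[{y | ℓ' y < 0}] x) (𝓝 (f' x)) :=
        hf'.continuousAt.tendsto.mono_left nhdsWithin_le_nhds
      refine h2.congr' ?_
      filter_upwards [self_mem_nhdsWithin] with y hy
      exact ((h y (hn y hy)).fderiv).symm
  have h1 := key ℓ e₀ h₀ fun y hy ↦ hy.ne
  have h2 := key (-ℓ) (-e₀) (by simp [h₀]) fun y hy ↦ by
    simp only [neg_apply] at hy
    exact (neg_lt_zero.1 hy).ne'
  have h3 := h1.union h2
  have h4 : {y | ℓ y ≤ 0} ∪ {y | (-ℓ) y ≤ 0} = univ := by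
    ext y
    simpa using le_total (ℓ y) 0
  rwa [h4, hasFDerivWithinAt_univ] at h3

/-- The candidate for the Taylor series of the extension: on `0 ≤ ℓ` the given Taylor series, and
on `ℓ < 0` the series of its reflections. -/
def seeleySeries (ℓ : E →L[ℝ] ℝ) (e₀ : E) (p : E → FormalMultilinearSeries ℝ E F) (x : E) :
    FormalMultilinearSeries ℝ E F := fun m ↦
  if 0 ≤ ℓ x then p x m else ∑' k, -seeleyCoeff (k + 1) •
    (p (seeleyMap ℓ e₀ (k + 1) x) m).compContinuousLinearMap (fun _ ↦ seeleyMap ℓ e₀ (k + 1))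

lemma apply_seeleyMap_succ_nonneg (h₀ : ℓ e₀ = 1) (k : ℕ) {x : E} (hx : ℓ x ≤ 0) :
    0 ≤ ℓ (seeleyMap ℓ e₀ (k + 1) x) := by
  rw [apply_seeleyMap h₀]
  have h1 : (1 : ℝ) ≤ 2 ^ k := one_le_pow₀ one_le_two
  have h2 : (2 : ℝ) - 2 ^ (k + 1) ≤ 0 := by rw [pow_succ]; linarith
  exact mul_nonneg_of_nonpos_of_nonpos h2 hx

lemma uniqueDiffOn_setOf_nonneg (h₀ : ℓ e₀ = 1) : UniqueDiffOn ℝ {x : E | 0 ≤ ℓ x} := by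
  refine uniqueDiffOn_convex
    ((convex_Ici (0 : ℝ)).is_linear_preimage ℓ.isBoundedLinearMap.toIsLinearMap) ⟨e₀, ?_⟩
  exact interior_maximal (fun x (hx : 0 < ℓ x) ↦ hx.le) (isOpen_lt continuous_const ℓ.continuous)
    (show 0 < ℓ e₀ by simp [h₀])

/-- **Seeley extension**: a smooth function with compact support on a closed half space extends to
a smooth function on the whole space. -/
theorem exists_contDiff_eq_on_halfSpace [CompleteSpace F] (h₀ : ℓ e₀ = 1) {f : E → F}
    (hf : ContDiffOn ℝ ∞ f {x | 0 ≤ ℓ x}) (hc : HasCompactSupport f) :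
    ∃ g : E → F, ContDiff ℝ ∞ g ∧ ∀ x, 0 ≤ ℓ x → g x = f x := by
  set p := ftaylorSeriesWithin ℝ f {x | 0 ≤ ℓ x} with hp
  have hT : HasFTaylorSeriesUpToOn ∞ f p {x | 0 ≤ ℓ x} :=
    hf.ftaylorSeriesWithin (uniqueDiffOn_setOf_nonneg h₀)
  have hcl : IsClosed {x : E | 0 ≤ ℓ x} := isClosed_le continuous_const ℓ.continuous
  -- the derivatives of `f` are bounded, since its support is compact
  have hbound : ∀ m : ℕ, ∃ C, ∀ x, 0 ≤ ℓ x → ‖p x m‖ ≤ C := by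
    intro m
    have hcont : ContinuousOn (fun x ↦ ‖p x m‖) ({x | 0 ≤ ℓ x} ∩ tsupport f) :=
      ((hT.cont m (mod_cast le_top)).mono inter_subset_left).norm
    obtain ⟨C, hC⟩ := ((hc.isCompact.inter_left hcl).bddAbove_image hcont)
    refine ⟨max C 0, fun x hx ↦ ?_⟩
    by_cases hxf : x ∈ tsupport f
    · exact (hC ⟨x, ⟨hx, hxf⟩, rfl⟩).trans (le_max_left _ _)
    · have h1 : f =ᶠ[𝓝[{x | 0 ≤ ℓ x}] x] 0 :=
        (notMem_tsupport_iff_eventuallyEq.1 hxf).filter_mono nhdsWithin_le_nhds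
      have h2 : p x m = 0 := by
        rw [hp, ftaylorSeriesWithin, h1.iteratedFDerivWithin_eq (image_eq_zero_of_notMem_tsupport hxf)]
        exact congrFun iteratedFDerivWithin_fun_zero x
      simp [h2]
  choose C hC using hbound
  have hle : ∀ (m k : ℕ) {x : E}, ℓ x ≤ 0 → ‖-seeleyCoeff (k + 1) •
      (p (seeleyMap ℓ e₀ (k + 1) x) m).compContinuousLinearMap (fun _ ↦ seeleyMap ℓ e₀ (k + 1))‖
      ≤ C m * (1 + ‖ℓ.smulRight e₀‖) ^ m * ‖seeleyCoeff (k + 1) * ((2 : ℝ) ^ m) ^ (k + 1)‖ := by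
    intro m k x hx
    rw [neg_smul, norm_neg]
    exact norm_smul_compContinuousLinearMap_seeleyMap_le m
      (hC m _ (apply_seeleyMap_succ_nonneg h₀ k hx)) (k + 1)
  have hsum : ∀ m : ℕ, Summable fun k ↦
      C m * (1 + ‖ℓ.smulRight e₀‖) ^ m * ‖seeleyCoeff (k + 1) * ((2 : ℝ) ^ m) ^ (k + 1)‖ :=
    fun m ↦ (summable_nat_add_iff 1).2 (summable_seeley_bound m (C m))
  -- on the hyperplane, the two cases of the definition of `seeleySeries` agree
  have hneg : ∀ (m : ℕ) {x : E}, ℓ x ≤ 0 → seeleySeries ℓ e₀ p x m =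
      ∑' k, -seeleyCoeff (k + 1) • (p (seeleyMap ℓ e₀ (k + 1) x) m).compContinuousLinearMap
        (fun _ ↦ seeleyMap ℓ e₀ (k + 1)) := by
    intro m x hx
    rcases hx.lt_or_eq with h | h
    · simp [seeleySeries, not_le.2 h]
    · simp only [seeleySeries, h, le_refl, if_true, seeleyMap_of_apply_eq_zero h]
      exact (tsum_seeley_compContinuousLinearMap m (p x m)).symm
  have hcont : ∀ m : ℕ, Continuous fun x ↦ seeleySeries ℓ e₀ p x m := by
    intro m
    have h1 : ContinuousOn (fun x ↦ seeleySeries ℓ e₀ p x m) {x | 0 ≤ ℓ x} :=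
      (hT.cont m (mod_cast le_top)).congr fun x hx ↦ if_pos hx
    have h2 : ContinuousOn (fun x ↦ seeleySeries ℓ e₀ p x m) {x | ℓ x ≤ 0} := by
      refine ContinuousOn.congr ?_ fun x hx ↦ hneg m hx
      refine continuousOn_tsum (fun k ↦ ?_) (hsum m) fun k x hx ↦ hle m k hx
      have h3 : ContinuousOn (fun x ↦ p (seeleyMap ℓ e₀ (k + 1) x) m) {x | ℓ x ≤ 0} :=
        (hT.cont m (mod_cast le_top)).comp (seeleyMap ℓ e₀ (k + 1)).continuous.continuousOn
          fun x hx ↦ apply_seeleyMap_succ_nonneg h₀ k hx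
      exact ((ContinuousMultilinearMap.compContinuousLinearMapL (fun _ : Fin m ↦
        seeleyMap ℓ e₀ (k + 1))).continuous.comp_continuousOn h3).const_smul (-seeleyCoeff (k + 1))
    rw [← continuousOn_univ]
    have h4 := h1.union_of_isClosed h2 hcl (isClosed_le ℓ.continuous continuous_const)
    refine h4.mono fun x _ ↦ ?_
    exact le_total 0 (ℓ x)
  have hderiv : ∀ (m : ℕ) (x : E), ℓ x ≠ 0 → HasFDerivAt (fun x ↦ seeleySeries ℓ e₀ p x m)
      (seeleySeries ℓ e₀ p x (m + 1)).curryLeft x := by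
    intro m x hx
    rcases hx.lt_or_gt with h | h
    · have hopen : IsOpen {x : E | ℓ x < 0} := isOpen_lt ℓ.continuous continuous_const
      have hconv : Convex ℝ {x : E | ℓ x < 0} :=
        (convex_Iio (0 : ℝ)).is_linear_preimage ℓ.isBoundedLinearMap.toIsLinearMap
      have hterm : ∀ (k : ℕ) (y : E), y ∈ {x : E | ℓ x < 0} → HasFDerivAt
          (fun x ↦ -seeleyCoeff (k + 1) • (p (seeleyMap ℓ e₀ (k + 1) x) m).compContinuousLinearMap
            (fun _ ↦ seeleyMap ℓ e₀ (k + 1)))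
          ((-seeleyCoeff (k + 1) • (p (seeleyMap ℓ e₀ (k + 1) y) (m + 1)).compContinuousLinearMap
            (fun _ ↦ seeleyMap ℓ e₀ (k + 1))).curryLeft) y := by
        intro k y hy
        have hy' : ℓ y < 0 := hy
        have h1 : HasFDerivWithinAt (fun x ↦ p (seeleyMap ℓ e₀ (k + 1) x) m)
            ((p (seeleyMap ℓ e₀ (k + 1) y) m.succ).curryLeft ∘L seeleyMap ℓ e₀ (k + 1))
            {x | ℓ x < 0} y :=
          (hT.fderivWithin m (mod_cast WithTop.coe_lt_top _) _
            (apply_seeleyMap_succ_nonneg h₀ k hy'.le)).comp y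
            (seeleyMap ℓ e₀ (k + 1)).hasFDerivWithinAt
            fun x (hx : ℓ x < 0) ↦ apply_seeleyMap_succ_nonneg h₀ k hx.le
        have h2 := ((ContinuousMultilinearMap.compContinuousLinearMapL (F := F) (fun _ : Fin m ↦
          seeleyMap ℓ e₀ (k + 1))).hasFDerivAt.comp y
            (h1.hasFDerivAt (hopen.mem_nhds hy))).const_smul (-seeleyCoeff (k + 1))
        refine h2.congr_fderiv ?_
        ext v w
        simp only [ContinuousLinearMap.comp_apply,
          smul_apply, ContinuousMultilinearMap.curryLeft_apply,
          ContinuousMultilinearMap.compContinuousLinearMap_apply,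
          ContinuousMultilinearMap.compContinuousLinearMapL_apply]
        congr 2
        ext i
        refine Fin.cases ?_ (fun i ↦ ?_) i <;> simp
      have hterms := hasFDerivAt_tsum_of_isPreconnected (hsum (m + 1)) hopen hconv.isPreconnected
        hterm (fun k y hy ↦ by
          rw [ContinuousMultilinearMap.curryLeft_norm]
          exact hle (m + 1) k (show ℓ y < 0 from hy).le) (show x ∈ {x : E | ℓ x < 0} from h)
        (Summable.of_norm_bounded (hsum m) fun k ↦ hle m k h.le) h
      have hcurry : (seeleySeries ℓ e₀ p x (m + 1)).curryLeft = ∑' k, (-seeleyCoeff (k + 1) •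
          (p (seeleyMap ℓ e₀ (k + 1) x) (m + 1)).compContinuousLinearMap
            (fun _ ↦ seeleyMap ℓ e₀ (k + 1))).curryLeft := by
        rw [hneg (m + 1) h.le]
        exact (continuousMultilinearCurryLeftEquiv ℝ (fun _ : Fin (m + 1) ↦ E)
          F).toContinuousLinearEquiv.map_tsum
      rw [hcurry]
      refine hterms.congr_of_eventuallyEq ?_
      filter_upwards [hopen.mem_nhds h] with y hy
      exact hneg m (show ℓ y < 0 from hy).le
    · have hnhds : {x | 0 ≤ ℓ x} ∈ 𝓝 x :=
        mem_of_superset ((isOpen_lt continuous_const ℓ.continuous).mem_nhds h)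
          fun y (hy : 0 < ℓ y) ↦ hy.le
      have h1 := (hT.fderivWithin m (mod_cast WithTop.coe_lt_top _) x h.le).hasFDerivAt hnhds
      have h2 : seeleySeries ℓ e₀ p x (m + 1) = p x (m + 1) := if_pos h.le
      rw [h2]
      refine h1.congr_of_eventuallyEq ?_
      filter_upwards [hnhds] with y hy
      exact if_pos hy
  refine ⟨fun x ↦ (seeleySeries ℓ e₀ p x 0).curry0, ?_, fun x hx ↦ ?_⟩
  · refine HasFTaylorSeriesUpTo.contDiff (n := ⊤) (f' := seeleySeries ℓ e₀ p)
      ⟨fun x ↦ rfl, fun m _ x ↦ ?_, fun m _ ↦ hcont m⟩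
    refine hasFDerivAt_of_hasFDerivAt_off_hyperplane h₀ (hcont m)
      (f' := fun x ↦ (seeleySeries ℓ e₀ p x (m + 1)).curryLeft) ?_ (hderiv m) x
    exact (continuousMultilinearCurryLeftEquiv ℝ (fun _ : Fin (m + 1) ↦ E) F).continuous.comp
      (hcont (m + 1))
  · have : seeleySeries ℓ e₀ p x 0 = p x 0 := if_pos hx
    simp only [this]
    exact hT.zero_eq x hx

/-- A function that is smooth on a closed half space near a point extends smoothly to a
neighbourhood of the point. -/
theorem exists_contDiff_eventually_eq_on_halfSpace [FiniteDimensional ℝ E] [CompleteSpace F]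
    (h₀ : ℓ e₀ = 1) {f : E → F} {V : Set E} (hV : IsOpen V) {x₀ : E} (hx₀ : x₀ ∈ V)
    (hf : ContDiffOn ℝ ∞ f (V ∩ {x | 0 ≤ ℓ x})) :
    ∃ g : E → F, ContDiff ℝ ∞ g ∧ ∀ᶠ x in 𝓝 x₀, 0 ≤ ℓ x → g x = f x := by
  obtain ⟨φ, hφV⟩ : ∃ φ : ContDiffBump x₀, tsupport φ ⊆ V := by
    obtain ⟨ε, hε, hεV⟩ := Metric.isOpen_iff.1 hV x₀ hx₀
    refine ⟨⟨ε / 4, ε / 2, by positivity, by linarith⟩, ?_⟩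
    rw [ContDiffBump.tsupport_eq]
    exact (Metric.closedBall_subset_ball (by simpa using hε)).trans hεV
  have hsmooth : ContDiffOn ℝ ∞ (fun x ↦ φ x • f x) {x | 0 ≤ ℓ x} := by
    intro x hx
    by_cases hxV : x ∈ V
    · have h1 : ContDiffWithinAt ℝ ∞ f {x | 0 ≤ ℓ x} x := by
        have := hf x ⟨hxV, hx⟩
        rwa [inter_comm, contDiffWithinAt_inter (hV.mem_nhds hxV)] at this
      exact φ.contDiffAt.contDiffWithinAt.smul h1
    · have h1 : (fun x ↦ φ x • f x) =ᶠ[𝓝 x] fun _ ↦ 0 := by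
        filter_upwards [notMem_tsupport_iff_eventuallyEq.1 (fun h ↦ hxV (hφV h))] with y hy
        simp [hy]
      exact (contDiffAt_const.congr_of_eventuallyEq h1).contDiffWithinAt
  obtain ⟨g, hg, hgf⟩ := exists_contDiff_eq_on_halfSpace h₀ hsmooth φ.hasCompactSupport.smul_right
  refine ⟨g, hg, ?_⟩
  filter_upwards [φ.eventuallyEq_one] with x hx1 hx2
  simp [hgf x hx2, hx1]

end Seeley

/-! ### Smooth coordinates with values in a vector space -/

section Coord

variable {E : Type*} [NormedAddCommGroup E] [NormedSpace ℝ E]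
  {H : Type*} [TopologicalSpace H] (J : ModelWithCorners ℝ E H)
  {N : Type*} [TopologicalSpace N] [ChartedSpace H N]
  {G : Type*} [NormedAddCommGroup G] [NormedSpace ℝ G]
  {G' : Type*} [NormedAddCommGroup G'] [NormedSpace ℝ G']

/-- A local coordinate system on `N` with values in an arbitrary normed space `G`, which need not
be the model space of `N`: a diffeomorphism from an open subset of `N` to an open subset of `G`. -/
structure IsCoord (e : OpenPartialHomeomorph N G) : Prop where
  smooth : ContMDiffOn J 𝓘(ℝ, G) ∞ e e.source
  smooth_symm : ContMDiffOn 𝓘(ℝ, G) J ∞ e.symm e.target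

variable {J}

lemma IsCoord.restrOpen {e : OpenPartialHomeomorph N G} (he : IsCoord J e) {s : Set N}
    (hs : IsOpen s) : IsCoord J (e.restrOpen s hs) :=
  ⟨he.smooth.mono inter_subset_left, he.smooth_symm.mono inter_subset_left⟩

lemma IsCoord.trans {e : OpenPartialHomeomorph N G} (he : IsCoord J e)
    {τ : OpenPartialHomeomorph G G'} (hτ : ContDiffOn ℝ ∞ τ τ.source)
    (hτ' : ContDiffOn ℝ ∞ τ.symm τ.target) : IsCoord J (e.trans τ) := by
  constructor
  · exact hτ.contMDiffOn.comp (he.smooth.mono inter_subset_left) fun x hx ↦ hx.2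
  · exact he.smooth_symm.comp (hτ'.contMDiffOn.mono inter_subset_left) fun x hx ↦ hx.2

variable (J) in
/-- The chart of `N` at a point, as a local coordinate system. -/
def coordAt [J.Boundaryless] (y : N) : OpenPartialHomeomorph N E :=
  (chartAt H y).transHomeomorph J.toHomeomorph

lemma isCoord_of_mem_maximalAtlas [J.Boundaryless] [IsManifold J ∞ N] {ψ : OpenPartialHomeomorph N H}
    (hψ : ψ ∈ IsManifold.maximalAtlas J ∞ N) :
    IsCoord J (ψ.transHomeomorph J.toHomeomorph) := by
  constructor
  · exact ψ.contMDiffOn_extend hψ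
  · have h := contMDiffOn_extend_symm (I := J) hψ
    exact h.mono fun z hz ↦ ⟨J.symm z, hz, J.right_inv (by simp [J.range_eq_univ])⟩

lemma isCoord_coordAt [J.Boundaryless] [IsManifold J ∞ N] (y : N) : IsCoord J (coordAt J y) :=
  isCoord_of_mem_maximalAtlas (IsManifold.chart_mem_maximalAtlas y)

lemma mem_coordAt_source [J.Boundaryless] (y : N) : y ∈ (coordAt J y).source := by
  simp [coordAt]

end Coord

section Adapted

open Filter

variable {E : Type*} [NormedAddCommGroup E] [NormedSpace ℝ E] [FiniteDimensional ℝ E]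
  {H : Type*} [TopologicalSpace H] {I : ModelWithCorners ℝ E H}
  {M : Type*} [TopologicalSpace M] [ChartedSpace H M]
  {E' : Type*} [NormedAddCommGroup E'] [NormedSpace ℝ E'] [FiniteDimensional ℝ E']
  {H' : Type*} [TopologicalSpace H'] {J : ModelWithCorners ℝ E' H'} [J.Boundaryless]
  {N : Type*} [TopologicalSpace N] [ChartedSpace H' N] [IsManifold J ∞ N]

/-- The inverse function theorem for a smooth map of a vector space, as a local diffeomorphism. -/
lemma exists_openPartialHomeomorph_of_injective_fderiv {f : E → E} (hf : ContDiff ℝ ∞ f) {a : E}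
    (ha : Function.Injective (fderiv ℝ f a)) :
    ∃ τ : OpenPartialHomeomorph E E, a ∈ τ.source ∧ (∀ x, τ x = f x) ∧
      ContDiffOn ℝ ∞ τ τ.source ∧ ContDiffOn ℝ ∞ τ.symm τ.target := by
  have : CompleteSpace E := FiniteDimensional.complete ℝ E
  have key : ∀ x, Function.Injective (fderiv ℝ f x) →
      ∃ A : E ≃L[ℝ] E, (A : E →L[ℝ] E) = fderiv ℝ f x := fun x hx ↦
    ⟨ContinuousLinearEquiv.ofBijective (fderiv ℝ f x) (LinearMap.ker_eq_bot.2 hx)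
      (LinearMap.range_eq_top.2 (LinearMap.injective_iff_surjective.1 hx)), rfl⟩
  obtain ⟨A, hA⟩ := key a ha
  have hd : HasFDerivAt f (A : E →L[ℝ] E) a := by
    rw [hA]
    exact (hf.differentiable (by simp)).differentiableAt.hasFDerivAt
  set τ₀ := hf.contDiffAt.toOpenPartialHomeomorph f hd (by simp) with hτ₀
  have hcont : Continuous (fderiv ℝ f) := hf.continuous_fderiv (by simp)
  set S : Set E := fderiv ℝ f ⁻¹' range ((↑) : (E ≃L[ℝ] E) → E →L[ℝ] E) with hS
  have hSo : IsOpen S := (ContinuousLinearEquiv.isOpen).preimage hcont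
  refine ⟨τ₀.restrOpen S hSo, ⟨hf.contDiffAt.mem_toOpenPartialHomeomorph_source hd (by simp),
    ⟨A, hA⟩⟩, fun x ↦ rfl, hf.contDiffOn, ?_⟩
  intro z hz
  obtain ⟨hz1, B, hB⟩ := hz
  refine (OpenPartialHomeomorph.contDiffAt_symm τ₀ (f₀' := B) hz1 ?_ ?_).contDiffWithinAt
  · rw [hB]
    exact (hf.differentiable (by simp)).differentiableAt.hasFDerivAt
  · exact hf.contDiffAt

/-- The transition map between two charts of a manifold with boundary extends to a local
diffeomorphism of the model vector space. -/
lemma exists_extension_of_chart_transition {ℓ : E →L[ℝ] ℝ} {e₀ : E} (h₀ : ℓ e₀ = 1)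
    (hI : range I = {x | 0 ≤ ℓ x}) {φ φ' : OpenPartialHomeomorph M H}
    (hφ : φ ∈ IsManifold.maximalAtlas I ∞ M) (hφ' : φ' ∈ IsManifold.maximalAtlas I ∞ M) {x : M}
    (hx : x ∈ φ.source) (hx' : x ∈ φ'.source) :
    ∃ τ : OpenPartialHomeomorph E E, φ.extend I x ∈ τ.source ∧
      ContDiffOn ℝ ∞ τ τ.source ∧ ContDiffOn ℝ ∞ τ.symm τ.target ∧
      ∀ᶠ p in 𝓝 x, τ (φ.extend I p) = φ'.extend I p := by
  have : CompleteSpace E := FiniteDimensional.complete ℝ E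
  -- both transition maps extend smoothly across the boundary
  have key : ∀ (φ φ' : OpenPartialHomeomorph M H), φ ∈ IsManifold.maximalAtlas I ∞ M →
      φ' ∈ IsManifold.maximalAtlas I ∞ M → x ∈ φ.source → x ∈ φ'.source →
      ∃ g : E → E, ContDiff ℝ ∞ g ∧
        ∀ᶠ z in 𝓝 (φ.extend I x), 0 ≤ ℓ z → g z = φ'.extend I ((φ.extend I).symm z) := by
    intro φ φ' hφ hφ' hx hx'
    have h1 := ModelWithCorners.contDiffOn_extendCoordChange (I := I) hφ hφ'
    have h2 := ModelWithCorners.extendCoordChange_source_mem_nhdsWithin' (I := I) hx hx'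
    rw [mem_nhdsWithin] at h2
    obtain ⟨V, hV, hxV, hVs⟩ := h2
    exact exists_contDiff_eventually_eq_on_halfSpace h₀ hV hxV (h1.mono (hI ▸ hVs))
  obtain ⟨g, hg, hgeq⟩ := key φ φ' hφ hφ' hx hx'
  obtain ⟨g', hg', hgeq'⟩ := key φ' φ hφ' hφ hx' hx
  have hmap : map (φ.extend I) (𝓝 x) = 𝓝[range I] φ.extend I x := φ.map_extend_nhds hx
  have hg0 : ∀ᶠ p in 𝓝 x, g (φ.extend I p) = φ'.extend I p := by
    have h1 := (φ.continuousAt_extend (I := I) hx).eventually hgeq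
    filter_upwards [h1, φ.open_source.mem_nhds hx] with p hp1 hp2
    rw [hp1, φ.extend_left_inv hp2]
    have : φ.extend I p ∈ range I := mem_range_self _
    rwa [hI] at this
  have hgx : g (φ.extend I x) = φ'.extend I x := hg0.self_of_nhds
  have hinv : ∀ᶠ z in 𝓝[range I] φ.extend I x, g' (g z) = z := by
    rw [← hmap, eventually_map]
    have h1 := (φ'.continuousAt_extend (I := I) hx').eventually hgeq'
    filter_upwards [h1, hg0, φ'.open_source.mem_nhds hx'] with p hp1 hp2 hp3
    rw [hp2, hp1, φ'.extend_left_inv hp3]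
    have : φ'.extend I p ∈ range I := mem_range_self _
    rwa [hI] at this
  -- the extensions are inverse to each other on `range I` only, but this determines the derivative
  have hdiff : fderiv ℝ g' (g (φ.extend I x)) ∘L fderiv ℝ g (φ.extend I x)
      = ContinuousLinearMap.id ℝ E := by
    have h1 : HasFDerivWithinAt (fun z ↦ g' (g z)) (fderiv ℝ g' (g (φ.extend I x)) ∘L
        fderiv ℝ g (φ.extend I x)) (range I) (φ.extend I x) :=
      (((hg'.differentiable (by simp)).differentiableAt.hasFDerivAt).comp (φ.extend I x)
        ((hg.differentiable (by simp)).differentiableAt.hasFDerivAt)).hasFDerivWithinAt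
    have h2 : HasFDerivWithinAt (fun z ↦ g' (g z)) (ContinuousLinearMap.id ℝ E) (range I)
        (φ.extend I x) :=
      (hasFDerivWithinAt_id _ _).congr_of_eventuallyEq hinv
        (hinv.self_of_nhdsWithin (mem_range_self _))
    exact (I.uniqueDiffOn _ (mem_range_self _)).eq h1 h2
  obtain ⟨τ, h1, h2, h3, h4⟩ := exists_openPartialHomeomorph_of_injective_fderiv hg
    (a := φ.extend I x) (fun v w hvw ↦ by
      have hv := congrArg (fun L ↦ L v) hdiff
      have hw := congrArg (fun L ↦ L w) hdiff
      simp only [ContinuousLinearMap.comp_apply, ContinuousLinearMap.id_apply] at hv hw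
      rw [← hv, ← hw, hvw])
  refine ⟨τ, h1, h3, h4, ?_⟩
  filter_upwards [hg0] with p hp
  rw [h2, hp]

/-- A smooth embedding of codimension zero of a manifold with boundary `M` into a manifold `N`
without boundary extends every chart of `M` to a local coordinate system of `N`. -/
theorem exists_isCoord_extending_extChartAt [IsManifold I ∞ M] {ℓ : E →L[ℝ] ℝ} {e₀ : E}
    (h₀ : ℓ e₀ = 1) (hI : range I = {x | 0 ≤ ℓ x}) (hdim : Module.finrank ℝ E = Module.finrank ℝ E')
    {f : M → N} (hf : IsSmoothEmbedding I J ∞ f) (x : M) :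
    ∃ e : OpenPartialHomeomorph N E, IsCoord J e ∧ f x ∈ e.source ∧
      (∀ p, f p ∈ e.source → p ∈ (extChartAt I x).source ∧ e (f p) = extChartAt I x p) ∧
      ∀ y ∈ e.source, e y ∈ range I → y ∈ range f := by
  have him := hf.isImmersion.isImmersionAt x
  set φ := him.domChart
  set ψ := him.codChart
  -- the complement of an immersion between spaces of equal dimension is trivial
  have hA : ∃ A : E ≃L[ℝ] E', ∀ z, A z = him.equiv (z, 0) := by
    have hfin : FiniteDimensional ℝ (E × him.complement) :=
      him.equiv.symm.toLinearEquiv.finiteDimensional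
    have hfin' : FiniteDimensional ℝ him.complement :=
      Module.Finite.of_surjective (LinearMap.snd ℝ E him.complement) LinearMap.snd_surjective
    have h1 := him.equiv.toLinearEquiv.finrank_eq
    rw [Module.finrank_prod, hdim] at h1
    have h2 : Module.finrank ℝ him.complement = 0 := by omega
    let L : E →ₗ[ℝ] E' := him.equiv.toLinearMap ∘ₗ LinearMap.inl ℝ E him.complement
    have hL : Function.Injective L := him.equiv.injective.comp LinearMap.inl_injective
    exact ⟨(LinearEquiv.ofInjectiveOfFinrankEq L hL hdim).toContinuousLinearEquiv, fun z ↦ rfl⟩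
  obtain ⟨A, hA⟩ := hA
  have hψf : ∀ p ∈ φ.source, A.symm (ψ.extend J (f p)) = φ.extend I p := by
    intro p hp
    have h1 := him.writtenInCharts
      ((φ.extend I).map_source (show p ∈ (φ.extend I).source by rwa [φ.extend_source]))
    simp only [Function.comp_apply] at h1
    rw [φ.extend_left_inv hp] at h1
    rw [h1, ← hA, A.symm_apply_apply]
  obtain ⟨τ, hτx, hτ, hτ', hτφ⟩ := exists_extension_of_chart_transition h₀ hI
    him.domChart_mem_maximalAtlas (IsManifold.chart_mem_maximalAtlas x) him.mem_domChart_source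
    (mem_chart_source H x)
  set e₁ : OpenPartialHomeomorph N E :=
    (ψ.transHomeomorph J.toHomeomorph).trans A.symm.toHomeomorph.toOpenPartialHomeomorph with he₁
  have he₁c : IsCoord J e₁ :=
    (isCoord_of_mem_maximalAtlas him.codChart_mem_maximalAtlas).trans
      A.symm.contDiff.contDiffOn A.contDiff.contDiffOn
  have he₁f : ∀ p ∈ φ.source, e₁ (f p) = φ.extend I p := fun p hp ↦ hψf p hp
  have he₁x : f x ∈ e₁.source := by
    simpa [he₁] using him.mem_codChart_source
  set e₂ := e₁.trans τ
  have he₂c : IsCoord J e₂ := he₁c.trans hτ hτ'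
  have he₂x : f x ∈ e₂.source := by
    refine ⟨he₁x, ?_⟩
    change e₁ (f x) ∈ τ.source
    rw [he₁f x him.mem_domChart_source]
    exact hτx
  have hgood : ∀ᶠ p in 𝓝 x, p ∈ (extChartAt I x).source ∧ e₂ (f p) = extChartAt I x p := by
    filter_upwards [hτφ, φ.open_source.mem_nhds him.mem_domChart_source,
      extChartAt_source_mem_nhds (I := I) x] with p hp1 hp2 hp3
    refine ⟨hp3, ?_⟩
    change τ (e₁ (f p)) = _
    rw [he₁f p hp2, hp1]
    rfl
  -- shrink the domain so that it only meets the image of the chart domain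
  obtain ⟨O, hO, hxO, hOs⟩ : ∃ O : Set N, IsOpen O ∧ f x ∈ O ∧
      ∀ p, f p ∈ O → p ∈ (extChartAt I x).source ∧ e₂ (f p) = extChartAt I x p := by
    rw [hf.isEmbedding.isInducing.nhds_eq_comap, eventually_comap] at hgood
    obtain ⟨O, hO1, hO2, hO3⟩ := eventually_nhds_iff.1 hgood
    exact ⟨O, hO2, hO3, fun p hp ↦ hO1 _ hp p rfl⟩
  set e₃ := e₂.restrOpen O hO
  have he₃x : f x ∈ e₃.source := ⟨he₂x, hxO⟩
  have he₃f : ∀ p, f p ∈ e₃.source → p ∈ (extChartAt I x).source ∧ e₃ (f p) = extChartAt I x p :=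
    fun p hp ↦ hOs p hp.2
  -- shrink the domain so that all its points over `range I` lie in the image of `f`
  have hsurj : ∀ᶠ z in 𝓝 (extChartAt I x x), z ∈ range I →
      z ∈ (extChartAt I x).target ∧ f ((extChartAt I x).symm z) ∈ e₃.source := by
    have h1 : ∀ᶠ z in 𝓝[range I] (extChartAt I x x), f ((extChartAt I x).symm z) ∈ e₃.source := by
      have h2 : ContinuousAt (fun z ↦ f ((extChartAt I x).symm z)) (extChartAt I x x) := by
        refine ContinuousAt.comp (g := f) ?_ (continuousAt_extChartAt_symm x)
        exact hf.isEmbedding.continuous.continuousAt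
      have h3 : e₃.source ∈ 𝓝 (f ((extChartAt I x).symm (extChartAt I x x))) := by
        rw [extChartAt_to_inv]
        exact e₃.open_source.mem_nhds he₃x
      exact (h2.eventually h3).filter_mono nhdsWithin_le_nhds
    have h4 := h1.and (extChartAt_target_mem_nhdsWithin (I := I) x)
    filter_upwards [eventually_nhdsWithin_iff.1 h4] with z hz hzI
    exact ⟨(hz hzI).2, (hz hzI).1⟩
  have hsurj' : ∀ᶠ y in 𝓝 (f x), e₃ y ∈ range I →
      e₃ y ∈ (extChartAt I x).target ∧ f ((extChartAt I x).symm (e₃ y)) ∈ e₃.source := by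
    have h1 := e₃.continuousAt he₃x
    rw [ContinuousAt, (he₃f x he₃x).2] at h1
    exact h1.eventually hsurj
  obtain ⟨O', hO'1, hO'2, hO'3⟩ := eventually_nhds_iff.1 hsurj'
  refine ⟨e₃.restrOpen O' hO'2, he₂c.restrOpen hO |>.restrOpen hO'2, ⟨he₃x, hO'3⟩,
    fun p hp ↦ he₃f p hp.1, fun y hy hyI ↦ ?_⟩
  obtain ⟨h1, h2⟩ := hO'1 y hy.2 hyI
  refine ⟨(extChartAt I x).symm (e₃ y), e₃.injOn h2 hy.1 ?_⟩
  rw [(he₃f _ h2).2, (extChartAt I x).right_inv h1]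

end Adapted

/-! ### Tensor fields in local coordinates -/

section Toolkit

variable {E : Type*} [NormedAddCommGroup E] [NormedSpace ℝ E]
  {H : Type*} [TopologicalSpace H] {J : ModelWithCorners ℝ E H}
  {N : Type*} [TopologicalSpace N] [ChartedSpace H N]
  {G : Type*} [NormedAddCommGroup G] [NormedSpace ℝ G]
  {G' : Type*} [NormedAddCommGroup G'] [NormedSpace ℝ G']

variable (J) in
/-- The derivative of a local coordinate system at a point of the manifold. -/
def dC (e : OpenPartialHomeomorph N G) (y : N) : TangentSpace J y →L[ℝ] G :=
  mfderiv J 𝓘(ℝ, G) e y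

variable (J) in
/-- The inverse of the derivative of a local coordinate system at a point of the manifold. -/
def dCinv (e : OpenPartialHomeomorph N G) (y : N) : G →L[ℝ] TangentSpace J y :=
  (dC J e y).inverse

section

variable {e : OpenPartialHomeomorph N G}

lemma IsCoord.mdifferentiable (he : IsCoord J e) : e.MDifferentiable J 𝓘(ℝ, G) :=
  ⟨he.smooth.mdifferentiableOn (by simp), he.smooth_symm.mdifferentiableOn (by simp)⟩

/-- The derivative of a local coordinate system as an isomorphism. -/
def IsCoord.equiv (he : IsCoord J e) {y : N} (hy : y ∈ e.source) : TangentSpace J y ≃L[ℝ] G :=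
  he.mdifferentiable.mfderiv hy

lemma IsCoord.coe_equiv (he : IsCoord J e) {y : N} (hy : y ∈ e.source) :
    (he.equiv hy : TangentSpace J y →L[ℝ] G) = dC J e y := rfl

lemma IsCoord.coe_equiv_symm (he : IsCoord J e) {y : N} (hy : y ∈ e.source) :
    ((he.equiv hy).symm : G →L[ℝ] TangentSpace J y) = dCinv J e y := by
  rw [dCinv, ← he.coe_equiv hy, ContinuousLinearMap.inverse_equiv]

lemma IsCoord.dC_dCinv (he : IsCoord J e) {y : N} (hy : y ∈ e.source) (g : G) :
    dC J e y (dCinv J e y g) = g := by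
  rw [← he.coe_equiv hy, ← he.coe_equiv_symm hy]
  exact (he.equiv hy).apply_symm_apply g

lemma IsCoord.dCinv_dC (he : IsCoord J e) {y : N} (hy : y ∈ e.source) (v : TangentSpace J y) :
    dCinv J e y (dC J e y v) = v := by
  rw [← he.coe_equiv hy, ← he.coe_equiv_symm hy]
  exact (he.equiv hy).symm_apply_apply v

lemma IsCoord.mfderiv_symm (he : IsCoord J e) {z : G} (hz : z ∈ e.target) :
    mfderiv 𝓘(ℝ, G) J e.symm z = dCinv J e (e.symm z) := by
  have h := he.mdifferentiable.comp_symm_deriv hz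
  ext g
  have h1 : dC J e (e.symm z) (mfderiv 𝓘(ℝ, G) J e.symm z g) = g := congrArg (fun L ↦ L g) h
  have h2 := he.dCinv_dC (e.map_target hz) (mfderiv 𝓘(ℝ, G) J e.symm z g)
  rw [← h2, h1]
  rfl

variable [IsManifold J ∞ N]

/-- A smooth vector field given in coordinates is smooth. -/
lemma IsCoord.contMDiffOn_dCinv (he : IsCoord J e) {V : G → G} (hV : ContDiffOn ℝ ∞ V e.target) :
    ContMDiffOn J J.tangent ∞ (fun y ↦ (⟨y, dCinv J e y (V (e y))⟩ : TangentBundle J N))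
      e.source := by
  have h1 := he.smooth_symm.contMDiffOn_tangentMapWithin (m := ∞) (by simp)
    e.open_target.uniqueMDiffOn
  have h2 : ContMDiffOn J (𝓘(ℝ, G)).tangent ∞
      (fun y ↦ (⟨e y, V (e y)⟩ : TangentBundle 𝓘(ℝ, G) G)) e.source := by
    have h := (contMDiffOn_vectorSpace_iff_contDiffOn (V := V)).2 hV
    exact h.comp he.smooth e.mapsTo
  have h3 := h1.comp h2 (fun y hy ↦ e.map_source hy)
  refine h3.congr fun y hy ↦ ?_
  simp only [Function.comp_apply, tangentMapWithin]
  have h4 : mfderivWithin 𝓘(ℝ, G) J e.symm e.target (e y) = mfderiv 𝓘(ℝ, G) J e.symm (e y) :=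
    mfderivWithin_of_isOpen e.open_target (e.map_source hy)
  rw [h4, he.mfderiv_symm (e.map_source hy), e.left_inv hy]
  rfl

/-- The coordinate expression of a smooth vector field is smooth. -/
lemma IsCoord.contMDiffWithinAt_dC (he : IsCoord J e) {s : Set N} {y : N} (hy : y ∈ e.source)
    {X : Π y : N, TangentSpace J y}
    (hX : ContMDiffWithinAt J J.tangent ∞ (fun y ↦ (⟨y, X y⟩ : TangentBundle J N)) s y) :
    ContMDiffWithinAt J 𝓘(ℝ, G) ∞ (fun y ↦ dC J e y (X y)) s y := by
  have h1 := he.smooth.contMDiffOn_tangentMapWithin (m := ∞) (by simp)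
    e.open_source.uniqueMDiffOn
  have h0 : IsOpen (π E (TangentSpace J) ⁻¹' e.source) :=
    e.open_source.preimage (FiberBundle.continuous_proj E (TangentSpace J))
  have h2 := (h1.contMDiffAt (h0.mem_nhds (x := ⟨y, X y⟩) hy)).comp_contMDiffWithinAt y hX
  have h3 := (contMDiff_snd_tangentBundle_modelSpace (n := ∞) G 𝓘(ℝ, G)).contMDiffAt
    |>.comp_contMDiffWithinAt y h2
  have h4 : ∀ y ∈ e.source, dC J e y (X y) = mfderivWithin J 𝓘(ℝ, G) e e.source y (X y) := by
    intro y hy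
    rw [mfderivWithin_of_isOpen e.open_source hy]
    rfl
  refine h3.congr_of_eventuallyEq ?_ (h4 y hy)
  filter_upwards [nhdsWithin_le_nhds (e.open_source.mem_nhds hy)] with y hy using h4 y hy

end

omit [NormedAddCommGroup G] [NormedSpace ℝ G] in
lemma contMDiffAt_clm_of_forall {F F' : Type*} [NormedAddCommGroup F] [NormedSpace ℝ F]
    [FiniteDimensional ℝ F] [NormedAddCommGroup F'] [NormedSpace ℝ F'] {f : N → F →L[ℝ] F'} {y : N}
    (h : ∀ v, ContMDiffAt J 𝓘(ℝ, F') ∞ (fun x ↦ f x v) y) :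
    ContMDiffAt J 𝓘(ℝ, F →L[ℝ] F') ∞ f y := by
  let d := Module.finrank ℝ F
  have hd : d = Module.finrank ℝ (Fin d → ℝ) := (Module.finrank_fin_fun ℝ).symm
  let e₁ := ContinuousLinearEquiv.ofFinrankEq hd
  let e₂ := (e₁.arrowCongr (1 : F' ≃L[ℝ] F')).trans (ContinuousLinearEquiv.piRing (Fin d))
  rw [← Function.id_comp f, ← e₂.symm_comp_self]
  refine (e₂.symm.contDiff (n := ∞)).contMDiff.contMDiffAt.comp y ?_
  rw [contMDiffAt_pi_space]
  exact fun i ↦ h _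

variable [IsManifold J ∞ N] [FiniteDimensional ℝ E]

omit [FiniteDimensional ℝ E] in
lemma contMDiffAt_symm_trivializationAt (y₀ : N) (v : E) :
    ContMDiffAt J J.tangent ∞
      (fun y ↦ (⟨y, (trivializationAt E (TangentSpace J) y₀).symm y v⟩ : TangentBundle J N)) y₀ := by
  rw [contMDiffAt_section]
  refine (contMDiffAt_const (c := v)).congr_of_eventuallyEq ?_
  filter_upwards [(trivializationAt E (TangentSpace J) y₀).open_baseSet.mem_nhds
    (mem_baseSet_trivializationAt E (TangentSpace J) y₀)] with y hy
  rw [Trivialization.apply_mk_symm _ hy]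

/-- A field of bilinear forms is smooth if its values on smooth vector fields are smooth. -/
lemma contMDiffAt_form_of_forall
    {S : Π y : N, TangentSpace J y →L[ℝ] TangentSpace J y →L[ℝ] ℝ} {y₀ : N}
    (h : ∀ X Y : Π y : N, TangentSpace J y,
      ContMDiffAt J J.tangent ∞ (fun y ↦ (⟨y, X y⟩ : TangentBundle J N)) y₀ →
      ContMDiffAt J J.tangent ∞ (fun y ↦ (⟨y, Y y⟩ : TangentBundle J N)) y₀ →
      ContMDiffAt J 𝓘(ℝ, ℝ) ∞ (fun y ↦ S y (X y) (Y y)) y₀) :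
    ContMDiffAt J (J.prod 𝓘(ℝ, E →L[ℝ] E →L[ℝ] ℝ)) ∞
      (fun y ↦ TotalSpace.mk' (E →L[ℝ] E →L[ℝ] ℝ)
        (E := fun y : N ↦ TangentSpace J y →L[ℝ] TangentSpace J y →L[ℝ] ℝ) y (S y)) y₀ := by
  rw [contMDiffAt_hom_bundle]
  refine ⟨contMDiffAt_id, ?_⟩
  set τ := trivializationAt E (TangentSpace J) y₀ with hτ
  have hy₀ : y₀ ∈ τ.baseSet := mem_baseSet_trivializationAt E (TangentSpace J) y₀
  refine contMDiffAt_clm_of_forall fun v ↦ contMDiffAt_clm_of_forall fun w ↦ ?_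
  refine (h _ _ (contMDiffAt_symm_trivializationAt y₀ v)
    (contMDiffAt_symm_trivializationAt y₀ w)).congr_of_eventuallyEq ?_
  filter_upwards [τ.open_baseSet.mem_nhds hy₀] with y hy
  rw [inCoordinates_apply_eq₂ hy hy (mem_univ _)]
  simp

/-- A field of bilinear forms on the cotangent spaces is smooth if its values on smooth covector
fields are smooth. -/
lemma contMDiffAt_bivector_of_forall
    {P : Π y : N, (TangentSpace J y →L[ℝ] ℝ) →L[ℝ] (TangentSpace J y →L[ℝ] ℝ) →L[ℝ] ℝ} {y₀ : N}
    (h : ∀ α β : Π y : N, TangentSpace J y →L[ℝ] ℝ,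
      (∀ X : Π y : N, TangentSpace J y,
        ContMDiffAt J J.tangent ∞ (fun y ↦ (⟨y, X y⟩ : TangentBundle J N)) y₀ →
        ContMDiffAt J 𝓘(ℝ, ℝ) ∞ (fun y ↦ α y (X y)) y₀) →
      (∀ X : Π y : N, TangentSpace J y,
        ContMDiffAt J J.tangent ∞ (fun y ↦ (⟨y, X y⟩ : TangentBundle J N)) y₀ →
        ContMDiffAt J 𝓘(ℝ, ℝ) ∞ (fun y ↦ β y (X y)) y₀) →
      ContMDiffAt J 𝓘(ℝ, ℝ) ∞ (fun y ↦ P y (α y) (β y)) y₀) :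
    ContMDiffAt J (J.prod 𝓘(ℝ, (E →L[ℝ] ℝ) →L[ℝ] (E →L[ℝ] ℝ) →L[ℝ] ℝ)) ∞
      (fun y ↦ TotalSpace.mk' ((E →L[ℝ] ℝ) →L[ℝ] (E →L[ℝ] ℝ) →L[ℝ] ℝ)
        (E := fun y : N ↦
          (TangentSpace J y →L[ℝ] ℝ) →L[ℝ] (TangentSpace J y →L[ℝ] ℝ) →L[ℝ] ℝ) y (P y)) y₀ := by
  rw [contMDiffAt_hom_bundle]
  refine ⟨contMDiffAt_id, ?_⟩
  set τ := trivializationAt E (TangentSpace J) y₀ with hτ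
  have hy₀ : y₀ ∈ τ.baseSet := mem_baseSet_trivializationAt E (TangentSpace J) y₀
  have hα : ∀ (α : E →L[ℝ] ℝ) (X : Π y : N, TangentSpace J y),
      ContMDiffAt J J.tangent ∞ (fun y ↦ (⟨y, X y⟩ : TangentBundle J N)) y₀ →
      ContMDiffAt J 𝓘(ℝ, ℝ) ∞ (fun y ↦ (α.comp (τ.continuousLinearMapAt ℝ y)) (X y)) y₀ := by
    intro α X hX
    rw [contMDiffAt_section] at hX
    have h1 := (α.contDiff (n := ∞)).contMDiff.contMDiffAt.comp y₀ hX
    refine h1.congr_of_eventuallyEq ?_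
    filter_upwards [τ.open_baseSet.mem_nhds hy₀] with y hy
    simp only [ContinuousLinearMap.comp_apply, Function.comp_apply]
    rw [Trivialization.continuousLinearMapAt_apply, Trivialization.coe_linearMapAt_of_mem _ hy]
  refine contMDiffAt_clm_of_forall fun α ↦ contMDiffAt_clm_of_forall fun β ↦ ?_
  refine (h _ _ (hα α) (hα β)).congr_of_eventuallyEq ?_
  filter_upwards [τ.open_baseSet.mem_nhds hy₀] with y hy
  have hy' : y ∈ (trivializationAt (E →L[ℝ] ℝ) (fun y : N ↦ TangentSpace J y →L[ℝ] ℝ) y₀).baseSet := by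
    rw [hom_trivializationAt_baseSet]
    exact ⟨hy, mem_univ _⟩
  have key : ∀ α : E →L[ℝ] ℝ,
      (trivializationAt (E →L[ℝ] ℝ) (fun y : N ↦ TangentSpace J y →L[ℝ] ℝ) y₀).symm y α
        = α.comp (τ.continuousLinearMapAt ℝ y) := by
    intro α
    have h1 : (trivializationAt (E →L[ℝ] ℝ) (fun y : N ↦ TangentSpace J y →L[ℝ] ℝ) y₀
        ⟨y, α.comp (τ.continuousLinearMapAt ℝ y)⟩).2 = α := by
      ext v
      rw [hom_trivializationAt_apply]
      simp only [ContinuousLinearMap.inCoordinates, ContinuousLinearMap.comp_apply]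
      rw [Trivialization.continuousLinearMapAt_symmL _ hy]
      simp
    conv_lhs => rw [← h1]
    exact Trivialization.symm_apply_apply_mk _ hy' _
  rw [inCoordinates_apply_eq₂ hy' hy' (mem_univ _), key, key]
  simp

end Toolkit

section PullForm

variable {V W : Type*} [AddCommGroup V] [Module ℝ V] [TopologicalSpace V]
  [AddCommGroup W] [Module ℝ W] [TopologicalSpace W]

/-- The pull-back of a bilinear form under a linear map. -/
def pullForm (L : V →L[ℝ] W) (S : W →L[ℝ] W →L[ℝ] ℝ) : V →L[ℝ] V →L[ℝ] ℝ :=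
  (ContinuousLinearMap.precomp ℝ L).comp (S.comp L)

@[simp] lemma pullForm_apply (L : V →L[ℝ] W) (S : W →L[ℝ] W →L[ℝ] ℝ) (v w : V) :
    pullForm L S v w = S (L v) (L w) := rfl

end PullForm

section Local

variable {E : Type*} [NormedAddCommGroup E] [NormedSpace ℝ E]
  {H : Type*} [TopologicalSpace H] {J : ModelWithCorners ℝ E H}
  {N : Type*} [TopologicalSpace N] [ChartedSpace H N]
  {G : Type*} [NormedAddCommGroup G] [NormedSpace ℝ G]
  {G' : Type*} [NormedAddCommGroup G'] [NormedSpace ℝ G']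

variable (J) in
/-- The coordinate expression of a field of bilinear forms. -/
def loc2 (e : OpenPartialHomeomorph N G)
    (S : Π y : N, TangentSpace J y →L[ℝ] TangentSpace J y →L[ℝ] ℝ) (z : G) : G →L[ℝ] G →L[ℝ] ℝ :=
  pullForm (dCinv J e (e.symm z)) (S (e.symm z))

variable (J) in
/-- The coordinate expression of a vector field. -/
def locV (e : OpenPartialHomeomorph N G) (X : Π y : N, TangentSpace J y) (z : G) : G :=
  dC J e (e.symm z) (X (e.symm z))

/-- The derivative of a function on the manifold, computed in coordinates. -/
lemma IsCoord.mvfderiv_eq {e : OpenPartialHomeomorph N G} (he : IsCoord J e) {F : Type*}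
    [NormedAddCommGroup F] [NormedSpace ℝ F] {f : N → F} {y : N}
    (hy : y ∈ e.source) (hf : MDifferentiableAt J 𝓘(ℝ, F) f y) :
    mvfderiv J f y = (fderiv ℝ (fun z ↦ f (e.symm z)) (e y)).comp (dC J e y) := by
  have h1 : MDifferentiableAt 𝓘(ℝ, G) 𝓘(ℝ, F) (fun z ↦ f (e.symm z)) (e y) := by
    refine MDifferentiableAt.comp (I' := J) (g := f) (e y) ?_
      (he.mdifferentiable.mdifferentiableAt_symm (e.map_source hy))
    rwa [e.left_inv hy]
  have h2 : HasMFDerivAt J 𝓘(ℝ, F) ((fun z ↦ f (e.symm z)) ∘ e) y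
      ((mfderiv 𝓘(ℝ, G) 𝓘(ℝ, F) (fun z ↦ f (e.symm z)) (e y)).comp (mfderiv J 𝓘(ℝ, G) e y)) :=
    h1.hasMFDerivAt.comp y (he.mdifferentiable.mdifferentiableAt hy).hasMFDerivAt
  have h3 : HasMFDerivAt J 𝓘(ℝ, F) f y
      ((mfderiv 𝓘(ℝ, G) 𝓘(ℝ, F) (fun z ↦ f (e.symm z)) (e y)).comp (mfderiv J 𝓘(ℝ, G) e y)) := by
    refine h2.congr_of_eventuallyEq ?_
    filter_upwards [e.open_source.mem_nhds hy] with x hx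
    simp [e.left_inv hx]
  have h4 := h3.mfderiv
  rw [mfderiv_eq_fderiv] at h4
  ext v
  have h5 := congrArg (fun L ↦ L v) h4
  exact h5

variable [IsManifold J ∞ N]

/-- The pull-back of a smooth field of bilinear forms under a smooth map of a vector space is
smooth. -/
lemma contDiffOn_pullForm_mfderivWithin [FiniteDimensional ℝ G] {f : G → N} {s : Set G}
    (hs : UniqueDiffOn ℝ s) (hf : ContMDiffOn 𝓘(ℝ, G) J ∞ f s)
    {S : Π y : N, TangentSpace J y →L[ℝ] TangentSpace J y →L[ℝ] ℝ} {t : Set N} (hst : MapsTo f s t)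
    (hS : ContMDiffOn J (J.prod 𝓘(ℝ, E →L[ℝ] E →L[ℝ] ℝ)) ∞
      (fun y ↦ TotalSpace.mk' (E →L[ℝ] E →L[ℝ] ℝ)
        (E := fun y : N ↦ TangentSpace J y →L[ℝ] TangentSpace J y →L[ℝ] ℝ) y (S y)) t) :
    ContDiffOn ℝ ∞ (fun z ↦ (pullForm (mfderivWithin 𝓘(ℝ, G) J f s z) (S (f z)) :
      G →L[ℝ] G →L[ℝ] ℝ)) s := by
  have h0 : ∀ v : G, ContMDiffOn 𝓘(ℝ, G) J.tangent ∞
      (fun z ↦ (⟨f z, mfderivWithin 𝓘(ℝ, G) J f s z v⟩ : TangentBundle J N)) s := by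
    intro v
    have h1 := hf.contMDiffOn_tangentMapWithin (m := ∞) (by simp) hs.uniqueMDiffOn
    have h2 : ContMDiffOn 𝓘(ℝ, G) (𝓘(ℝ, G)).tangent ∞
      (fun z ↦ (⟨z, v⟩ : TangentBundle 𝓘(ℝ, G) G)) s :=
      (contMDiffOn_vectorSpace_iff_contDiffOn (V := fun _ ↦ v)).2 contDiffOn_const
    exact h1.comp h2 fun z hz ↦ hz
  refine contDiffOn_clm_apply.2 fun v ↦ contDiffOn_clm_apply.2 fun w ↦ ?_
  have h3 := (hS.comp hf hst).clm_bundle_apply₂ (F₃ := ℝ) (E₃ := Bundle.Trivial N ℝ) (h0 v) (h0 w)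
  intro z hz
  have h4 := (contMDiffWithinAt_totalSpace.1 (h3 z hz)).2
  exact h4.contDiffWithinAt

lemma IsCoord.contDiffOn_loc2 [FiniteDimensional ℝ G] {e : OpenPartialHomeomorph N G}
    (he : IsCoord J e) {S : Π y : N, TangentSpace J y →L[ℝ] TangentSpace J y →L[ℝ] ℝ}
    (hS : ContMDiffOn J (J.prod 𝓘(ℝ, E →L[ℝ] E →L[ℝ] ℝ)) ∞
      (fun y ↦ TotalSpace.mk' (E →L[ℝ] E →L[ℝ] ℝ)
        (E := fun y : N ↦ TangentSpace J y →L[ℝ] TangentSpace J y →L[ℝ] ℝ) y (S y)) e.source) :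
    ContDiffOn ℝ ∞ (loc2 J e S) e.target := by
  refine (contDiffOn_pullForm_mfderivWithin e.open_target.uniqueDiffOn he.smooth_symm
    (t := e.source) (fun z hz ↦ e.map_target hz) hS).congr fun z hz ↦ ?_
  rw [mfderivWithin_of_isOpen e.open_target hz, he.mfderiv_symm hz]
  rfl

lemma IsCoord.contDiffOn_locV {e : OpenPartialHomeomorph N G} (he : IsCoord J e)
    {X : Π y : N, TangentSpace J y} (hX : SmoothFieldOn J X e.source) :
    ContDiffOn ℝ ∞ (locV J e X) e.target := by
  have h : ContMDiffOn J 𝓘(ℝ, G) ∞ (fun y ↦ dC J e y (X y)) e.source :=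
    fun y hy ↦ he.contMDiffWithinAt_dC hy (hX y hy)
  exact (h.comp he.smooth_symm fun z hz ↦ e.map_target hz).contDiffOn

/-- A smooth field of bilinear forms given in coordinates is smooth. -/
lemma IsCoord.contMDiffAt_pullForm_dC [FiniteDimensional ℝ E] {e : OpenPartialHomeomorph N G}
    (he : IsCoord J e) {Q : G → G →L[ℝ] G →L[ℝ] ℝ} (hQ : ContDiffOn ℝ ∞ Q e.target) {y₀ : N}
    (hy₀ : y₀ ∈ e.source) :
    ContMDiffAt J (J.prod 𝓘(ℝ, E →L[ℝ] E →L[ℝ] ℝ)) ∞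
      (fun y ↦ TotalSpace.mk' (E →L[ℝ] E →L[ℝ] ℝ)
        (E := fun y : N ↦ TangentSpace J y →L[ℝ] TangentSpace J y →L[ℝ] ℝ) y
        (pullForm (dC J e y) (Q (e y)))) y₀ := by
  refine contMDiffAt_form_of_forall fun X Y hX hY ↦ ?_
  have h1 : ContMDiffAt J 𝓘(ℝ, G →L[ℝ] G →L[ℝ] ℝ) ∞ (fun y ↦ Q (e y)) y₀ :=
    (hQ.contMDiffOn.comp he.smooth e.mapsTo).contMDiffAt (e.open_source.mem_nhds hy₀)
  exact (h1.clm_apply (he.contMDiffWithinAt_dC hy₀ hX)).clm_apply (he.contMDiffWithinAt_dC hy₀ hY)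

/-- A smooth bivector field given in coordinates is smooth. -/
lemma IsCoord.contMDiffAt_pullForm_precomp_dCinv [FiniteDimensional ℝ E] [FiniteDimensional ℝ G]
    {e : OpenPartialHomeomorph N G}
    (he : IsCoord J e) {Q : G → (G →L[ℝ] ℝ) →L[ℝ] (G →L[ℝ] ℝ) →L[ℝ] ℝ}
    (hQ : ContDiffOn ℝ ∞ Q e.target) {y₀ : N} (hy₀ : y₀ ∈ e.source) :
    ContMDiffAt J (J.prod 𝓘(ℝ, (E →L[ℝ] ℝ) →L[ℝ] (E →L[ℝ] ℝ) →L[ℝ] ℝ)) ∞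
      (fun y ↦ TotalSpace.mk' ((E →L[ℝ] ℝ) →L[ℝ] (E →L[ℝ] ℝ) →L[ℝ] ℝ)
        (E := fun y : N ↦
          (TangentSpace J y →L[ℝ] ℝ) →L[ℝ] (TangentSpace J y →L[ℝ] ℝ) →L[ℝ] ℝ) y
        (pullForm (ContinuousLinearMap.precomp ℝ (dCinv J e y)) (Q (e y)))) y₀ := by
  refine contMDiffAt_bivector_of_forall fun α β hα hβ ↦ ?_
  have h1 : ContMDiffAt J 𝓘(ℝ, (G →L[ℝ] ℝ) →L[ℝ] (G →L[ℝ] ℝ) →L[ℝ] ℝ) ∞ (fun y ↦ Q (e y)) y₀ :=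
    (hQ.contMDiffOn.comp he.smooth e.mapsTo).contMDiffAt (e.open_source.mem_nhds hy₀)
  have h2 : ∀ g : G, ContMDiffAt J J.tangent ∞
      (fun y ↦ (⟨y, dCinv J e y g⟩ : TangentBundle J N)) y₀ := fun g ↦
    (he.contMDiffOn_dCinv (V := fun _ ↦ g) contDiffOn_const).contMDiffAt
      (e.open_source.mem_nhds hy₀)
  have h3 : ∀ α : Π y : N, TangentSpace J y →L[ℝ] ℝ,
      (∀ X : Π y : N, TangentSpace J y,
        ContMDiffAt J J.tangent ∞ (fun y ↦ (⟨y, X y⟩ : TangentBundle J N)) y₀ →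
        ContMDiffAt J 𝓘(ℝ, ℝ) ∞ (fun y ↦ α y (X y)) y₀) →
      ContMDiffAt J 𝓘(ℝ, G →L[ℝ] ℝ) ∞ (fun y ↦ (α y).comp (dCinv J e y)) y₀ := fun α hα ↦
    contMDiffAt_clm_of_forall fun g ↦ hα _ (h2 g)
  exact (h1.clm_apply (h3 α hα)).clm_apply (h3 β hβ)

end Local

/-! ### Differential forms on a vector space -/

section Flat

variable {G : Type*} [NormedAddCommGroup G] [NormedSpace ℝ G]
  {G' : Type*} [NormedAddCommGroup G'] [NormedSpace ℝ G']

/-- The exterior derivative of a 1-form on a vector space. -/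
def d1 (γ : G → G →L[ℝ] ℝ) (z v w : G) : ℝ :=
  fderiv ℝ γ z v w - fderiv ℝ γ z w v

/-- The exterior derivative of an alternating 2-form on a vector space. -/
def d2 (η : G → G →L[ℝ] G →L[ℝ] ℝ) (z u v w : G) : ℝ :=
  fderiv ℝ η z u v w + fderiv ℝ η z v w u + fderiv ℝ η z w u v

lemma d1_congr {γ γ' : G → G →L[ℝ] ℝ} {z : G} (h : γ =ᶠ[𝓝 z] γ') (v w : G) :
    d1 γ z v w = d1 γ' z v w := by
  have h' : fderiv ℝ γ z = fderiv ℝ γ' z := h.fderiv_eq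
  simp only [d1, h']

lemma d2_congr {η η' : G → G →L[ℝ] G →L[ℝ] ℝ} {z : G} (h : η =ᶠ[𝓝 z] η') (u v w : G) :
    d2 η z u v w = d2 η' z u v w := by
  have h' : fderiv ℝ η z = fderiv ℝ η' z := h.fderiv_eq
  simp only [d2, h']

lemma differentiableAt_fderiv_of_contDiffAt {T : G → G'} {z : G} (hT : ContDiffAt ℝ ∞ T z) :
    DifferentiableAt ℝ (fderiv ℝ T) z :=
  (hT.fderiv_right (m := 1) (WithTop.coe_le_coe.2 le_top)).differentiableAt one_ne_zero

lemma fderiv_fderiv_comm_of_contDiffAt {T : G → G'} {z : G} (hT : ContDiffAt ℝ ∞ T z) (v w : G) :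
    fderiv ℝ (fderiv ℝ T) z v w = fderiv ℝ (fderiv ℝ T) z w v :=
  hT.isSymmSndFDerivAt (by rw [minSmoothness_of_isRCLikeNormedField]; exact WithTop.coe_le_coe.2 le_top) v w

lemma fderiv_pullForm {T : G → G'} {η : G' → G' →L[ℝ] G' →L[ℝ] ℝ} {z : G}
    (hT : ContDiffAt ℝ ∞ T z) (hη : DifferentiableAt ℝ η (T z)) (u v w : G) :
    fderiv ℝ (fun z ↦ pullForm (fderiv ℝ T z) (η (T z))) z u v w
      = fderiv ℝ η (T z) (fderiv ℝ T z u) (fderiv ℝ T z v) (fderiv ℝ T z w)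
        + η (T z) (fderiv ℝ (fderiv ℝ T) z u v) (fderiv ℝ T z w)
        + η (T z) (fderiv ℝ T z v) (fderiv ℝ (fderiv ℝ T) z u w) := by
  have h1 : HasFDerivAt T (fderiv ℝ T z) z := (hT.differentiableAt (by simp)).hasFDerivAt
  have h2 := (differentiableAt_fderiv_of_contDiffAt hT).hasFDerivAt
  have h3 := hη.hasFDerivAt.comp z h1
  have h4 : HasFDerivAt (fun z ↦ pullForm (fderiv ℝ T z) (η (T z)))
      _ z := ((ContinuousLinearMap.compL ℝ G G' ℝ).flip.hasFDerivAt.comp z h2).clm_comp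
        (h3.clm_comp h2)
  rw [h4.fderiv]
  simp
  ring

lemma d2_pullForm {T : G → G'} {η : G' → G' →L[ℝ] G' →L[ℝ] ℝ} {z : G}
    (hT : ContDiffAt ℝ ∞ T z) (hη : DifferentiableAt ℝ η (T z))
    (halt : ∀ v w, η (T z) v w = - η (T z) w v) (u v w : G) :
    d2 (fun z ↦ pullForm (fderiv ℝ T z) (η (T z))) z u v w
      = d2 η (T z) (fderiv ℝ T z u) (fderiv ℝ T z v) (fderiv ℝ T z w) := by
  simp only [d2, fderiv_pullForm hT hη]
  rw [fderiv_fderiv_comm_of_contDiffAt hT u v, fderiv_fderiv_comm_of_contDiffAt hT w u, fderiv_fderiv_comm_of_contDiffAt hT w v,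
    halt (fderiv ℝ T z w) (fderiv ℝ (fderiv ℝ T) z v u),
    halt (fderiv ℝ T z u) (fderiv ℝ (fderiv ℝ T) z v w),
    halt (fderiv ℝ T z v) (fderiv ℝ (fderiv ℝ T) z u w)]
  ring

lemma fderiv_pull_one {T : G → G'} {γ : G' → G' →L[ℝ] ℝ} {z : G}
    (hT : ContDiffAt ℝ ∞ T z) (hγ : DifferentiableAt ℝ γ (T z)) (u v : G) :
    fderiv ℝ (fun z ↦ (γ (T z)).comp (fderiv ℝ T z)) z u v
      = fderiv ℝ γ (T z) (fderiv ℝ T z u) (fderiv ℝ T z v)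
        + γ (T z) (fderiv ℝ (fderiv ℝ T) z u v) := by
  have h1 : HasFDerivAt T (fderiv ℝ T z) z := (hT.differentiableAt (by simp)).hasFDerivAt
  have h4 := (hγ.hasFDerivAt.comp z h1).clm_comp (differentiableAt_fderiv_of_contDiffAt hT).hasFDerivAt
  have h5 := h4.fderiv
  simp only [Function.comp_apply] at h5
  rw [h5]
  simp
  ring

lemma d1_pull {T : G → G'} {γ : G' → G' →L[ℝ] ℝ} {z : G}
    (hT : ContDiffAt ℝ ∞ T z) (hγ : DifferentiableAt ℝ γ (T z)) (u v : G) :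
    d1 (fun z ↦ (γ (T z)).comp (fderiv ℝ T z)) z u v
      = d1 γ (T z) (fderiv ℝ T z u) (fderiv ℝ T z v) := by
  simp only [d1, fderiv_pull_one hT hγ]
  rw [fderiv_fderiv_comm_of_contDiffAt hT u v]
  ring

end Flat

/-! ### Change of local coordinates -/

section Change

variable {E : Type*} [NormedAddCommGroup E] [NormedSpace ℝ E]
  {H : Type*} [TopologicalSpace H] {J : ModelWithCorners ℝ E H}
  {N : Type*} [TopologicalSpace N] [ChartedSpace H N]
  {G : Type*} [NormedAddCommGroup G] [NormedSpace ℝ G]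
  {G' : Type*} [NormedAddCommGroup G'] [NormedSpace ℝ G']
  {e : OpenPartialHomeomorph N G} {e' : OpenPartialHomeomorph N G'}

omit [NormedSpace ℝ G] in
lemma eventually_symm_mem {z : G} (hz : z ∈ e.target)
    {s : Set N} (hs : IsOpen s) (hzs : e.symm z ∈ s) : ∀ᶠ x in 𝓝 z, e.symm x ∈ s :=
  (e.symm.continuousAt hz).eventually (hs.mem_nhds hzs)

lemma IsCoord.contDiffAt_change (he : IsCoord J e) (he' : IsCoord J e') {z : G}
    (hz : z ∈ e.target) (hz' : e.symm z ∈ e'.source) :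
    ContDiffAt ℝ ∞ (fun x ↦ e' (e.symm x)) z := by
  have h1 : ContMDiffAt 𝓘(ℝ, G) J ∞ e.symm z :=
    he.smooth_symm.contMDiffAt (e.open_target.mem_nhds hz)
  have h2 : ContMDiffAt J 𝓘(ℝ, G') ∞ e' (e.symm z) :=
    he'.smooth.contMDiffAt (e'.open_source.mem_nhds hz')
  exact (h2.comp z h1).contDiffAt

lemma IsCoord.fderiv_change (he : IsCoord J e) (he' : IsCoord J e') {z : G}
    (hz : z ∈ e.target) (hz' : e.symm z ∈ e'.source) :
    fderiv ℝ (fun x ↦ e' (e.symm x)) z = (dC J e' (e.symm z)).comp (dCinv J e (e.symm z)) := by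
  have h1 := mfderiv_comp (I' := J) z (he'.mdifferentiable.mdifferentiableAt hz')
    (he.mdifferentiable.mdifferentiableAt_symm hz)
  rw [he.mfderiv_symm hz, mfderiv_eq_fderiv] at h1
  exact h1

lemma IsCoord.loc2_change (he : IsCoord J e) (he' : IsCoord J e')
    (S : Π y : N, TangentSpace J y →L[ℝ] TangentSpace J y →L[ℝ] ℝ) {z : G}
    (hz : z ∈ e.target) (hz' : e.symm z ∈ e'.source) :
    loc2 J e S z = pullForm (fderiv ℝ (fun x ↦ e' (e.symm x)) z) (loc2 J e' S (e' (e.symm z))) := by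
  rw [he.fderiv_change he' hz hz']
  ext v w
  simp only [loc2, pullForm_apply, ContinuousLinearMap.comp_apply]
  rw [e'.left_inv hz', he'.dCinv_dC hz', he'.dCinv_dC hz']

lemma IsCoord.locV_change (he : IsCoord J e) (he' : IsCoord J e') (X : Π y : N, TangentSpace J y)
    {z : G} (hz : z ∈ e.target) (hz' : e.symm z ∈ e'.source) :
    fderiv ℝ (fun x ↦ e' (e.symm x)) z (locV J e X z) = locV J e' X (e' (e.symm z)) := by
  rw [he.fderiv_change he' hz hz']
  simp only [locV, ContinuousLinearMap.comp_apply]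
  rw [e'.left_inv hz', he.dCinv_dC (e.map_target hz)]

lemma IsCoord.loc2_locV_change (he : IsCoord J e) (he' : IsCoord J e')
    (S : Π y : N, TangentSpace J y →L[ℝ] TangentSpace J y →L[ℝ] ℝ) (X : Π y : N, TangentSpace J y)
    {z : G} (hz : z ∈ e.target) (hz' : e.symm z ∈ e'.source) :
    loc2 J e S z (locV J e X z) = (loc2 J e' S (e' (e.symm z)) (locV J e' X (e' (e.symm z)))).comp
      (fderiv ℝ (fun x ↦ e' (e.symm x)) z) := by
  rw [he.loc2_change he' S hz hz', ← he.locV_change he' X hz hz']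
  rfl

lemma IsCoord.d2_loc2_change (he : IsCoord J e) (he' : IsCoord J e')
    {S : Π y : N, TangentSpace J y →L[ℝ] TangentSpace J y →L[ℝ] ℝ} {z : G}
    (hz : z ∈ e.target) (hz' : e.symm z ∈ e'.source)
    (hS : DifferentiableAt ℝ (loc2 J e' S) (e' (e.symm z))) (halt : ∀ y v, S y v v = 0)
    (u v w : G) : ∃ u' v' w', d2 (loc2 J e S) z u v w
      = d2 (loc2 J e' S) (e' (e.symm z)) u' v' w' := by
  have h1 : loc2 J e S =ᶠ[𝓝 z] fun x ↦ pullForm (fderiv ℝ (fun x ↦ e' (e.symm x)) x)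
      (loc2 J e' S (e' (e.symm x))) := by
    filter_upwards [e.open_target.mem_nhds hz,
      eventually_symm_mem hz e'.open_source hz'] with x hx hx'
    exact he.loc2_change he' S hx hx'
  rw [d2_congr h1]
  have h2 := d2_pullForm (he.contDiffAt_change he' hz hz') hS (fun v w ↦ ?_) u v w
  · exact ⟨_, _, _, h2⟩
  · have h3 := halt (e'.symm (e' (e.symm z))) (dCinv J e' _ v + dCinv J e' _ w)
    simp only [map_add, add_apply, halt] at h3
    simp only [loc2, pullForm_apply]
    linarith

/-- The equation `d(i_X S) = c S` does not depend on the coordinates. -/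
lemma IsCoord.d1_loc2_change (he : IsCoord J e) (he' : IsCoord J e')
    {S : Π y : N, TangentSpace J y →L[ℝ] TangentSpace J y →L[ℝ] ℝ} {X : Π y : N, TangentSpace J y}
    {z : G} {c : ℝ} (hz : z ∈ e.target) (hz' : e.symm z ∈ e'.source)
    (hS : DifferentiableAt ℝ (loc2 J e' S) (e' (e.symm z)))
    (hX : DifferentiableAt ℝ (locV J e' X) (e' (e.symm z)))
    (h : ∀ v w, d1 (fun x ↦ loc2 J e' S x (locV J e' X x)) (e' (e.symm z)) v w
      = c * loc2 J e' S (e' (e.symm z)) v w) (v w : G) :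
    d1 (fun x ↦ loc2 J e S x (locV J e X x)) z v w = c * loc2 J e S z v w := by
  have h1 : (fun x ↦ loc2 J e S x (locV J e X x)) =ᶠ[𝓝 z] fun x ↦
      ((fun x ↦ loc2 J e' S x (locV J e' X x)) (e' (e.symm x))).comp
        (fderiv ℝ (fun x ↦ e' (e.symm x)) x) := by
    filter_upwards [e.open_target.mem_nhds hz,
      eventually_symm_mem hz e'.open_source hz'] with x hx hx'
    exact he.loc2_locV_change he' S X hx hx'
  rw [d1_congr h1, d1_pull (T := fun x ↦ e' (e.symm x)) (he.contDiffAt_change he' hz hz')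
    (hS.clm_apply hX), h, he.loc2_change he' S hz hz']
  rfl

end Change

/-! ### Poisson structures in local coordinates -/

section FlatPoisson

variable {E : Type*} [NormedAddCommGroup E] [NormedSpace ℝ E]
  {H : Type*} [TopologicalSpace H] {J : ModelWithCorners ℝ E H}
  {N : Type*} [TopologicalSpace N] [ChartedSpace H N]
  {G : Type*} [NormedAddCommGroup G] [NormedSpace ℝ G]

/-- `Q` is a Poisson structure on the subset `V` of a vector space. -/
structure FlatPoisson (Q : G → (G →L[ℝ] ℝ) →L[ℝ] (G →L[ℝ] ℝ) →L[ℝ] ℝ) (V : Set G) : Prop where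
  smooth : ContDiffOn ℝ ∞ Q V
  alternating : ∀ z ∈ V, ∀ α, Q z α α = 0
  jacobi : ∀ f g h : G → ℝ, ContDiffOn ℝ ∞ f V → ContDiffOn ℝ ∞ g V → ContDiffOn ℝ ∞ h V →
    ∀ z ∈ V, Q z (fderiv ℝ f z) (fderiv ℝ (fun x ↦ Q x (fderiv ℝ g x) (fderiv ℝ h x)) z)
      + Q z (fderiv ℝ g z) (fderiv ℝ (fun x ↦ Q x (fderiv ℝ h x) (fderiv ℝ f x)) z)
      + Q z (fderiv ℝ h z) (fderiv ℝ (fun x ↦ Q x (fderiv ℝ f x) (fderiv ℝ g x)) z) = 0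

/-- The conditions on a Poisson structure, at a single point. -/
structure IsPoissonAt [IsManifold J ∞ N]
    (P : Π y : N, (TangentSpace J y →L[ℝ] ℝ) →L[ℝ] (TangentSpace J y →L[ℝ] ℝ) →L[ℝ] ℝ) (y : N) :
    Prop where
  alternating : ∀ α, P y α α = 0
  smooth : ContMDiffAt J (J.prod 𝓘(ℝ, (E →L[ℝ] ℝ) →L[ℝ] (E →L[ℝ] ℝ) →L[ℝ] ℝ)) ∞
    (fun x ↦ TotalSpace.mk' ((E →L[ℝ] ℝ) →L[ℝ] (E →L[ℝ] ℝ) →L[ℝ] ℝ)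
      (E := fun x : N ↦
        (TangentSpace J x →L[ℝ] ℝ) →L[ℝ] (TangentSpace J x →L[ℝ] ℝ) →L[ℝ] ℝ) x (P x)) y
  jacobi : ∀ f g h : N → ℝ, ContMDiff J 𝓘(ℝ, ℝ) ∞ f → ContMDiff J 𝓘(ℝ, ℝ) ∞ g →
    ContMDiff J 𝓘(ℝ, ℝ) ∞ h →
      bivectorBracket J P f (bivectorBracket J P g h) y
        + bivectorBracket J P g (bivectorBracket J P h f) y
        + bivectorBracket J P h (bivectorBracket J P f g) y = 0

variable [IsManifold J ∞ N]
  {P : Π y : N, (TangentSpace J y →L[ℝ] ℝ) →L[ℝ] (TangentSpace J y →L[ℝ] ℝ) →L[ℝ] ℝ}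

/-- A bivector field satisfying the conditions at every point is a Poisson structure. -/
def PoissonStructure.ofIsPoissonAt (h : ∀ y, IsPoissonAt P y) : PoissonStructure J N where
  bivector := P
  alternating y := (h y).alternating
  smooth y := (h y).smooth
  jacobi f g k hf hg hk y := (h y).jacobi f g k hf hg hk

/-- A bivector field which is a Poisson structure in local coordinates is a Poisson structure. -/
theorem IsCoord.isPoissonAt [FiniteDimensional ℝ E] [FiniteDimensional ℝ G]
    {e : OpenPartialHomeomorph N G} (he : IsCoord J e)
    {Q : G → (G →L[ℝ] ℝ) →L[ℝ] (G →L[ℝ] ℝ) →L[ℝ] ℝ} (hQ : FlatPoisson Q e.target)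
    (hP : ∀ y ∈ e.source, P y = pullForm (ContinuousLinearMap.precomp ℝ (dCinv J e y)) (Q (e y)))
    {y : N} (hy : y ∈ e.source) : IsPoissonAt P y := by
  have hF : ∀ {f : N → ℝ}, ContMDiff J 𝓘(ℝ, ℝ) ∞ f →
      ContDiffOn ℝ ∞ (fun z ↦ f (e.symm z)) e.target := fun hf ↦
    (hf.comp_contMDiffOn he.smooth_symm).contDiffOn
  have hcomp : ∀ {f : N → ℝ} {x : N}, x ∈ e.source → MDifferentiableAt J 𝓘(ℝ, ℝ) f x →
      (mvfderiv J f x).comp (dCinv J e x) = fderiv ℝ (fun z ↦ f (e.symm z)) (e x) := by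
    intro f x hx hf
    rw [he.mvfderiv_eq hx hf]
    ext v
    simp [he.dC_dCinv hx]
  have hbr : ∀ {f g : N → ℝ} {x : N}, x ∈ e.source → MDifferentiableAt J 𝓘(ℝ, ℝ) f x →
      MDifferentiableAt J 𝓘(ℝ, ℝ) g x → bivectorBracket J P f g x
        = Q (e x) (fderiv ℝ (fun z ↦ f (e.symm z)) (e x))
          (fderiv ℝ (fun z ↦ g (e.symm z)) (e x)) := by
    intro f g x hx hf hg
    rw [bivectorBracket, hP x hx, ← hcomp hx hf, ← hcomp hx hg]
    rfl
  have hsm : ∀ {f g : N → ℝ}, ContMDiff J 𝓘(ℝ, ℝ) ∞ f → ContMDiff J 𝓘(ℝ, ℝ) ∞ g →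
      ContDiffOn ℝ ∞ (fun z ↦ Q z (fderiv ℝ (fun z ↦ f (e.symm z)) z)
        (fderiv ℝ (fun z ↦ g (e.symm z)) z)) e.target := by
    intro f g hf hg
    exact (hQ.smooth.clm_apply ((hF hf).fderiv_of_isOpen e.open_target (by simp))).clm_apply
      ((hF hg).fderiv_of_isOpen e.open_target (by simp))
  have hbr2 : ∀ {f g h : N → ℝ}, ContMDiff J 𝓘(ℝ, ℝ) ∞ f → ContMDiff J 𝓘(ℝ, ℝ) ∞ g →
      ContMDiff J 𝓘(ℝ, ℝ) ∞ h → bivectorBracket J P f (bivectorBracket J P g h) y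
        = Q (e y) (fderiv ℝ (fun z ↦ f (e.symm z)) (e y)) (fderiv ℝ (fun z ↦
          Q z (fderiv ℝ (fun z ↦ g (e.symm z)) z) (fderiv ℝ (fun z ↦ h (e.symm z)) z)) (e y)) := by
    intro f g h hf hg hh
    have h1 : ∀ x ∈ e.source, bivectorBracket J P g h x
        = (fun z ↦ Q z (fderiv ℝ (fun z ↦ g (e.symm z)) z)
          (fderiv ℝ (fun z ↦ h (e.symm z)) z)) (e x) := fun x hx ↦
      hbr hx (hg.mdifferentiable (by simp) x) (hh.mdifferentiable (by simp) x)
    have h2 : MDifferentiableAt J 𝓘(ℝ, ℝ) (bivectorBracket J P g h) y := by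
      have h3 : ContMDiffOn J 𝓘(ℝ, ℝ) ∞ (bivectorBracket J P g h) e.source :=
        ((hsm hg hh).contMDiffOn.comp he.smooth e.mapsTo).congr h1
      exact (h3.contMDiffAt (e.open_source.mem_nhds hy)).mdifferentiableAt (by simp)
    rw [hbr hy (hf.mdifferentiable (by simp) y) h2]
    congr 1
    refine Filter.EventuallyEq.fderiv_eq ?_
    filter_upwards [e.open_target.mem_nhds (e.map_source hy)] with z hz
    rw [h1 _ (e.map_target hz), e.right_inv hz]
  refine ⟨fun α ↦ ?_, ?_, fun f g h hf hg hh ↦ ?_⟩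
  · rw [hP y hy]
    exact hQ.alternating _ (e.map_source hy) _
  · refine (he.contMDiffAt_pullForm_precomp_dCinv hQ.smooth hy).congr_of_eventuallyEq ?_
    filter_upwards [e.open_source.mem_nhds hy] with x hx
    rw [hP x hx]
  · rw [hbr2 hf hg hh, hbr2 hg hh hf, hbr2 hh hf hg]
    exact hQ.jacobi _ _ _ (hF hf) (hF hg) (hF hh) _ (e.map_source hy)

end FlatPoisson

/-! ### Deforming the Poisson structure of a symplectic form -/

section Deform

variable {G : Type*} [NormedAddCommGroup G] [NormedSpace ℝ G] [FiniteDimensional ℝ G]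

/-- `η` is a symplectic form on the subset `V` of a vector space. -/
structure FlatSymplectic (η : G → G →L[ℝ] G →L[ℝ] ℝ) (V : Set G) : Prop where
  smooth : ContDiffOn ℝ ∞ η V
  alternating : ∀ z ∈ V, ∀ v, η z v v = 0
  nondegenerate : ∀ z ∈ V, ∀ v, (∀ w, η z v w = 0) → v = 0
  closed : ∀ z ∈ V, ∀ u v w, d2 η z u v w = 0

lemma apply_swap_of_alternating {W : Type*} [AddCommGroup W] [Module ℝ W] [TopologicalSpace W]
    {S : W →L[ℝ] W →L[ℝ] ℝ} (h : ∀ v, S v v = 0)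
    (v w : W) : S v w = - S w v := by
  have h3 := h (v + w)
  simp only [map_add, add_apply, h] at h3
  linarith

lemma isInvertible_of_nondegenerate {S : G →L[ℝ] G →L[ℝ] ℝ}
    (h : ∀ v, (∀ w, S v w = 0) → v = 0) : S.IsInvertible := by
  have hinj : Function.Injective (S : G →ₗ[ℝ] G →L[ℝ] ℝ) := by
    rw [← LinearMap.ker_eq_bot, LinearMap.ker_eq_bot']
    intro v hv
    exact h v fun w ↦ by
      have : S v = 0 := hv
      rw [this]; rfl
  have hdim : Module.finrank ℝ G = Module.finrank ℝ (G →L[ℝ] ℝ) := by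
    rw [← (LinearMap.toContinuousLinearMap (𝕜 := ℝ) (E := G) (F' := ℝ)).finrank_eq]
    exact (Subspace.dual_finrank_eq (K := ℝ) (V := G)).symm
  refine ⟨(LinearEquiv.ofInjectiveOfFinrankEq _ hinj hdim).toContinuousLinearEquiv, ?_⟩
  ext v w
  rfl

variable {η : G → G →L[ℝ] G →L[ℝ] ℝ} {V : Set G}

namespace FlatSymplectic

lemma isInvertible (h : FlatSymplectic η V) {z : G} (hz : z ∈ V) : (η z).IsInvertible :=
  isInvertible_of_nondegenerate (h.nondegenerate z hz)

lemma apply_inverse (h : FlatSymplectic η V) {z : G} (hz : z ∈ V) (a : G →L[ℝ] ℝ) :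
    η z ((η z).inverse a) = a :=
  (h.isInvertible hz).self_apply_inverse a

lemma contDiffOn_inverse (h : FlatSymplectic η V) :
    ContDiffOn ℝ ∞ (fun z ↦ (η z).inverse) V := fun z hz ↦ by
  have : CompleteSpace G := FiniteDimensional.complete ℝ G
  exact (h.isInvertible hz).contDiffAt_map_inverse.comp_contDiffWithinAt z (h.smooth z hz)

lemma apply_inverse_swap (h : FlatSymplectic η V) {z : G} (hz : z ∈ V) (a b : G →L[ℝ] ℝ) :
    a ((η z).inverse b) = - b ((η z).inverse a) := by
  have h1 := apply_swap_of_alternating (h.alternating z hz) ((η z).inverse a) ((η z).inverse b)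
  rwa [h.apply_inverse hz, h.apply_inverse hz] at h1

omit [FiniteDimensional ℝ G] in
lemma differentiableAt (h : FlatSymplectic η V) (hV : IsOpen V) {z : G} (hz : z ∈ V) :
    DifferentiableAt ℝ η z :=
  (h.smooth.contDiffAt (hV.mem_nhds hz)).differentiableAt (by simp)

omit [FiniteDimensional ℝ G] in
lemma fderiv_swap (h : FlatSymplectic η V) (hV : IsOpen V) {z : G} (hz : z ∈ V) (u v w : G) :
    fderiv ℝ η z u v w = - fderiv ℝ η z u w v := by
  refine apply_swap_of_alternating (fun v ↦ ?_) v w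
  have h1 : HasFDerivAt (fun z ↦ η z v v) _ z :=
    ((h.differentiableAt hV hz).hasFDerivAt.clm_apply (hasFDerivAt_const v z)).clm_apply
      (hasFDerivAt_const v z)
  have h2 : HasFDerivAt (fun z ↦ η z v v) (0 : G →L[ℝ] ℝ) z := by
    refine (hasFDerivAt_const (0 : ℝ) z).congr_of_eventuallyEq ?_
    filter_upwards [hV.mem_nhds hz] with x hx using h.alternating x hx v
  have h3 := congrArg (fun L ↦ L u) (h1.unique h2)
  simpa using h3

/-- The derivative of `π(b, c)`, where `π` is the inverse of a symplectic form. -/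
lemma fderiv_apply_inverse (h : FlatSymplectic η V) (hV : IsOpen V) {z : G} (hz : z ∈ V)
    {b c : G → G →L[ℝ] ℝ} (hb : DifferentiableAt ℝ b z) (hc : DifferentiableAt ℝ c z) (u : G) :
    fderiv ℝ (fun x ↦ c x ((η x).inverse (b x))) z u
      = fderiv ℝ c z u ((η z).inverse (b z)) - fderiv ℝ b z u ((η z).inverse (c z))
        + fderiv ℝ η z u ((η z).inverse (b z)) ((η z).inverse (c z)) := by
  have hU : DifferentiableAt ℝ (fun x ↦ (η x).inverse (b x)) z :=
    ((h.contDiffOn_inverse.contDiffAt (hV.mem_nhds hz)).differentiableAt (by simp)).clm_apply hb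
  set Ub : G → G := fun x ↦ (η x).inverse (b x) with hUb
  have h1 : HasFDerivAt (fun x ↦ η x (Ub x)) _ z :=
    (h.differentiableAt hV hz).hasFDerivAt.clm_apply hU.hasFDerivAt
  have h2 : HasFDerivAt (fun x ↦ η x (Ub x)) (fderiv ℝ b z) z := by
    refine hb.hasFDerivAt.congr_of_eventuallyEq ?_
    filter_upwards [hV.mem_nhds hz] with x hx using h.apply_inverse hx _
  have h3 := congrArg (fun L ↦ L u ((η z).inverse (c z))) (h1.unique h2)
  have h4 : HasFDerivAt (fun x ↦ c x (Ub x)) _ z := hc.hasFDerivAt.clm_apply hU.hasFDerivAt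
  have h5 : c z (fderiv ℝ Ub z u) = - η z (fderiv ℝ Ub z u) ((η z).inverse (c z)) := by
    rw [apply_swap_of_alternating (h.alternating z hz) (fderiv ℝ Ub z u), h.apply_inverse hz,
      neg_neg]
  rw [h4.fderiv]
  simp only [add_apply, ContinuousLinearMap.comp_apply, ContinuousLinearMap.flip_apply] at h3 ⊢
  rw [h5]
  linarith

lemma fderiv_apply_inverse_swap (h : FlatSymplectic η V) (hV : IsOpen V) {z : G} (hz : z ∈ V)
    {b c : G → G →L[ℝ] ℝ} (hb : DifferentiableAt ℝ b z) (hc : DifferentiableAt ℝ c z) (u : G) :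
    fderiv ℝ (fun x ↦ c x ((η x).inverse (b x))) z u
      = - fderiv ℝ (fun x ↦ b x ((η x).inverse (c x))) z u := by
  rw [h.fderiv_apply_inverse hV hz hb hc, h.fderiv_apply_inverse hV hz hc hb,
    h.fderiv_swap hV hz u]
  ring

/-- The Jacobi identity of a symplectic form for 1-forms which need not be closed. -/
lemma jacobi_one_forms (h : FlatSymplectic η V) (hV : IsOpen V) {z : G} (hz : z ∈ V)
    {a b c : G → G →L[ℝ] ℝ} (ha : DifferentiableAt ℝ a z) (hb : DifferentiableAt ℝ b z)
    (hc : DifferentiableAt ℝ c z) :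
    fderiv ℝ (fun x ↦ c x ((η x).inverse (b x))) z ((η z).inverse (a z))
      + fderiv ℝ (fun x ↦ a x ((η x).inverse (c x))) z ((η z).inverse (b z))
      + fderiv ℝ (fun x ↦ b x ((η x).inverse (a x))) z ((η z).inverse (c z))
      = d1 c z ((η z).inverse (a z)) ((η z).inverse (b z))
        + d1 a z ((η z).inverse (b z)) ((η z).inverse (c z))
        + d1 b z ((η z).inverse (c z)) ((η z).inverse (a z)) := by
  have h1 := h.closed z hz ((η z).inverse (a z)) ((η z).inverse (b z)) ((η z).inverse (c z))
  rw [h.fderiv_apply_inverse hV hz hb hc, h.fderiv_apply_inverse hV hz hc ha,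
    h.fderiv_apply_inverse hV hz ha hb]
  simp only [d1, d2] at h1 ⊢
  linarith

end FlatSymplectic

/-- The bivector field `g (π - w X ∧ Y)`, where `π` is the inverse of the symplectic form `η`,
`X` is dual to the 1-form `α`, `Y` is dual to the constant 1-form `ℓ`, and `g` is a function of
`ℓ`. -/
def deformed (η : G → G →L[ℝ] G →L[ℝ] ℝ) (α : G → G →L[ℝ] ℝ) (ℓ : G →L[ℝ] ℝ) (g : ℝ → ℝ)
    (w : G → ℝ) (z : G) : (G →L[ℝ] ℝ) →L[ℝ] (G →L[ℝ] ℝ) →L[ℝ] ℝ :=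
  g (ℓ z) • ((ContinuousLinearMap.apply ℝ ℝ).comp (η z).inverse
    - w z • ((ContinuousLinearMap.apply ℝ ℝ ((η z).inverse (α z))).smulRight
        (ContinuousLinearMap.apply ℝ ℝ ((η z).inverse ℓ))
      - (ContinuousLinearMap.apply ℝ ℝ ((η z).inverse ℓ)).smulRight
        (ContinuousLinearMap.apply ℝ ℝ ((η z).inverse (α z)))))

omit [FiniteDimensional ℝ G] in
lemma deformed_apply (η : G → G →L[ℝ] G →L[ℝ] ℝ) (α : G → G →L[ℝ] ℝ) (ℓ : G →L[ℝ] ℝ) (g : ℝ → ℝ)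
    (w : G → ℝ) (z : G) (a b : G →L[ℝ] ℝ) :
    deformed η α ℓ g w z a b = g (ℓ z) * (b ((η z).inverse a)
      - w z * (a ((η z).inverse (α z)) * b ((η z).inverse ℓ)
        - a ((η z).inverse ℓ) * b ((η z).inverse (α z)))) := by
  simp [deformed]

/-- If `dα = c η`, then `g (π - w X ∧ Y)` is a Poisson structure for every `w` whose derivative is
`-w² dh` modulo `dℓ`, where `h = ℓ(X)`, and every solution `g` of `g' (1 - w h) = -c w g`. -/
theorem FlatSymplectic.flatPoisson_deformed (h : FlatSymplectic η V) (hV : IsOpen V)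
    {α : G → G →L[ℝ] ℝ} {c : ℝ} {ℓ : G →L[ℝ] ℝ} (hα : ContDiffOn ℝ ∞ α V)
    (hdα : ∀ z ∈ V, ∀ v w, d1 α z v w = c * η z v w)
    {g : ℝ → ℝ} (hg : ContDiff ℝ ∞ g) {w : G → ℝ} (hw : ContDiffOn ℝ ∞ w V)
    (hdw : ∀ z ∈ V, ∃ k : ℝ, ∀ u, fderiv ℝ w z u
      = k * ℓ u - w z ^ 2 * fderiv ℝ (fun x ↦ ℓ ((η x).inverse (α x))) z u)
    (hdg : ∀ z ∈ V, deriv g (ℓ z) * (1 - w z * ℓ ((η z).inverse (α z))) = -(c * w z * g (ℓ z))) :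
    FlatPoisson (deformed η α ℓ g w) V := by
  have hsm : ∀ {a b : G → G →L[ℝ] ℝ}, ContDiffOn ℝ ∞ a V → ContDiffOn ℝ ∞ b V →
      ContDiffOn ℝ ∞ (fun x ↦ b x ((η x).inverse (a x))) V := fun ha hb ↦
    hb.clm_apply (h.contDiffOn_inverse.clm_apply ha)
  refine ⟨?_, fun z hz a ↦ ?_, ?_⟩
  · refine contDiffOn_clm_apply.2 fun a ↦ contDiffOn_clm_apply.2 fun b ↦ ?_
    simp only [deformed_apply]
    have ha : ContDiffOn ℝ ∞ (fun _ : G ↦ a) V := contDiffOn_const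
    have hb : ContDiffOn ℝ ∞ (fun _ : G ↦ b) V := contDiffOn_const
    have hl : ContDiffOn ℝ ∞ (fun _ : G ↦ ℓ) V := contDiffOn_const
    exact (hg.comp_contDiffOn ℓ.contDiff.contDiffOn).mul ((hsm ha hb).sub
      (hw.mul (((hsm hα ha).mul (hsm hl hb)).sub ((hsm hl ha).mul (hsm hα hb)))))
  · rw [deformed_apply]
    have h1 := h.apply_inverse_swap hz a a
    have h2 : a ((η z).inverse a) = 0 := by linarith
    rw [h2]
    ring
  · intro f₁ f₂ f₃ hf₁ hf₂ hf₃ z hz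
    have hnhds := hV.mem_nhds hz
    have hd : ∀ {f : G → ℝ}, ContDiffOn ℝ ∞ f V → DifferentiableAt ℝ f z := fun hf ↦
      (hf.contDiffAt hnhds).differentiableAt (by simp)
    have hd' : ∀ {f : G → G →L[ℝ] ℝ}, ContDiffOn ℝ ∞ f V → DifferentiableAt ℝ f z := fun hf ↦
      (hf.contDiffAt hnhds).differentiableAt (by simp)
    have hdf : ∀ {f : G → ℝ}, ContDiffOn ℝ ∞ f V → ContDiffOn ℝ ∞ (fderiv ℝ f) V := fun hf ↦
      hf.fderiv_of_isOpen hV (by simp)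
    have hl : ContDiffOn ℝ ∞ (fun _ : G ↦ ℓ) V := contDiffOn_const
    have hl0 : ∀ v w, d1 (fun _ : G ↦ ℓ) z v w = 0 := by
      intro v w
      simp [d1]
    have hdf0 : ∀ {f : G → ℝ}, ContDiffOn ℝ ∞ f V → ∀ v w, d1 (fderiv ℝ f) z v w = 0 := by
      intro f hf v w
      rw [d1, fderiv_fderiv_comm_of_contDiffAt (hf.contDiffAt hnhds), sub_self]
    obtain ⟨k, hk⟩ := hdw z hz
    have hgz := hdg z hz
    -- the derivative of a bracket
    have hbr : ∀ {p q : G → G →L[ℝ] ℝ}, ContDiffOn ℝ ∞ p V → ContDiffOn ℝ ∞ q V → ∀ u,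
        fderiv ℝ (fun x ↦ deformed η α ℓ g w x (p x) (q x)) z u
        = deriv g (ℓ z) * ℓ u * (q z ((η z).inverse (p z))
          - w z * (p z ((η z).inverse (α z)) * q z ((η z).inverse ℓ)
            - p z ((η z).inverse ℓ) * q z ((η z).inverse (α z))))
        + g (ℓ z) * (fderiv ℝ (fun x ↦ q x ((η x).inverse (p x))) z u
          - (k * ℓ u - w z ^ 2 * fderiv ℝ (fun x ↦ ℓ ((η x).inverse (α x))) z u)
            * (p z ((η z).inverse (α z)) * q z ((η z).inverse ℓ)
            - p z ((η z).inverse ℓ) * q z ((η z).inverse (α z)))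
          - w z * (fderiv ℝ (fun x ↦ p x ((η x).inverse (α x))) z u * q z ((η z).inverse ℓ)
            + p z ((η z).inverse (α z)) * fderiv ℝ (fun x ↦ q x ((η x).inverse ℓ)) z u
            - fderiv ℝ (fun x ↦ p x ((η x).inverse ℓ)) z u * q z ((η z).inverse (α z))
            - p z ((η z).inverse ℓ) * fderiv ℝ (fun x ↦ q x ((η x).inverse (α x))) z u)) := by
      intro p q hp hq u
      simp only [deformed_apply]
      have e1 : HasFDerivAt (fun x ↦ g (ℓ x)) _ z :=
        ((hg.differentiable (by simp)).differentiableAt (x := ℓ z)).hasDerivAt.comp_hasFDerivAt z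
          ℓ.hasFDerivAt
      have e2 := (hd (hsm hp hq)).hasFDerivAt
      have e3 := (hd (hsm hα hp)).hasFDerivAt
      have e4 := (hd (hsm hα hq)).hasFDerivAt
      have e5 := (hd (hsm hl hp)).hasFDerivAt
      have e6 := (hd (hsm hl hq)).hasFDerivAt
      have e7 := (hd hw).hasFDerivAt
      have e8 := e1.mul (e2.sub (e7.mul ((e3.mul e6).sub (e5.mul e4))))
      have e9 := congrArg (fun L ↦ L u) e8.fderiv
      refine Eq.trans e9 ?_
      simp only [add_apply, sub_apply, smul_apply, smul_eq_mul, Pi.mul_apply, Pi.sub_apply]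
      rw [hk]
      ring
    -- the Hamiltonian vector field of `a`
    have key : ∀ a b : G →L[ℝ] ℝ, deformed η α ℓ g w z a b = b (g (ℓ z) • ((η z).inverse a
        - w z • (a ((η z).inverse (α z)) • ((η z).inverse ℓ)
        - a ((η z).inverse ℓ) • ((η z).inverse (α z))))) := by
      intro a b
      rw [deformed_apply]
      simp
    have h1 := hdf hf₁
    have h2 := hdf hf₂
    have h3 := hdf hf₃
    -- the Jacobi identities between the five 1-forms which occur
    have R123 := h.jacobi_one_forms hV hz (hd' h1) (hd' h2) (hd' h3)
    rw [hdf0 hf₁, hdf0 hf₂, hdf0 hf₃] at R123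
    have Rα : ∀ {p q : G → ℝ}, ContDiffOn ℝ ∞ p V → ContDiffOn ℝ ∞ q V →
        fderiv ℝ (fun x ↦ fderiv ℝ q x ((η x).inverse (fderiv ℝ p x))) z ((η z).inverse (α z))
        - fderiv ℝ (fun x ↦ fderiv ℝ q x ((η x).inverse (α x))) z ((η z).inverse (fderiv ℝ p z))
        + fderiv ℝ (fun x ↦ fderiv ℝ p x ((η x).inverse (α x))) z ((η z).inverse (fderiv ℝ q z))
        = - c * fderiv ℝ q z ((η z).inverse (fderiv ℝ p z)) := by
      intro p q hp hq
      have := h.jacobi_one_forms hV hz (hd' hα) (hd' (hdf hp)) (hd' (hdf hq))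
      rw [hdf0 hp, hdf0 hq, hdα z hz, h.apply_inverse hz,
        h.fderiv_apply_inverse_swap hV hz (hd' (hdf hq)) (hd' hα),
        h.apply_inverse_swap hz (fderiv ℝ p z)] at this
      linarith
    have Rl : ∀ {p q : G → ℝ}, ContDiffOn ℝ ∞ p V → ContDiffOn ℝ ∞ q V →
        fderiv ℝ (fun x ↦ fderiv ℝ q x ((η x).inverse (fderiv ℝ p x))) z ((η z).inverse ℓ)
        - fderiv ℝ (fun x ↦ fderiv ℝ q x ((η x).inverse ℓ)) z ((η z).inverse (fderiv ℝ p z))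
        + fderiv ℝ (fun x ↦ fderiv ℝ p x ((η x).inverse ℓ)) z ((η z).inverse (fderiv ℝ q z))
        = 0 := by
      intro p q hp hq
      have := h.jacobi_one_forms hV hz (hd' hl) (hd' (hdf hp)) (hd' (hdf hq))
      rw [hdf0 hp, hdf0 hq, hl0,
        h.fderiv_apply_inverse_swap hV hz (hd' (hdf hq)) (hd' hl)] at this
      linarith
    have Rαl : ∀ {p : G → ℝ}, ContDiffOn ℝ ∞ p V →
        fderiv ℝ (fun x ↦ fderiv ℝ p x ((η x).inverse ℓ)) z ((η z).inverse (α z))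
        - fderiv ℝ (fun x ↦ fderiv ℝ p x ((η x).inverse (α x))) z ((η z).inverse ℓ)
        + fderiv ℝ (fun x ↦ ℓ ((η x).inverse (α x))) z ((η z).inverse (fderiv ℝ p z))
        = - c * fderiv ℝ p z ((η z).inverse ℓ) := by
      intro p hp
      have := h.jacobi_one_forms hV hz (hd' hα) (hd' hl) (hd' (hdf hp))
      rw [hdf0 hp, hl0, hdα z hz, h.apply_inverse hz,
        h.fderiv_apply_inverse_swap hV hz (hd' (hdf hp)) (hd' hα),
        h.apply_inverse_swap hz ℓ] at this
      linarith
    have l1 := h.apply_inverse_swap hz ℓ (fderiv ℝ f₁ z)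
    have l2 := h.apply_inverse_swap hz ℓ (fderiv ℝ f₂ z)
    have l3 := h.apply_inverse_swap hz ℓ (fderiv ℝ f₃ z)
    have ll : ℓ ((η z).inverse ℓ) = 0 := by
      have := h.apply_inverse_swap hz ℓ ℓ
      linarith
    rw [key, key, key, hbr h2 h3, hbr h3 h1, hbr h1 h2]
    simp only [map_smul, map_sub, smul_eq_mul, l1, l2, l3, ll]
    have A12 := Rα hf₁ hf₂
    have A23 := Rα hf₂ hf₃
    have A31 := Rα hf₃ hf₁
    have L12 := Rl hf₁ hf₂
    have L23 := Rl hf₂ hf₃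
    have L31 := Rl hf₃ hf₁
    have B1 := Rαl hf₁
    have B2 := Rαl hf₂
    have B3 := Rαl hf₃
    generalize g (ℓ z) = g₀ at *
    generalize deriv g (ℓ z) = g₁ at *
    generalize w z = w₀ at *
    generalize ℓ ((η z).inverse (α z)) = h₀ at *
    set U := (η z).inverse
    set x₁ := fderiv ℝ f₁ z (U (α z))
    set x₂ := fderiv ℝ f₂ z (U (α z))
    set x₃ := fderiv ℝ f₃ z (U (α z))
    set y₁ := fderiv ℝ f₁ z (U ℓ)
    set y₂ := fderiv ℝ f₂ z (U ℓ)
    set y₃ := fderiv ℝ f₃ z (U ℓ)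
    set p₁₂ := fderiv ℝ f₂ z (U (fderiv ℝ f₁ z))
    set p₂₃ := fderiv ℝ f₃ z (U (fderiv ℝ f₂ z))
    set p₃₁ := fderiv ℝ f₁ z (U (fderiv ℝ f₃ z))
    -- the Jacobiator is a combination of these identities and of the equation for `g`
    linear_combination g₀ ^ 2 * R123 + g₀ ^ 2 * w₀ * (y₃ * A12 + y₁ * A23 + y₂ * A31)
      - g₀ ^ 2 * w₀ * (x₃ * L12 + x₁ * L23 + x₂ * L31)
      + g₀ ^ 2 * w₀ ^ 2 * ((x₂ * y₃ - x₃ * y₂) * B1 + (x₃ * y₁ - x₁ * y₃) * B2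
        + (x₁ * y₂ - x₂ * y₁) * B3)
      - g₀ * (y₁ * p₂₃ + y₂ * p₃₁ + y₃ * p₁₂) * hgz

end Deform

/-! ### Continuing a closed form across a hyperplane -/

section Collar

open MeasureTheory

/-- Integrals over the unit interval depend smoothly on parameters. -/
lemma contDiff_integral_unitInterval {G F : Type*} [NormedAddCommGroup G] [NormedSpace ℝ G]
    [NormedAddCommGroup F] [NormedSpace ℝ F] {f : G × ℝ → F} (hf : ContDiff ℝ ∞ f) :
    ContDiff ℝ ∞ (fun z ↦ ∫ τ in (0 : ℝ)..1, f (z, τ)) := by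
  let χ : ContDiffBump (0 : ℝ) := ⟨1, 2, one_pos, one_lt_two⟩
  -- the integral is a convolution with the indicator function of the interval
  have key := contDiffOn_convolution_right_with_param_comp (n := ⊤) (μ := volume)
    (ContinuousLinearMap.lsmul ℝ ℝ : ℝ →L[ℝ] F →L[ℝ] F) (s := (univ : Set G)) (v := fun _ ↦ (0 : ℝ))
    contDiffOn_const (f := indicator (Ioc 0 1) fun _ ↦ (1 : ℝ))
    (g := fun z x ↦ χ x • f (z, -x)) (k := Metric.closedBall 0 2) isOpen_univ
    (isCompact_closedBall 0 2) ?_ ?_ ?_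
  · rw [contDiffOn_univ] at key
    convert key using 2 with z
    rw [convolution_def, intervalIntegral.integral_of_le zero_le_one,
      ← integral_indicator measurableSet_Ioc]
    congr 1
    ext t
    by_cases ht : t ∈ Ioc (0 : ℝ) 1
    · have h1 : χ (0 - t) = 1 := by
        refine χ.one_of_mem_closedBall ?_
        simp only [zero_sub, Metric.mem_closedBall, dist_zero_right, norm_neg, Real.norm_eq_abs]
        rw [abs_of_pos ht.1]
        exact ht.2
      rw [indicator_of_mem ht, indicator_of_mem ht, h1]
      simp
    · rw [indicator_of_notMem ht, indicator_of_notMem ht]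
      simp
  · intro z x _ hx
    have h1 : χ x = 0 := by
      refine χ.zero_of_le_dist ?_
      simp only [Metric.mem_closedBall, not_le] at hx
      exact hx.le
    simp [h1]
  · refine (integrable_indicator_iff measurableSet_Ioc).2 ?_ |>.locallyIntegrable
    exact integrableOn_const (by simp)
  · refine ContDiff.contDiffOn ?_
    exact (χ.contDiff.comp contDiff_snd).smul (hf.comp (contDiff_fst.prodMk contDiff_snd.neg))

variable {G : Type*} [NormedAddCommGroup G] [NormedSpace ℝ G] (ℓ : G →L[ℝ] ℝ) (e₀ : G)

/-- The projection of a vector space onto the hyperplane `ℓ = 0` along `e₀`. -/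
def hproj : G →L[ℝ] G := ContinuousLinearMap.id ℝ G - ℓ.smulRight e₀

lemma hproj_apply (z : G) : hproj ℓ e₀ z = z - ℓ z • e₀ := rfl

lemma hproj_add_smul (z : G) : hproj ℓ e₀ z + ℓ z • e₀ = z := by simp [hproj_apply]

variable {ℓ e₀} in
lemma apply_hproj (h₀ : ℓ e₀ = 1) (z : G) : ℓ (hproj ℓ e₀ z) = 0 := by simp [hproj_apply, h₀]

variable {ℓ e₀} in
lemma hproj_self (h₀ : ℓ e₀ = 1) : hproj ℓ e₀ e₀ = 0 := by simp [hproj_apply, h₀]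

variable {ℓ e₀} in
lemma hproj_hproj_add (h₀ : ℓ e₀ = 1) (z : G) (t : ℝ) :
    hproj ℓ e₀ (hproj ℓ e₀ z + t • e₀) = hproj ℓ e₀ z := by simp [hproj_apply, h₀]

/-- The 1-form `z ↦ ∫ η(e₀, ·)`, integrated along `e₀` from the hyperplane `ℓ = 0` to `z`. For
alternating `η`, composing with the projection does not change the integrand. -/
def fiberIntegral (η : G → G →L[ℝ] G →L[ℝ] ℝ) (z : G) : G →L[ℝ] ℝ :=
  ∫ σ in (0 : ℝ)..ℓ z, (η (hproj ℓ e₀ z + σ • e₀) e₀).comp (hproj ℓ e₀)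

/-- The sum of the pull-back of `η` under the projection to the hyperplane `ℓ = 0` and of the
exterior derivative of `fiberIntegral ℓ e₀ η`: a 2-form which agrees with `η` on the hyperplane, has
the same contraction with `e₀`, and is closed if `η` is closed along the hyperplane. -/
def collarForm (η : G → G →L[ℝ] G →L[ℝ] ℝ) (z : G) : G →L[ℝ] G →L[ℝ] ℝ :=
  pullForm (hproj ℓ e₀) (η (hproj ℓ e₀ z))
    + (fderiv ℝ (fiberIntegral ℓ e₀ η) z - (fderiv ℝ (fiberIntegral ℓ e₀ η) z).flip)

/-- A primitive of `c` times `collarForm ℓ e₀ η`, if `a` is a primitive of `c η` along the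
hyperplane. -/
def collarOneForm (c : ℝ) (η : G → G →L[ℝ] G →L[ℝ] ℝ) (a : G → G →L[ℝ] ℝ) (z : G) : G →L[ℝ] ℝ :=
  (a (hproj ℓ e₀ z)).comp (hproj ℓ e₀) + c • fiberIntegral ℓ e₀ η z

variable {ℓ e₀} {η : G → G →L[ℝ] G →L[ℝ] ℝ} {a : G → G →L[ℝ] ℝ} {c : ℝ}

lemma contDiff_fiberIntegral (hη : ContDiff ℝ ∞ η) : ContDiff ℝ ∞ (fiberIntegral ℓ e₀ η) := by
  have h1 : fiberIntegral ℓ e₀ η = fun z ↦ ℓ z • ∫ τ in (0 : ℝ)..1,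
      (η (hproj ℓ e₀ z + (ℓ z * τ) • e₀) e₀).comp (hproj ℓ e₀) := by
    ext1 z
    rw [intervalIntegral.smul_integral_comp_mul_left
      (fun σ ↦ (η (hproj ℓ e₀ z + σ • e₀) e₀).comp (hproj ℓ e₀))]
    simp [fiberIntegral]
  rw [h1]
  refine ℓ.contDiff.smul (contDiff_integral_unitInterval (f := fun q : G × ℝ ↦
    (η (hproj ℓ e₀ q.1 + (ℓ q.1 * q.2) • e₀) e₀).comp (hproj ℓ e₀)) ?_)
  have h2 : ContDiff ℝ ∞ (fun q : G × ℝ ↦ hproj ℓ e₀ q.1 + (ℓ q.1 * q.2) • e₀) :=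
    ((hproj ℓ e₀).contDiff.comp contDiff_fst).add
      (((ℓ.contDiff.comp contDiff_fst).mul contDiff_snd).smul contDiff_const)
  exact ((hη.comp h2).clm_apply contDiff_const).clm_comp contDiff_const

lemma contDiff_collarForm [FiniteDimensional ℝ G] (hη : ContDiff ℝ ∞ η) :
    ContDiff ℝ ∞ (collarForm ℓ e₀ η) := by
  have h1 : ContDiff ℝ ∞ (fderiv ℝ (fiberIntegral ℓ e₀ η)) :=
    (contDiff_fiberIntegral hη).fderiv_right (by simp)
  have h2 := hη.comp (hproj ℓ e₀).contDiff
  refine contDiff_clm_apply_iff.2 fun v ↦ contDiff_clm_apply_iff.2 fun w ↦ ?_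
  exact ((h2.clm_apply contDiff_const).clm_apply contDiff_const).add
    (((h1.clm_apply contDiff_const).clm_apply contDiff_const).sub
      ((h1.clm_apply contDiff_const).clm_apply contDiff_const))

lemma contDiff_collarOneForm (hη : ContDiff ℝ ∞ η) (ha : ContDiff ℝ ∞ a) :
    ContDiff ℝ ∞ (collarOneForm ℓ e₀ c η a) :=
  ((ha.comp (hproj ℓ e₀).contDiff).clm_comp contDiff_const).add
    ((contDiff_fiberIntegral hη).const_smul c)

lemma collarForm_alternating (h : ∀ z v, η z v v = 0) (z v : G) :
    collarForm ℓ e₀ η z v v = 0 := by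
  simp [collarForm, h]

lemma differentiable_of_contDiff {F F' : Type*} [NormedAddCommGroup F] [NormedSpace ℝ F]
    [NormedAddCommGroup F'] [NormedSpace ℝ F'] {f : F → F'} (hf : ContDiff ℝ ∞ f) :
    Differentiable ℝ f := hf.differentiable (by simp)

/-- The 2-form `collarForm` is closed where `η` is closed on the hyperplane: pull-backs commute with
the exterior derivative, and the second term is exact. -/
lemma d2_collarForm (hη : ContDiff ℝ ∞ η) (halt : ∀ z v, η z v v = 0) {z : G}
    (hcl : ∀ u v w, d2 η (hproj ℓ e₀ z) u v w = 0) (u v w : G) :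
    d2 (collarForm ℓ e₀ η) z u v w = 0 := by
  have hΓ := contDiff_fiberIntegral (ℓ := ℓ) (e₀ := e₀) hη
  have h1 : ContDiff ℝ ∞ (fderiv ℝ (fiberIntegral ℓ e₀ η)) := hΓ.fderiv_right (by simp)
  have h2 := d2_pullForm (T := hproj ℓ e₀) (z := z) (hproj ℓ e₀).contDiff.contDiffAt
    (differentiable_of_contDiff hη).differentiableAt
    (fun v w ↦ apply_swap_of_alternating (halt _) v w) u v w
  rw [hcl] at h2
  have h3 : ∀ u v w, fderiv ℝ (collarForm ℓ e₀ η) z u v w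
      = fderiv ℝ (fun z ↦ pullForm (fderiv ℝ (hproj ℓ e₀) z) (η (hproj ℓ e₀ z))) z u v w
      + (fderiv ℝ (fderiv ℝ (fiberIntegral ℓ e₀ η)) z u v w
        - fderiv ℝ (fderiv ℝ (fiberIntegral ℓ e₀ η)) z u w v) := by
    intro u v w
    have e1 : DifferentiableAt ℝ
        (fun z ↦ pullForm (fderiv ℝ (hproj ℓ e₀) z) (η (hproj ℓ e₀ z))) z := by
      simp only [ContinuousLinearMap.fderiv, pullForm]
      have := (differentiable_of_contDiff hη).comp (hproj ℓ e₀).differentiable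
      exact ((differentiable_const _).clm_comp (this.clm_comp (differentiable_const _))) z
    have e2 := ((differentiable_of_contDiff h1) z).hasFDerivAt
    have e3 := (ContinuousLinearMap.flipₗᵢ ℝ G G ℝ).toContinuousLinearEquiv.toContinuousLinearMap
      |>.hasFDerivAt.comp z e2
    have e4 := e1.hasFDerivAt.add (e2.sub e3)
    have e5 : collarForm ℓ e₀ η =
      (fun z ↦ pullForm (fderiv ℝ (hproj ℓ e₀) z) (η (hproj ℓ e₀ z)))
        + (fderiv ℝ (fiberIntegral ℓ e₀ η) -
          (ContinuousLinearMap.flipₗᵢ ℝ G G ℝ).toContinuousLinearEquiv.toContinuousLinearMap ∘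
            fderiv ℝ (fiberIntegral ℓ e₀ η)) := by
      ext x v w
      simp [collarForm]
    rw [e5, e4.fderiv]
    simp
  simp only [d2] at h2 ⊢
  rw [h3, h3, h3]
  have h4 := fun u v w ↦ congrArg (fun L ↦ L w)
    (fderiv_fderiv_comm_of_contDiffAt (hΓ.contDiffAt (x := z)) u v)
  linarith [h4 u v w, h4 v w u, h4 w u v]

lemma continuous_fiberIntegral_integrand (hη : ContDiff ℝ ∞ η) (z : G) :
    Continuous fun σ : ℝ ↦ (η (z + σ • e₀) e₀).comp (hproj ℓ e₀) := by
  have := hη.continuous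
  fun_prop

lemma fiberIntegral_apply_self (h₀ : ℓ e₀ = 1) (hη : ContDiff ℝ ∞ η) (z : G) :
    fiberIntegral ℓ e₀ η z e₀ = 0 := by
  rw [fiberIntegral, ContinuousLinearMap.intervalIntegral_apply
    ((continuous_fiberIntegral_integrand hη _).intervalIntegrable _ _)]
  simp [hproj_self h₀]

lemma fderiv_fiberIntegral_apply_self (h₀ : ℓ e₀ = 1) (hη : ContDiff ℝ ∞ η) (z u : G) :
    fderiv ℝ (fiberIntegral ℓ e₀ η) z u e₀ = 0 := by
  have h1 := (differentiable_of_contDiff (contDiff_fiberIntegral (ℓ := ℓ) (e₀ := e₀) hη) z)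
    |>.hasFDerivAt.clm_apply (hasFDerivAt_const e₀ z)
  have h2 : HasFDerivAt (fun z ↦ fiberIntegral ℓ e₀ η z e₀) (0 : G →L[ℝ] ℝ) z := by
    simp only [fiberIntegral_apply_self h₀ hη]
    exact hasFDerivAt_const 0 z
  have h3 := congrArg (fun L ↦ L u) (h1.unique h2)
  simpa using h3

lemma fderiv_fiberIntegral_normal (h₀ : ℓ e₀ = 1) (hη : ContDiff ℝ ∞ η) (z : G) :
    fderiv ℝ (fiberIntegral ℓ e₀ η) z e₀ = (η z e₀).comp (hproj ℓ e₀) := by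
  have h1 : HasDerivAt (fun t : ℝ ↦ z + t • e₀) e₀ 0 := by
    simpa using ((hasDerivAt_id (0 : ℝ)).smul_const e₀).const_add z
  have h2 : HasFDerivAt (fiberIntegral ℓ e₀ η) (fderiv ℝ (fiberIntegral ℓ e₀ η) z)
      (z + (0 : ℝ) • e₀) := by
    rw [zero_smul, add_zero]
    exact (differentiable_of_contDiff (contDiff_fiberIntegral hη) z).hasFDerivAt
  have h3 := h2.comp_hasDerivAt 0 h1
  have hc := continuous_fiberIntegral_integrand (ℓ := ℓ) (e₀ := e₀) hη (hproj ℓ e₀ z)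
  have h4 := intervalIntegral.integral_hasDerivAt_right (hc.intervalIntegrable 0 (ℓ z))
    hc.stronglyMeasurable.stronglyMeasurableAtFilter hc.continuousAt
  have h4' : HasDerivAt (fun u ↦ ∫ x in (0 : ℝ)..u,
      (η (hproj ℓ e₀ z + x • e₀) e₀).comp (hproj ℓ e₀)) ((η z e₀).comp (hproj ℓ e₀))
      (ℓ z + 0) := by
    rw [hproj_add_smul] at h4
    rwa [add_zero]
  have h5 := h4'.comp_const_add (ℓ z) 0
  refine h3.unique (h5.congr_of_eventuallyEq (Filter.Eventually.of_forall fun t ↦ ?_))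
  simp [fiberIntegral, h₀, hproj_self h₀]

lemma fiberIntegral_of_apply_eq_zero {z : G} (hz : ℓ z = 0) : fiberIntegral ℓ e₀ η z = 0 := by
  simp [fiberIntegral, hz]

lemma fderiv_fiberIntegral_of_apply_eq_zero (h₀ : ℓ e₀ = 1) (hη : ContDiff ℝ ∞ η) {z : G}
    (hz : ℓ z = 0) (u : G) :
    fderiv ℝ (fiberIntegral ℓ e₀ η) z u = ℓ u • (η z e₀).comp (hproj ℓ e₀) := by
  have h0 : fderiv ℝ (fiberIntegral ℓ e₀ η) z (hproj ℓ e₀ u) = 0 := by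
    have h1 : HasDerivAt (fun t : ℝ ↦ z + t • hproj ℓ e₀ u) (hproj ℓ e₀ u) 0 := by
      simpa using ((hasDerivAt_id (0 : ℝ)).smul_const (hproj ℓ e₀ u)).const_add z
    have h2 : HasFDerivAt (fiberIntegral ℓ e₀ η) (fderiv ℝ (fiberIntegral ℓ e₀ η) z)
        (z + (0 : ℝ) • hproj ℓ e₀ u) := by
      rw [zero_smul, add_zero]
      exact (differentiable_of_contDiff (contDiff_fiberIntegral hη) z).hasFDerivAt
    have h3 := h2.comp_hasDerivAt 0 h1
    refine h3.unique ((hasDerivAt_const (0 : ℝ) (0 : G →L[ℝ] ℝ)).congr_of_eventuallyEq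
      (Filter.Eventually.of_forall fun t ↦ ?_))
    refine fiberIntegral_of_apply_eq_zero ?_
    simp [hz, apply_hproj h₀]
  conv_lhs => rw [← hproj_add_smul ℓ e₀ u]
  rw [map_add, map_smul, h0, zero_add, fderiv_fiberIntegral_normal h₀ hη]

lemma collarForm_normal (h₀ : ℓ e₀ = 1) (hη : ContDiff ℝ ∞ η) (halt : ∀ z v, η z v v = 0)
    (z w : G) : collarForm ℓ e₀ η z e₀ w = η z e₀ w := by
  simp only [collarForm, add_apply, sub_apply, pullForm_apply, ContinuousLinearMap.flip_apply,
    fderiv_fiberIntegral_apply_self h₀ hη, fderiv_fiberIntegral_normal h₀ hη, hproj_self h₀,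
    map_zero, zero_apply, ContinuousLinearMap.comp_apply]
  simp [hproj_apply, halt]

lemma collarForm_of_apply_eq_zero (h₀ : ℓ e₀ = 1) (hη : ContDiff ℝ ∞ η)
    (halt : ∀ z v, η z v v = 0) {z : G} (hz : ℓ z = 0) : collarForm ℓ e₀ η z = η z := by
  have hP : hproj ℓ e₀ z = z := by simp [hproj_apply, hz]
  ext v w
  simp only [collarForm, add_apply, sub_apply, pullForm_apply, ContinuousLinearMap.flip_apply,
    fderiv_fiberIntegral_of_apply_eq_zero h₀ hη hz, hP, smul_apply,
    ContinuousLinearMap.comp_apply, smul_eq_mul]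
  have h1 := apply_swap_of_alternating (halt z) v e₀
  simp only [hproj_apply, map_sub, map_smul, sub_apply, smul_apply, smul_eq_mul, halt, h1]
  ring

/-- The 2-form `collarForm` agrees with `η` along segments in the direction `e₀`, starting on the
hyperplane, on which `η` is closed. -/
lemma collarForm_eq (h₀ : ℓ e₀ = 1) (hη : ContDiff ℝ ∞ η) [FiniteDimensional ℝ G]
    (halt : ∀ z v, η z v v = 0) {z : G}
    (hcl : ∀ τ ∈ Icc (0 : ℝ) 1, ∀ u v w, d2 η (hproj ℓ e₀ z + (τ * ℓ z) • e₀) u v w = 0) :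
    collarForm ℓ e₀ η z = η z := by
  have hD := (contDiff_collarForm (ℓ := ℓ) (e₀ := e₀) hη)
  -- the difference `δ` is closed along the segment and annihilates `e₀`, hence is constant there
  set δ : G → G →L[ℝ] G →L[ℝ] ℝ := fun z ↦ collarForm ℓ e₀ η z - η z with hδ
  have hδd : Differentiable ℝ δ := differentiable_of_contDiff (hD.sub hη)
  have hδ0 : ∀ x w, δ x w e₀ = 0 := by
    intro x w
    simp only [hδ, sub_apply]
    rw [apply_swap_of_alternating (collarForm_alternating halt x) w e₀,
      apply_swap_of_alternating (halt x) w e₀, collarForm_normal h₀ hη halt]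
    ring
  have hδ1 : ∀ x u w, fderiv ℝ δ x u w e₀ = 0 := by
    intro x u w
    have h1 := ((hδd x).hasFDerivAt.clm_apply (hasFDerivAt_const w x)).clm_apply
      (hasFDerivAt_const e₀ x)
    have h2 : HasFDerivAt (fun x ↦ δ x w e₀) (0 : G →L[ℝ] ℝ) x := by
      simp only [hδ0]
      exact hasFDerivAt_const 0 x
    have h3 := congrArg (fun L ↦ L u) (h1.unique h2)
    simpa using h3
  have hδ1' : ∀ x u w, fderiv ℝ δ x u e₀ w = 0 := by
    intro x u w
    have hδ0' : ∀ x w, δ x e₀ w = 0 := by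
      intro x w
      simp only [hδ, sub_apply]
      rw [collarForm_normal h₀ hη halt, sub_self]
    have h1 := ((hδd x).hasFDerivAt.clm_apply (hasFDerivAt_const e₀ x)).clm_apply
      (hasFDerivAt_const w x)
    have h2 : HasFDerivAt (fun x ↦ δ x e₀ w) (0 : G →L[ℝ] ℝ) x := by
      simp only [hδ0']
      exact hasFDerivAt_const 0 x
    have h3 := congrArg (fun L ↦ L u) (h1.unique h2)
    simpa using h3
  have hd2 : ∀ x, (∀ u v w, d2 η x u v w = 0) → (∀ u v w, d2 η (hproj ℓ e₀ x) u v w = 0) →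
      fderiv ℝ δ x e₀ = 0 := by
    intro x hx hx'
    ext v w
    have h1 := d2_collarForm hη halt hx' e₀ v w
    have h2 := hx e₀ v w
    have h3 : ∀ u v w, fderiv ℝ δ x u v w
        = fderiv ℝ (collarForm ℓ e₀ η) x u v w - fderiv ℝ η x u v w := by
      intro u v w
      rw [hδ, fderiv_fun_sub (differentiable_of_contDiff hD x) (differentiable_of_contDiff hη x)]
      rfl
    have h4 := hδ1 x v w
    have h5 := hδ1' x w v
    simp only [d2] at h1 h2
    rw [h3] at h4 h5
    rw [h3]
    simp only [zero_apply]
    linarith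
  -- `δ` is constant on the segment from the projection of `z` to `z`
  have hseg : ∀ τ ∈ Icc (0 : ℝ) 1, δ (hproj ℓ e₀ z + (τ * ℓ z) • e₀) = δ (hproj ℓ e₀ z) := by
    have hline : ∀ τ : ℝ, HasDerivAt (fun τ : ℝ ↦ hproj ℓ e₀ z + (τ * ℓ z) • e₀)
        (ℓ z • e₀) τ := by
      intro τ
      simpa using (((hasDerivAt_id τ).mul_const (ℓ z)).smul_const e₀).const_add (hproj ℓ e₀ z)
    have hder : ∀ τ : ℝ, HasDerivAt (fun τ : ℝ ↦ δ (hproj ℓ e₀ z + (τ * ℓ z) • e₀))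
        (fderiv ℝ δ (hproj ℓ e₀ z + (τ * ℓ z) • e₀) (ℓ z • e₀)) τ := fun τ ↦
      (hδd _).hasFDerivAt.comp_hasDerivAt τ (hline τ)
    intro τ hτ
    have h1 := constant_of_has_deriv_right_zero (a := 0) (b := 1)
      (f := fun τ : ℝ ↦ δ (hproj ℓ e₀ z + (τ * ℓ z) • e₀))
      (fun τ _ ↦ (hder τ).continuousAt.continuousWithinAt) (fun τ hτ ↦ ?_) τ hτ
    · simpa using h1
    · have h2 := (hder τ).hasDerivWithinAt (s := Ici τ)
      rw [map_smul, hd2 _ (hcl τ (Ico_subset_Icc_self hτ)), smul_zero] at h2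
      · exact h2
      · rw [hproj_hproj_add h₀]
        simpa using hcl 0 (by simp)
  have h1 := hseg 1 (by simp)
  rw [one_mul, hproj_add_smul] at h1
  have h2 : δ (hproj ℓ e₀ z) = 0 := by
    simp only [hδ, collarForm_of_apply_eq_zero h₀ hη halt (apply_hproj h₀ z), sub_self]
  rw [h2] at h1
  exact sub_eq_zero.1 h1

/-- The 1-form `collarOneForm` is a primitive of `c` times `collarForm`. -/
lemma d1_collarOneForm (hη : ContDiff ℝ ∞ η) (ha : ContDiff ℝ ∞ a) {z : G}
    (hda : ∀ v w, d1 a (hproj ℓ e₀ z) v w = c * η (hproj ℓ e₀ z) v w) (v w : G) :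
    d1 (collarOneForm ℓ e₀ c η a) z v w = c * collarForm ℓ e₀ η z v w := by
  have h1 := d1_pull (T := hproj ℓ e₀) (z := z) (hproj ℓ e₀).contDiff.contDiffAt
    (differentiable_of_contDiff ha).differentiableAt v w
  rw [hda] at h1
  have h2 : ∀ v w, fderiv ℝ (collarOneForm ℓ e₀ c η a) z v w
      = fderiv ℝ (fun z ↦ (a (hproj ℓ e₀ z)).comp (fderiv ℝ (hproj ℓ e₀) z)) z v w
        + c * fderiv ℝ (fiberIntegral ℓ e₀ η) z v w := by
    intro v w
    have e1 : DifferentiableAt ℝ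
        (fun z ↦ (a (hproj ℓ e₀ z)).comp (fderiv ℝ (hproj ℓ e₀) z)) z := by
      simp only [ContinuousLinearMap.fderiv]
      have := (differentiable_of_contDiff ha).comp (hproj ℓ e₀).differentiable
      exact (this.clm_comp (differentiable_const _)) z
    have e2 := (differentiable_of_contDiff (contDiff_fiberIntegral (ℓ := ℓ) (e₀ := e₀) hη)) z
    have e4 := e1.hasFDerivAt.add (e2.hasFDerivAt.const_smul c)
    have e5 : collarOneForm ℓ e₀ c η a =
      (fun z ↦ (a (hproj ℓ e₀ z)).comp (fderiv ℝ (hproj ℓ e₀) z))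
        + c • fiberIntegral ℓ e₀ η := by
      ext x v
      simp [collarOneForm]
    rw [e5, e4.fderiv]
    simp
  simp only [d1] at h1 ⊢
  rw [h2, h2]
  simp only [ContinuousLinearMap.fderiv] at h1
  simp only [collarForm, add_apply, sub_apply, pullForm_apply, ContinuousLinearMap.flip_apply,
    ContinuousLinearMap.fderiv]
  linarith

end Collar

section Collar

variable {G : Type*} [NormedAddCommGroup G] [NormedSpace ℝ G]
  {ℓ : G →L[ℝ] ℝ} {e₀ : G} {η η' : G → G →L[ℝ] G →L[ℝ] ℝ} {a a' : G → G →L[ℝ] ℝ} {c : ℝ}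

/-- On the hyperplane, the vector field dual to `collarOneForm` has the same normal component as the
vector field dual to `a`. -/
lemma apply_inverse_collarOneForm [FiniteDimensional ℝ G] (h₀ : ℓ e₀ = 1) (hη : ContDiff ℝ ∞ η)
    (halt : ∀ z v, η z v v = 0) {z : G} (hz : ℓ z = 0)
    (hnd : ∀ v, (∀ w, η z v w = 0) → v = 0) {X : G} (hX : a z = η z X) :
    ℓ ((collarForm ℓ e₀ η z).inverse (collarOneForm ℓ e₀ c η a z)) = ℓ X := by
  have hinv := isInvertible_of_nondegenerate hnd
  have hP : hproj ℓ e₀ z = z := by simp [hproj_apply, hz]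
  rw [collarForm_of_apply_eq_zero h₀ hη halt hz, collarOneForm,
    fiberIntegral_of_apply_eq_zero hz, smul_zero, add_zero, hP]
  have h1 : (a z).comp (hproj ℓ e₀) = η z X - a z e₀ • ℓ := by
    ext v
    rw [← hX]
    simp [hproj_apply, mul_comm]
  have h2 : ∀ v, (η z).inverse (η z v) = v := fun v ↦ hinv.inverse_apply_self v
  have h3 : η z ((η z).inverse ℓ) = ℓ := hinv.self_apply_inverse ℓ
  have h4 : ℓ ((η z).inverse ℓ) = 0 := by
    have h5 := halt z ((η z).inverse ℓ)
    rwa [h3] at h5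
  rw [h1, map_sub, map_smul, h2, map_sub, map_smul, h4, smul_zero, sub_zero]

lemma eventually_isInvertible [FiniteDimensional ℝ G] {S : G → G →L[ℝ] G →L[ℝ] ℝ} {z : G}
    (hS : ContinuousAt S z) (h : (S z).IsInvertible) : ∀ᶠ x in 𝓝 z, (S x).IsInvertible := by
  have : CompleteSpace G := FiniteDimensional.complete ℝ G
  exact hS.eventually (ContinuousLinearEquiv.isOpen.mem_nhds h)

/-- Near a point of the hyperplane, the form `collarForm` is symplectic and the vector field dual
to `collarOneForm` is transverse to the hyperplanes. -/
lemma eventually_nondegenerate_collarForm [FiniteDimensional ℝ G] (h₀ : ℓ e₀ = 1)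
    (hη : ContDiff ℝ ∞ η) (ha : ContDiff ℝ ∞ a) (halt : ∀ z v, η z v v = 0) {z : G} (hz : ℓ z = 0)
    (hnd : ∀ v, (∀ w, η z v w = 0) → v = 0) {X : G} (hX : a z = η z X) (hℓX : 0 < ℓ X) :
    ∀ᶠ x in 𝓝 z, (collarForm ℓ e₀ η x).IsInvertible ∧
      0 < ℓ ((collarForm ℓ e₀ η x).inverse (collarOneForm ℓ e₀ c η a x)) := by
  have : CompleteSpace G := FiniteDimensional.complete ℝ G
  have hinv : (collarForm ℓ e₀ η z).IsInvertible := by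
    rw [collarForm_of_apply_eq_zero h₀ hη halt hz]
    exact isInvertible_of_nondegenerate hnd
  have h1 := (contDiff_collarForm (ℓ := ℓ) (e₀ := e₀) hη).continuous.continuousAt (x := z)
  have h2 : ContinuousAt (fun x ↦ (collarForm ℓ e₀ η x).inverse) z :=
    ((hinv.contDiffAt_map_inverse (n := ∞)).continuousAt).comp (f := collarForm ℓ e₀ η) h1
  have h3 := (contDiff_collarOneForm (ℓ := ℓ) (e₀ := e₀) (c := c) hη ha).continuous.continuousAt
    (x := z)
  have h4 : ContinuousAt
      (fun x ↦ ℓ ((collarForm ℓ e₀ η x).inverse (collarOneForm ℓ e₀ c η a x))) z :=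
    ℓ.continuous.continuousAt.comp (h2.clm_apply h3)
  refine (eventually_isInvertible h1 hinv).and (h4.eventually (lt_mem_nhds ?_))
  simp only
  rwa [apply_inverse_collarOneForm h₀ hη halt hz hnd hX]

/-- A map `T` which, on an open set `U`, commutes with the translations along `e₀` down to the
hyperplane `ℓ = 0`, and pulls back `η'` and `a'` to `η` and `a`. -/
structure IsCollarMap (ℓ : G →L[ℝ] ℝ) (e₀ : G) (η η' : G → G →L[ℝ] G →L[ℝ] ℝ)
    (a a' : G → G →L[ℝ] ℝ) (T : G → G) (U : Set G) : Prop where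
  isOpen : IsOpen U
  pos : ∀ x ∈ U, 0 < ℓ x
  smooth : ∀ x ∈ U, ∀ σ ∈ Icc 0 (ℓ x), ContDiffAt ℝ ∞ T (hproj ℓ e₀ x + σ • e₀)
  map_add : ∀ x ∈ U, ∀ σ ∈ Icc 0 (ℓ x), T (hproj ℓ e₀ x + σ • e₀) = hproj ℓ e₀ (T x) + σ • e₀
  apply_map : ∀ x ∈ U, ℓ (T x) = ℓ x
  form : ∀ x ∈ U, ∀ σ ∈ Icc 0 (ℓ x), η (hproj ℓ e₀ x + σ • e₀)
    = pullForm (fderiv ℝ T (hproj ℓ e₀ x + σ • e₀)) (η' (T (hproj ℓ e₀ x + σ • e₀)))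
  one_form : ∀ x ∈ U, ∀ σ ∈ Icc 0 (ℓ x), a (hproj ℓ e₀ x + σ • e₀)
    = (a' (T (hproj ℓ e₀ x + σ • e₀))).comp (fderiv ℝ T (hproj ℓ e₀ x + σ • e₀))

namespace IsCollarMap

variable {T : G → G} {U : Set G} {z : G}

lemma contDiffAt (h : IsCollarMap ℓ e₀ η η' a a' T U) (hz : z ∈ U) : ContDiffAt ℝ ∞ T z := by
  have h1 := h.smooth z hz (ℓ z) ⟨(h.pos z hz).le, le_rfl⟩
  rwa [hproj_add_smul] at h1

lemma hasFDerivAt (h : IsCollarMap ℓ e₀ η η' a a' T U) (hz : z ∈ U) :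
    HasFDerivAt T (fderiv ℝ T z) z :=
  ((h.contDiffAt hz).differentiableAt (by simp)).hasFDerivAt

lemma apply_fderiv (h : IsCollarMap ℓ e₀ η η' a a' T U) (hz : z ∈ U) (u : G) :
    ℓ (fderiv ℝ T z u) = ℓ u := by
  have h1 : HasFDerivAt (fun x ↦ ℓ (T x)) _ z := ℓ.hasFDerivAt.comp z (h.hasFDerivAt hz)
  have h2 : HasFDerivAt (fun x ↦ ℓ (T x)) ℓ z := by
    refine ℓ.hasFDerivAt.congr_of_eventuallyEq ?_
    filter_upwards [h.isOpen.mem_nhds hz] with x hx using h.apply_map x hx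
  exact congrArg (fun L ↦ L u) (h1.unique h2)

lemma fderiv_self (h : IsCollarMap ℓ e₀ η η' a a' T U) (hz : z ∈ U) :
    fderiv ℝ T z e₀ = e₀ := by
  have h1 : HasDerivAt (fun t : ℝ ↦ z + t • e₀) e₀ 0 := by
    simpa using ((hasDerivAt_id (0 : ℝ)).smul_const e₀).const_add z
  have h2 : HasFDerivAt T (fderiv ℝ T z) (z + (0 : ℝ) • e₀) := by
    rw [zero_smul, add_zero]
    exact h.hasFDerivAt hz
  have h3 := (h2.comp_hasDerivAt 0 h1).hasDerivWithinAt (s := Iic 0)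
  have h4 : HasDerivWithinAt (fun t : ℝ ↦ T z + t • e₀) e₀ (Iic 0) 0 := by
    simpa using (((hasDerivAt_id (0 : ℝ)).smul_const e₀).const_add (T z)).hasDerivWithinAt
  refine (uniqueDiffWithinAt_Iic (0 : ℝ)).eq_deriv _ h3 (h4.congr_of_eventuallyEq ?_ (by simp))
  have h5 : ∀ᶠ t : ℝ in 𝓝[Iic 0] 0, -ℓ z < t :=
    nhdsWithin_le_nhds (lt_mem_nhds (by linarith [h.pos z hz]))
  filter_upwards [h5, self_mem_nhdsWithin] with t ht ht'
  have h6 := h.map_add z hz (ℓ z + t) ⟨by linarith, by linarith [show t ≤ 0 from ht']⟩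
  have h7 : hproj ℓ e₀ z + (ℓ z + t) • e₀ = z + t • e₀ := by
    rw [add_smul, ← add_assoc, hproj_add_smul]
  have h8 : hproj ℓ e₀ (T z) + (ℓ z + t) • e₀ = T z + t • e₀ := by
    rw [← h.apply_map z hz, add_smul, ← add_assoc, hproj_add_smul]
  rw [h7, h8] at h6
  exact h6

lemma hproj_fderiv (h : IsCollarMap ℓ e₀ η η' a a' T U) (hz : z ∈ U) (u : G) :
    hproj ℓ e₀ (fderiv ℝ T z u) = fderiv ℝ T z (hproj ℓ e₀ u) := by
  rw [hproj_apply, hproj_apply, h.apply_fderiv hz, map_sub, map_smul, h.fderiv_self hz]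

/-- The derivative of a collar map does not depend on the normal coordinate. -/
lemma fderiv_eq (h : IsCollarMap ℓ e₀ η η' a a' T U) (hz : z ∈ U) {σ : ℝ}
    (hσ : σ ∈ Icc 0 (ℓ z)) :
    fderiv ℝ T (hproj ℓ e₀ z + σ • e₀) = fderiv ℝ T z := by
  have hpos : ∀ σ ∈ Ioc 0 (ℓ z), fderiv ℝ T (hproj ℓ e₀ z + σ • e₀) = fderiv ℝ T z := by
    intro σ hσ
    have h1 : (fun x ↦ T (x + (σ - ℓ z) • e₀)) =ᶠ[𝓝 z] fun x ↦ T x + (σ - ℓ z) • e₀ := by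
      have h2 : ∀ᶠ x in 𝓝 z, ℓ z - σ < ℓ x :=
        ℓ.continuous.continuousAt.eventually (lt_mem_nhds (by linarith [hσ.1]))
      filter_upwards [h2, h.isOpen.mem_nhds hz] with x hx hxU
      have h6 := h.map_add x hxU (ℓ x + (σ - ℓ z)) ⟨by linarith, by linarith [hσ.2]⟩
      have h7 : hproj ℓ e₀ x + (ℓ x + (σ - ℓ z)) • e₀ = x + (σ - ℓ z) • e₀ := by
        rw [add_smul, ← add_assoc, hproj_add_smul]
      have h8 : hproj ℓ e₀ (T x) + (ℓ x + (σ - ℓ z)) • e₀ = T x + (σ - ℓ z) • e₀ := by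
        rw [← h.apply_map x hxU, add_smul, ← add_assoc, hproj_add_smul]
      rw [h7, h8] at h6
      exact h6
    have h9 := h1.fderiv_eq (𝕜 := ℝ)
    rw [fderiv_comp_add_right, fderiv_add_const] at h9
    rw [← h9]
    congr 1
    rw [hproj_apply]
    module
  rcases eq_or_lt_of_le hσ.1 with h0 | h0
  · -- the case `σ = 0` follows by continuity of the derivative
    subst h0
    have hcont : ContinuousAt (fderiv ℝ T) (hproj ℓ e₀ z + (0 : ℝ) • e₀) :=
      (differentiableAt_fderiv_of_contDiffAt (h.smooth z hz 0 hσ)).continuousAt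
    have h1 : Filter.Tendsto (fun σ : ℝ ↦ fderiv ℝ T (hproj ℓ e₀ z + σ • e₀)) (𝓝[>] 0)
        (𝓝 (fderiv ℝ T (hproj ℓ e₀ z + (0 : ℝ) • e₀))) := by
      have h2 : Continuous fun σ : ℝ ↦ hproj ℓ e₀ z + σ • e₀ := by fun_prop
      exact (ContinuousAt.comp (f := fun σ : ℝ ↦ hproj ℓ e₀ z + σ • e₀) hcont
        h2.continuousAt).tendsto.mono_left nhdsWithin_le_nhds
    refine tendsto_nhds_unique h1 (tendsto_const_nhds.congr' ?_)
    filter_upwards [Ioc_mem_nhdsGT (h.pos z hz)] with σ hσ using (hpos σ hσ).symm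
  · exact hpos σ ⟨h0, hσ.2⟩

lemma fiberIntegral_eq (hη' : ContDiff ℝ ∞ η')
    (h : IsCollarMap ℓ e₀ η η' a a' T U) (hz : z ∈ U) :
    fiberIntegral ℓ e₀ η z = (fiberIntegral ℓ e₀ η' (T z)).comp (fderiv ℝ T z) := by
  have h1 := (continuous_fiberIntegral_integrand (ℓ := ℓ) (e₀ := e₀) hη' (hproj ℓ e₀ (T z)))
    |>.intervalIntegrable (μ := MeasureTheory.volume) 0 (ℓ z)
  have h2 := (ContinuousLinearMap.precomp ℝ (fderiv ℝ T z)).intervalIntegral_comp_comm h1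
  rw [fiberIntegral, fiberIntegral, h.apply_map z hz]
  refine Eq.trans ?_ h2
  refine intervalIntegral.integral_congr fun σ hσ ↦ ?_
  rw [uIcc_of_le (h.pos z hz).le] at hσ
  ext u
  simp only [ContinuousLinearMap.precomp_apply, ContinuousLinearMap.comp_apply]
  rw [h.form z hz σ hσ, pullForm_apply, h.fderiv_eq hz hσ, h.map_add z hz σ hσ,
    h.fderiv_self hz, h.hproj_fderiv hz]

lemma map_hproj (h : IsCollarMap ℓ e₀ η η' a a' T U) (hz : z ∈ U) :
    T (hproj ℓ e₀ z) = hproj ℓ e₀ (T z) := by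
  simpa using h.map_add z hz 0 ⟨le_rfl, (h.pos z hz).le⟩

lemma fderiv_hproj (h : IsCollarMap ℓ e₀ η η' a a' T U) (hz : z ∈ U) :
    fderiv ℝ T (hproj ℓ e₀ z) = fderiv ℝ T z := by
  simpa using h.fderiv_eq hz (σ := 0) ⟨le_rfl, (h.pos z hz).le⟩

/-- Collar maps are compatible with the construction of `collarForm`. -/
lemma collarForm_eq_pullForm (hη' : ContDiff ℝ ∞ η')
    (h : IsCollarMap ℓ e₀ η η' a a' T U) (hz : z ∈ U) :
    collarForm ℓ e₀ η z = pullForm (fderiv ℝ T z) (collarForm ℓ e₀ η' (T z)) := by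
  have h1 := h.form z hz 0 ⟨le_rfl, (h.pos z hz).le⟩
  rw [zero_smul, add_zero, h.map_hproj hz, h.fderiv_hproj hz] at h1
  have h2 : fiberIntegral ℓ e₀ η =ᶠ[𝓝 z]
      fun x ↦ (fiberIntegral ℓ e₀ η' (T x)).comp (fderiv ℝ T x) := by
    filter_upwards [h.isOpen.mem_nhds hz] with x hx using h.fiberIntegral_eq hη' hx
  ext v w
  have h3 := d1_congr h2 v w
  rw [d1_pull (h.contDiffAt hz) (differentiable_of_contDiff (contDiff_fiberIntegral hη') _)] at h3
  simp only [d1] at h3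
  simp only [collarForm, add_apply, sub_apply, pullForm_apply, ContinuousLinearMap.flip_apply, h1,
    h3, h.hproj_fderiv hz]

/-- Collar maps are compatible with the construction of `collarOneForm`. -/
lemma collarOneForm_eq_comp (hη' : ContDiff ℝ ∞ η')
    (h : IsCollarMap ℓ e₀ η η' a a' T U) (hz : z ∈ U) :
    collarOneForm ℓ e₀ c η a z = (collarOneForm ℓ e₀ c η' a' (T z)).comp (fderiv ℝ T z) := by
  have h1 := h.one_form z hz 0 ⟨le_rfl, (h.pos z hz).le⟩
  rw [zero_smul, add_zero, h.map_hproj hz, h.fderiv_hproj hz] at h1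
  ext v
  simp [collarOneForm, h1, h.fiberIntegral_eq hη' hz, h.hproj_fderiv hz]

end IsCollarMap

end Collar

/-! ### The profile of the deformation -/

section Profile

/-- The functions of the normal coordinate which govern the deformation: `g` interpolates between
`1` at `s ≤ 0` and `0` at `s ≥ δ`, and `c p / r` is the logarithmic derivative of `1 / g`; the value
`r = 0` stands for an infinite quotient `p / r`. -/
structure IsProfile (c δ : ℝ) (g p r : ℝ → ℝ) : Prop where
  smooth_g : ContDiff ℝ ∞ g
  smooth_p : ContDiff ℝ ∞ p
  smooth_r : ContDiff ℝ ∞ r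
  g_of_nonpos : ∀ s ≤ 0, g s = 1
  p_of_nonpos : ∀ s ≤ 0, p s = 0
  g_of_le : ∀ s, δ ≤ s → g s = 0
  p_nonneg : ∀ s, 0 ≤ p s
  r_nonneg : ∀ s, 0 ≤ r s
  p_add_r_pos : ∀ s, 0 < p s + r s
  deriv_g : ∀ s, r s * deriv g s = -(c * p s * g s)

lemma deriv_eq_zero_of_eventuallyEq_const {f : ℝ → ℝ} {s k : ℝ} (h : ∀ᶠ x in 𝓝 s, f x = k) :
    deriv f s = 0 := by
  have h1 : f =ᶠ[𝓝 s] fun _ ↦ k := h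
  rw [h1.deriv_eq, deriv_const]

/-- A profile for `c = 0`: the step of `g` takes place where `r = 0`. -/
lemma exists_isProfile_zero {δ : ℝ} (hδ : 0 < δ) : ∃ g p r, IsProfile 0 δ g p r := by
  have hθ := Real.smoothTransition.contDiff (n := ⊤)
  refine ⟨fun s ↦ 1 - Real.smoothTransition (2 * s / δ - 1), fun s ↦ Real.smoothTransition
    (2 * s / δ), fun s ↦ 1 - Real.smoothTransition (2 * s / δ), ?_, ?_, ?_, ?_, ?_, ?_, ?_, ?_, ?_,
    ?_⟩
  · exact contDiff_const.sub (hθ.comp (by fun_prop))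
  · exact hθ.comp (by fun_prop)
  · exact contDiff_const.sub (hθ.comp (by fun_prop))
  · intro s hs
    have : 2 * s / δ ≤ 0 := div_nonpos_of_nonpos_of_nonneg (by linarith) hδ.le
    simp only [Real.smoothTransition.zero_of_nonpos (show 2 * s / δ - 1 ≤ 0 by linarith), sub_zero]
  · intro s hs
    exact Real.smoothTransition.zero_of_nonpos
      (div_nonpos_of_nonpos_of_nonneg (by linarith) hδ.le)
  · intro s hs
    have : 1 ≤ s / δ := (one_le_div hδ).2 hs
    have h2 : 1 ≤ 2 * s / δ - 1 := by rw [mul_div_assoc]; linarith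
    simp only [Real.smoothTransition.one_of_one_le h2, sub_self]
  · exact fun s ↦ Real.smoothTransition.nonneg _
  · exact fun s ↦ sub_nonneg.2 (Real.smoothTransition.le_one _)
  · intro s
    simp
  · intro s
    simp only [zero_mul, neg_zero, mul_eq_zero]
    rcases le_or_gt 1 (2 * s / δ) with h | h
    · left
      rw [Real.smoothTransition.one_of_one_le h, sub_self]
    · right
      refine deriv_eq_zero_of_eventuallyEq_const (k := 1) ?_
      have h1 : Continuous fun s : ℝ ↦ 2 * s / δ := by fun_prop
      filter_upwards [h1.continuousAt.eventually (gt_mem_nhds h)] with x hx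
      rw [Real.smoothTransition.zero_of_nonpos (by linarith), sub_zero]

/-- A profile for `c = 1`, given by `exp (-θ / (1 - t))` with `t = s / δ` and a smooth step `θ`. -/
lemma exists_isProfile_one {δ : ℝ} (hδ : 0 < δ) : ∃ g p r, IsProfile 1 δ g p r := by
  have hθ' := Real.smoothTransition.contDiff (n := ⊤)
  set θ : ℝ → ℝ := fun t ↦ Real.smoothTransition (2 * t) with hθdef
  have hθ : ContDiff ℝ ∞ θ := hθ'.comp (by fun_prop)
  have hθ1 : ∀ t, 1 / 2 ≤ t → θ t = 1 := fun t ht ↦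
    Real.smoothTransition.one_of_one_le (by linarith)
  have hθ0 : ∀ t ≤ 0, θ t = 0 := fun t ht ↦
    Real.smoothTransition.zero_of_nonpos (by linarith)
  have hdθ0 : ∀ t, 1 / 2 < t → deriv θ t = 0 := fun t ht ↦
    deriv_eq_zero_of_eventuallyEq_const (k := 1) <| by
      filter_upwards [lt_mem_nhds ht] with x hx using hθ1 x hx.le
  have hmono : Monotone θ := fun x y hxy ↦
    Real.smoothTransition.monotone (by linarith)
  have hdθ : ∀ t, 0 ≤ deriv θ t := fun t ↦ hmono.deriv_nonneg
  have hdθs : ContDiff ℝ ∞ (deriv θ) := (contDiff_infty_iff_deriv.1 hθ).2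
  set G : ℝ → ℝ := fun t ↦ if t < 1 then Real.exp (-θ t / (1 - t)) else 0 with hG
  have hGlt : ∀ t < 1, G =ᶠ[𝓝 t] fun t ↦ Real.exp (-θ t / (1 - t)) := fun t ht ↦ by
    filter_upwards [gt_mem_nhds ht] with x hx using if_pos hx
  have hGs : ContDiff ℝ ∞ G := by
    rw [contDiff_iff_contDiffAt]
    intro t
    rcases lt_or_ge t 1 with ht | ht
    · refine ContDiffAt.congr_of_eventuallyEq ?_ (hGlt t ht)
      refine (ContDiffAt.div hθ.neg.contDiffAt (by fun_prop) (by linarith)).exp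
    · -- near `1`, the step `θ` is constant
      have h1 : G =ᶠ[𝓝 t] fun t ↦ expNegInvGlue (1 - t) := by
        filter_upwards [lt_mem_nhds (show (1 / 2 : ℝ) < t by linarith)] with x hx
        simp only [hG, expNegInvGlue]
        split_ifs with h1 h2 h2
        · linarith
        · rw [hθ1 x hx.le, neg_div, one_div]
        · rfl
        · linarith
      refine ContDiffAt.congr_of_eventuallyEq ?_ h1
      exact (expNegInvGlue.contDiff.comp (by fun_prop)).contDiffAt
  -- the logarithmic derivative of `1 / G` is `(θ' (1 - t) + θ) / (1 - t) ^ 2`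
  have hGd : ∀ t, (1 - t) ^ 2 * deriv G t = -((deriv θ t * (1 - t) + θ t) * G t) := by
    intro t
    rcases lt_trichotomy t 1 with ht | ht | ht
    · have h0 : 1 - t ≠ 0 := by linarith
      have h1 := (hθ.differentiable (by simp) t).hasDerivAt.neg.div
        ((hasDerivAt_id t).const_sub 1) h0
      have h2 : HasDerivAt (fun t ↦ Real.exp (-θ t / (1 - t))) _ t := h1.exp
      rw [(hGlt t ht).deriv_eq, h2.deriv, (hGlt t ht).self_of_nhds]
      simp only [Pi.div_apply, Pi.neg_apply, id]
      field_simp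
      ring
    · subst ht
      simp [hG]
    · have h1 : deriv G t = 0 := deriv_eq_zero_of_eventuallyEq_const (k := 0) <| by
        filter_upwards [lt_mem_nhds ht] with x hx using if_neg (by linarith)
      have h2 : G t = 0 := if_neg (by linarith)
      rw [h1, h2]
      ring
  have hp : ∀ t, 0 ≤ deriv θ t * (1 - t) + θ t := by
    intro t
    have h2 : 0 ≤ θ t := Real.smoothTransition.nonneg _
    rcases le_or_gt t 1 with ht | ht
    · exact add_nonneg (mul_nonneg (hdθ t) (by linarith)) h2
    · rw [hdθ0 t (by linarith)]
      linarith
  refine ⟨fun s ↦ G (s / δ), fun s ↦ deriv θ (s / δ) * (1 - s / δ) + θ (s / δ),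
    fun s ↦ δ * (1 - s / δ) ^ 2, ?_, ?_, ?_, ?_, ?_, ?_, ?_, ?_, ?_, ?_⟩
  · exact hGs.comp (by fun_prop)
  · have h1 : ContDiff ℝ ∞ fun s : ℝ ↦ s / δ := by fun_prop
    exact ((hdθs.comp h1).mul (by fun_prop)).add (hθ.comp h1)
  · fun_prop
  · intro s hs
    have h1 : s / δ ≤ 0 := div_nonpos_of_nonpos_of_nonneg hs hδ.le
    simp only [hG, if_pos (show s / δ < 1 by linarith), hθ0 _ h1]
    simp
  · intro s hs
    have h1 : s / δ ≤ 0 := div_nonpos_of_nonpos_of_nonneg hs hδ.le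
    have h2 : deriv θ (s / δ) = 0 := by
      rcases eq_or_lt_of_le h1 with h3 | h3
      · rw [h3]
        -- the origin is a minimum of `θ`
        refine IsLocalMin.deriv_eq_zero (Filter.Eventually.of_forall fun x ↦ ?_)
        rw [hθ0 0 le_rfl]
        exact Real.smoothTransition.nonneg _
      · refine deriv_eq_zero_of_eventuallyEq_const (k := 0) ?_
        filter_upwards [gt_mem_nhds h3] with x hx using hθ0 x hx.le
    simp only [h2, hθ0 _ h1]
    ring
  · intro s hs
    have : 1 ≤ s / δ := (one_le_div hδ).2 hs
    exact if_neg (by linarith)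
  · exact fun s ↦ hp _
  · exact fun s ↦ by positivity
  · intro s
    rcases eq_or_ne (s / δ) 1 with h | h
    · simp only [h, hθ1 1 (by norm_num)]
      norm_num
    · have h1 : 0 < (1 - s / δ) ^ 2 := by
        have : 1 - s / δ ≠ 0 := sub_ne_zero.2 h.symm
        positivity
      exact add_pos_of_nonneg_of_pos (hp _) (mul_pos hδ h1)
  · intro s
    have h1 : HasDerivAt (fun s ↦ G (s / δ)) (deriv G (s / δ) * (1 / δ)) s :=
      HasDerivAt.comp (h₂ := G) s (hGs.differentiable (by simp) (s / δ)).hasDerivAt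
        ((hasDerivAt_id s).div_const δ)
    rw [h1.deriv, one_mul, ← hGd]
    field_simp

end Profile

section Weight

variable {G : Type*} [NormedAddCommGroup G] [NormedSpace ℝ G]
  {η : G → G →L[ℝ] G →L[ℝ] ℝ} {V : Set G} {α : G → G →L[ℝ] ℝ} {c δ : ℝ} {ℓ : G →L[ℝ] ℝ}
  {g p r : ℝ → ℝ}

/-- The weight `p / (r + p h)` of the deformation, where `h = ℓ(X)` and `X` is dual to `α`. -/
def weight (η : G → G →L[ℝ] G →L[ℝ] ℝ) (α : G → G →L[ℝ] ℝ) (ℓ : G →L[ℝ] ℝ) (p r : ℝ → ℝ) (z : G) :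
    ℝ :=
  p (ℓ z) / (r (ℓ z) + p (ℓ z) * ℓ ((η z).inverse (α z)))

lemma IsProfile.denom_pos (hgpr : IsProfile c δ g p r) (s : ℝ) {h : ℝ} (hh : 0 < h) :
    0 < r s + p s * h := by
  have h1 := hgpr.p_add_r_pos s
  rcases eq_or_lt_of_le (hgpr.p_nonneg s) with h2 | h2
  · rw [← h2] at h1 ⊢
    linarith
  · have := hgpr.r_nonneg s
    positivity

/-- The Poisson structure on a collar: it is the inverse of `η` for `ℓ ≤ 0` and vanishes for
`ℓ ≥ δ`. -/
theorem FlatSymplectic.flatPoisson_weight [FiniteDimensional ℝ G] (h : FlatSymplectic η V)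
    (hV : IsOpen V) (hα : ContDiffOn ℝ ∞ α V) (hdα : ∀ z ∈ V, ∀ v w, d1 α z v w = c * η z v w)
    (hpos : ∀ z ∈ V, 0 < ℓ ((η z).inverse (α z))) (hgpr : IsProfile c δ g p r) :
    FlatPoisson (deformed η α ℓ g (weight η α ℓ p r)) V := by
  set H : G → ℝ := fun z ↦ ℓ ((η z).inverse (α z)) with hH
  have hHs : ContDiffOn ℝ ∞ H V :=
    ℓ.contDiff.comp_contDiffOn (h.contDiffOn_inverse.clm_apply hα)
  have hden : ∀ z ∈ V, r (ℓ z) + p (ℓ z) * H z ≠ 0 := fun z hz ↦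
    (hgpr.denom_pos _ (hpos z hz)).ne'
  have hps : ContDiffOn ℝ ∞ (fun z ↦ p (ℓ z)) V := (hgpr.smooth_p.comp ℓ.contDiff).contDiffOn
  have hrs : ContDiffOn ℝ ∞ (fun z ↦ r (ℓ z)) V := (hgpr.smooth_r.comp ℓ.contDiff).contDiffOn
  refine h.flatPoisson_deformed hV hα hdα hgpr.smooth_g
    (hps.div (hrs.add (hps.mul hHs)) hden) (fun z hz ↦ ?_) (fun z hz ↦ ?_)
  · have e1 : HasFDerivAt (fun z ↦ p (ℓ z)) _ z :=
      ((hgpr.smooth_p.differentiable (by simp)) (ℓ z)).hasDerivAt.comp_hasFDerivAt z ℓ.hasFDerivAt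
    have e2 : HasFDerivAt (fun z ↦ r (ℓ z)) _ z :=
      ((hgpr.smooth_r.differentiable (by simp)) (ℓ z)).hasDerivAt.comp_hasFDerivAt z ℓ.hasFDerivAt
    have e3 : HasFDerivAt H (fderiv ℝ H z) z :=
      ((hHs.contDiffAt (hV.mem_nhds hz)).differentiableAt (by simp)).hasFDerivAt
    have e4 : HasFDerivAt (weight η α ℓ p r) _ z :=
      e1.mul ((hasDerivAt_inv (hden z hz)).comp_hasFDerivAt z (e2.add (e1.mul e3)))
    refine ⟨(deriv p (ℓ z) * r (ℓ z) - p (ℓ z) * deriv r (ℓ z))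
      / (r (ℓ z) + p (ℓ z) * H z) ^ 2, fun u ↦ ?_⟩
    have h0 := hden z hz
    rw [e4.fderiv, weight]
    have hHx : ∀ x, ℓ ((η x).inverse (α x)) = H x := fun _ ↦ rfl
    simp only [smul_apply, add_apply, smul_eq_mul, hHx]
    change _ = _ - _ * fderiv ℝ H z u
    field_simp
    ring
  · have h0 := hden z hz
    have h1 := hgpr.deriv_g (ℓ z)
    rw [weight]
    change deriv g (ℓ z) * (1 - p (ℓ z) / (r (ℓ z) + p (ℓ z) * H z) * H z)
      = -(c * (p (ℓ z) / (r (ℓ z) + p (ℓ z) * H z)) * g (ℓ z))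
    field_simp
    linear_combination h1

lemma deformed_of_nonpos (hgpr : IsProfile c δ g p r) {z : G} (hz : ℓ z ≤ 0) :
    deformed η α ℓ g (weight η α ℓ p r) z = (ContinuousLinearMap.apply ℝ ℝ).comp (η z).inverse := by
  simp [deformed, weight, hgpr.g_of_nonpos _ hz, hgpr.p_of_nonpos _ hz]

lemma deformed_of_le (hgpr : IsProfile c δ g p r) {w : G → ℝ} {z : G} (hz : δ ≤ ℓ z) :
    deformed η α ℓ g w z = 0 := by
  simp [deformed, hgpr.g_of_le _ hz]

/-- Compatibility of the deformed bivector with linear isomorphisms. -/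
lemma deformed_weight_comp {η' : G → G →L[ℝ] G →L[ℝ] ℝ} {α' : G → G →L[ℝ] ℝ} {z z' : G}
    {L : G →L[ℝ] G} (hL : Function.Surjective L) (hη : η z = pullForm L (η' z'))
    (hα : α z = (α' z').comp L) (hℓ : ℓ.comp L = ℓ) (hz : ℓ z' = ℓ z)
    (hinv : (η z).IsInvertible) (hinv' : (η' z').IsInvertible) (a b : G →L[ℝ] ℝ) :
    deformed η α ℓ g (weight η α ℓ p r) z (a.comp L) (b.comp L)
      = deformed η' α' ℓ g (weight η' α' ℓ p r) z' a b := by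
  have key : ∀ a : G →L[ℝ] ℝ, L ((η z).inverse (a.comp L)) = (η' z').inverse a := by
    intro a
    have h1 : η z ((η z).inverse (a.comp L)) = a.comp L := hinv.self_apply_inverse _
    have h2 : η' z' (L ((η z).inverse (a.comp L))) = a := by
      ext v
      obtain ⟨u, rfl⟩ := hL v
      have h3 := congrArg (fun f ↦ f u) h1
      rw [hη] at h3
      rw [hη]
      exact h3
    rw [← h2, hinv'.inverse_apply_self, h2]
  have key' : ∀ X, ℓ (L X) = ℓ X := fun X ↦ congrArg (fun f ↦ f X) hℓ
  have h1 : ℓ ((η z).inverse (α z)) = ℓ ((η' z').inverse (α' z')) := by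
    rw [hα, ← key' ((η z).inverse _), key]
  have h2 : L ((η z).inverse ℓ) = (η' z').inverse ℓ := by
    conv_lhs => rw [← hℓ]
    rw [key]
  rw [deformed_apply, deformed_apply, weight, weight, hz, h1, hα]
  simp only [ContinuousLinearMap.comp_apply, key, h2]

end Weight

/-! ### Closedness and the Lie derivative in local coordinates -/

lemma mdifferentiableAt_section_vectorSpace {G : Type*} [NormedAddCommGroup G] [NormedSpace ℝ G]
    {V : Π z : G, TangentSpace 𝓘(ℝ, G) z} {z : G} (hV : DifferentiableAt ℝ (fun z ↦ (V z : G)) z) :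
    MDifferentiableAt 𝓘(ℝ, G) (𝓘(ℝ, G)).tangent
      (fun y ↦ (⟨y, V y⟩ : TangentBundle 𝓘(ℝ, G) G)) z := by
  rw [mdifferentiableAt_section]
  simpa using! hV.mdifferentiableAt

lemma mlieBracket_eq_lieBracket {G : Type*} [NormedAddCommGroup G] [NormedSpace ℝ G]
    (V W : Π z : G, TangentSpace 𝓘(ℝ, G) z) (z : G) :
    mlieBracket 𝓘(ℝ, G) V W z = lieBracket ℝ (fun z ↦ (V z : G)) (fun z ↦ (W z : G)) z := by
  rw [← mlieBracketWithin_univ, mlieBracketWithin_eq_lieBracketWithin]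
  exact congrFun lieBracketWithin_univ z

lemma fderiv_apply_swap_of_alternating {G : Type*} [NormedAddCommGroup G] [NormedSpace ℝ G]
    {η : G → G →L[ℝ] G →L[ℝ] ℝ} {z : G} (hη : DifferentiableAt ℝ η z)
    (h : ∀ z v, η z v v = 0) (u v w : G) : fderiv ℝ η z u v w = - fderiv ℝ η z u w v := by
  refine apply_swap_of_alternating (fun w ↦ ?_) v w
  have h1 : HasFDerivAt (fun z ↦ η z w w) _ z :=
    (hη.hasFDerivAt.clm_apply (hasFDerivAt_const w _)).clm_apply (hasFDerivAt_const w _)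
  have h2 : HasFDerivAt (fun z ↦ η z w w) (0 : G →L[ℝ] ℝ) z := by
    simp only [h]
    exact hasFDerivAt_const (0 : ℝ) _
  have h3 := congrArg (fun L ↦ L u) (h1.unique h2)
  simpa using h3

section Intrinsic

variable {E : Type*} [NormedAddCommGroup E] [NormedSpace ℝ E] [FiniteDimensional ℝ E]
  {H : Type*} [TopologicalSpace H] {I : ModelWithCorners ℝ E H}
  {M : Type*} [TopologicalSpace M] [ChartedSpace H M] [IsManifold I ∞ M]
  {G : Type*} [NormedAddCommGroup G] [NormedSpace ℝ G] [FiniteDimensional ℝ G]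
  {e : OpenPartialHomeomorph M G}

/-- The Lie bracket of two vector fields in local coordinates. -/
lemma IsCoord.mlieBracket_eq (he : IsCoord I e) {x : M} (hx : x ∈ e.source)
    {X Y : Π y : M, TangentSpace I y} {V W : G → G} (hV : DifferentiableAt ℝ V (e x))
    (hW : DifferentiableAt ℝ W (e x)) (hXV : ∀ᶠ y in 𝓝 x, X y = dCinv I e y (V (e y)))
    (hYW : ∀ᶠ y in 𝓝 x, Y y = dCinv I e y (W (e y))) :
    mlieBracket I X Y x
      = dCinv I e x (fderiv ℝ W (e x) (V (e x)) - fderiv ℝ V (e x) (W (e x))) := by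
  have : CompleteSpace E := FiniteDimensional.complete ℝ E
  have : CompleteSpace G := FiniteDimensional.complete ℝ G
  have h2 : IsManifold I (minSmoothness ℝ 2) M := by
    rw [minSmoothness_of_isRCLikeNormedField]
    exact IsManifold.of_le (n := ∞) (WithTop.coe_le_coe.2 le_top)
  have h1 : mlieBracket I X Y x
      = mlieBracket I (mpullback I 𝓘(ℝ, G) e V) (mpullback I 𝓘(ℝ, G) e W) x :=
    Filter.EventuallyEq.mlieBracket_vectorField_eq hXV hYW
  have hV' : MDifferentiableAt 𝓘(ℝ, G) (𝓘(ℝ, G)).tangent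
      (fun y ↦ (⟨y, V y⟩ : TangentBundle 𝓘(ℝ, G) G)) (e x) :=
    mdifferentiableAt_section_vectorSpace hV
  have hW' : MDifferentiableAt 𝓘(ℝ, G) (𝓘(ℝ, G)).tangent
      (fun y ↦ (⟨y, W y⟩ : TangentBundle 𝓘(ℝ, G) G)) (e x) :=
    mdifferentiableAt_section_vectorSpace hW
  rw [h1, ← mpullback_mlieBracket (n := ∞) hV' hW'
    (he.smooth.contMDiffAt (e.open_source.mem_nhds hx))
    (by rw [minSmoothness_of_isRCLikeNormedField]; exact WithTop.coe_le_coe.2 le_top),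
    mpullback_apply]
  exact congrArg (mfderiv I 𝓘(ℝ, G) e x).inverse (mlieBracket_eq_lieBracket V W (e x))

omit [FiniteDimensional ℝ E] [IsManifold I ∞ M] [FiniteDimensional ℝ G] in
/-- The derivative of `S(Y, Z)` in local coordinates. -/
lemma IsCoord.mvfderiv_form_eq (he : IsCoord I e) {x : M} (hx : x ∈ e.source)
    {S : Π y : M, TangentSpace I y →L[ℝ] TangentSpace I y →L[ℝ] ℝ}
    (hS : ContDiffOn ℝ ∞ (loc2 I e S) e.target)
    {Y Z : Π y : M, TangentSpace I y} {v w : G} (hY : ∀ᶠ y in 𝓝 x, Y y = dCinv I e y v)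
    (hZ : ∀ᶠ y in 𝓝 x, Z y = dCinv I e y w) (u : TangentSpace I x) :
    mvfderiv I (fun y ↦ S y (Y y) (Z y)) x u
      = fderiv ℝ (loc2 I e S) (e x) (dC I e x u) v w := by
  have hloc : (fun y ↦ S y (Y y) (Z y)) =ᶠ[𝓝 x] fun y ↦ loc2 I e S (e y) v w := by
    filter_upwards [hY, hZ, e.open_source.mem_nhds hx] with y hy hz hy'
    rw [hy, hz, loc2, pullForm_apply, e.left_inv hy']
  have hd : ContDiffOn ℝ ∞ (fun z ↦ loc2 I e S z v w) e.target :=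
    (hS.clm_apply contDiffOn_const).clm_apply contDiffOn_const
  have hm : ContMDiffOn I 𝓘(ℝ, ℝ) ∞ (fun y ↦ loc2 I e S (e y) v w) e.source :=
    hd.contMDiffOn.comp he.smooth e.mapsTo
  have hm' : MDifferentiableAt I 𝓘(ℝ, ℝ) (fun y ↦ S y (Y y) (Z y)) x :=
    ((hm.contMDiffAt (e.open_source.mem_nhds hx)).mdifferentiableAt (by simp)).congr_of_eventuallyEq
      hloc
  rw [he.mvfderiv_eq hx hm']
  have h1 : (fun z ↦ S (e.symm z) (Y (e.symm z)) (Z (e.symm z))) =ᶠ[𝓝 (e x)]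
      fun z ↦ loc2 I e S z v w := by
    have h2 := (e.symm.continuousAt (e.map_source hx))
    rw [ContinuousAt, e.left_inv hx] at h2
    filter_upwards [h2.eventually hloc, e.open_target.mem_nhds (e.map_source hx)] with z hz hz'
    rw [hz, e.right_inv hz']
  rw [h1.fderiv_eq]
  have h3 := (hS.contDiffAt (e.open_target.mem_nhds (e.map_source hx))).differentiableAt (by simp)
  have h4 : HasFDerivAt (fun z ↦ loc2 I e S z v w) _ (e x) :=
    (h3.hasFDerivAt.clm_apply (hasFDerivAt_const v _)).clm_apply (hasFDerivAt_const w _)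
  rw [h4.fderiv]
  simp

omit [FiniteDimensional ℝ G] in
/-- Every coordinate vector field extends, from a neighbourhood of a given point, to a smooth
vector field on the manifold. -/
lemma IsCoord.exists_smoothFieldOn_univ [T2Space M] (he : IsCoord I e) {x : M} (hx : x ∈ e.source)
    (v : G) : ∃ Y : Π y : M, TangentSpace I y, SmoothFieldOn I Y univ ∧
      ∀ᶠ y in 𝓝 x, Y y = dCinv I e y v := by
  obtain ⟨ρ, -, hρ⟩ := (SmoothBumpFunction.nhds_basis_tsupport (I := I) x).mem_iff.1
    (e.open_source.mem_nhds hx)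
  refine ⟨(ρ : M → ℝ) • fun y ↦ dCinv I e y v, contMDiffOn_univ.2 ?_, ?_⟩
  · exact ContMDiffOn.smul_section_of_tsupport ρ.contMDiff.contMDiffOn e.open_source hρ
      (he.contMDiffOn_dCinv (V := fun _ ↦ v) contDiffOn_const)
  · filter_upwards [ρ.eventuallyEq_one] with y hy
    rw [Pi.smul_apply', hy]
    simp

/-- A symplectic form is closed in local coordinates. -/
lemma IsCoord.d2_loc2_eq_zero [T2Space M] (he : IsCoord I e) (Ω : SymplecticForm I M) {x : M}
    (hx : x ∈ e.source) (u v w : G) : d2 (loc2 I e Ω.form) (e x) u v w = 0 := by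
  -- evaluate `dΩ` on fields with constant coordinates near `x`, whose brackets vanish
  obtain ⟨U, hU, hUu⟩ := he.exists_smoothFieldOn_univ hx u
  obtain ⟨V, hV, hVv⟩ := he.exists_smoothFieldOn_univ hx v
  obtain ⟨W, hW, hWw⟩ := he.exists_smoothFieldOn_univ hx w
  have hS : ContDiffOn ℝ ∞ (loc2 I e Ω.form) e.target := he.contDiffOn_loc2 Ω.smooth.contMDiffOn
  have h0 : ∀ {X Y : Π y : M, TangentSpace I y} {v w : G}, (∀ᶠ y in 𝓝 x, X y = dCinv I e y v) →
      (∀ᶠ y in 𝓝 x, Y y = dCinv I e y w) → mlieBracket I X Y x = 0 := by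
    intro X Y v w hX hY
    rw [he.mlieBracket_eq hx (V := fun _ ↦ v) (W := fun _ ↦ w) (differentiableAt_const v)
      (differentiableAt_const w) hX hY]
    simp
  have h1 := Ω.closed U V W hU hV hW x
  rw [extDerivForm, he.mvfderiv_form_eq hx hS hVv hWw, he.mvfderiv_form_eq hx hS hUu hWw,
    he.mvfderiv_form_eq hx hS hUu hVv, h0 hUu hVv, h0 hUu hWw, h0 hVv hWw, hUu.self_of_nhds,
    hVv.self_of_nhds, hWw.self_of_nhds, he.dC_dCinv hx, he.dC_dCinv hx, he.dC_dCinv hx] at h1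
  simp only [map_zero, zero_apply, sub_zero, add_zero] at h1
  have h2 := fderiv_apply_swap_of_alternating
    ((hS.contDiffAt (e.open_target.mem_nhds (e.map_source hx))).differentiableAt (by simp))
    (fun z v ↦ Ω.alternating _ _) v w u
  rw [d2]
  linarith

omit [FiniteDimensional ℝ E] [FiniteDimensional ℝ G] in
lemma IsCoord.differentiableAt_locV (he : IsCoord I e) {x : M} (hx : x ∈ e.source) {U : Set M}
    (hU : IsOpen U) {X : Π y : M, TangentSpace I y} (hX : SmoothFieldOn I X U) (hxU : x ∈ U) :
    DifferentiableAt ℝ (locV I e X) (e x) := by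
  have h1 := (he.restrOpen hU).contDiffOn_locV (X := X) (hX.mono fun y hy ↦ hy.2)
  have h2 : e x ∈ (e.restrOpen U hU).target := (e.restrOpen U hU).map_source ⟨hx, hxU⟩
  have h3 := (h1.contDiffAt ((e.restrOpen U hU).open_target.mem_nhds h2)).differentiableAt
    (by simp)
  refine h3.congr_of_eventuallyEq ?_
  filter_upwards [(e.restrOpen U hU).open_target.mem_nhds h2] with z hz
  have h4 : e.symm z ∈ (e.restrOpen U hU).source := (e.restrOpen U hU).map_target hz
  have h5 : mfderiv I 𝓘(ℝ, G) (e.restrOpen U hU) (e.symm z) = mfderiv I 𝓘(ℝ, G) e (e.symm z) := by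
    rfl
  exact congrArg (fun L ↦ L (X (e.symm z))) h5

/-- Cartan's formula `L_X Ω = d(i_X Ω)` for a closed form, in local coordinates. -/
lemma IsCoord.d1_loc2_locV_eq [T2Space M] (he : IsCoord I e) (Ω : SymplecticForm I M) {U : Set M}
    (hU : IsOpen U) {X : Π y : M, TangentSpace I y} (hX : SmoothFieldOn I X U) {c : ℝ}
    (hL : ∀ Y Z : Π x : M, TangentSpace I x, SmoothFieldOn I Y univ → SmoothFieldOn I Z univ →
        ∀ x ∈ U, lieDerivForm I Ω.form X Y Z x = c * Ω.form x (Y x) (Z x))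
    {x : M} (hx : x ∈ e.source) (hxU : x ∈ U) (v w : G) :
    d1 (fun z ↦ loc2 I e Ω.form z (locV I e X z)) (e x) v w = c * loc2 I e Ω.form (e x) v w := by
  obtain ⟨V, hV, hVv⟩ := he.exists_smoothFieldOn_univ hx v
  obtain ⟨W, hW, hWw⟩ := he.exists_smoothFieldOn_univ hx w
  have hS : ContDiffOn ℝ ∞ (loc2 I e Ω.form) e.target := he.contDiffOn_loc2 Ω.smooth.contMDiffOn
  have hS' := ((hS.contDiffAt (e.open_target.mem_nhds (e.map_source hx))).differentiableAt
    (by simp)).hasFDerivAt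
  have hXd := he.differentiableAt_locV hx hU hX hxU
  have hXe : ∀ᶠ y in 𝓝 x, X y = dCinv I e y (locV I e X (e y)) := by
    filter_upwards [e.open_source.mem_nhds hx] with y hy
    rw [locV, e.left_inv hy, he.dCinv_dC hy]
  have h1 := hL V W hV hW x hxU
  have h0 : ∀ a b, loc2 I e Ω.form (e x) a b = Ω.form x (dCinv I e x a) (dCinv I e x b) := by
    intro a b
    rw [loc2, pullForm_apply, e.left_inv hx]
  rw [lieDerivForm, he.mvfderiv_form_eq hx hS hVv hWw,
    he.mlieBracket_eq hx hXd (differentiableAt_const v) hXe hVv,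
    he.mlieBracket_eq hx hXd (differentiableAt_const w) hXe hWw, hVv.self_of_nhds,
    hWw.self_of_nhds, ← h0, ← h0, ← h0] at h1
  have h3 : HasFDerivAt (fun z ↦ loc2 I e Ω.form z (locV I e X z)) _ (e x) :=
    hS'.clm_apply hXd.hasFDerivAt
  have hcl := he.d2_loc2_eq_zero Ω hx (dC I e x (X x)) v w
  have halt : ∀ a b, loc2 I e Ω.form (e x) a b = - loc2 I e Ω.form (e x) b a :=
    apply_swap_of_alternating fun a ↦ Ω.alternating _ _
  have hXx : locV I e X (e x) = dC I e x (X x) := by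
    rw [locV, e.left_inv hx]
  rw [d1, h3.fderiv]
  simp only [add_apply, ContinuousLinearMap.comp_apply, ContinuousLinearMap.flip_apply,
    fderiv_fun_const, Pi.zero_apply, zero_apply, zero_sub, map_neg, neg_apply] at h1 ⊢
  rw [hXx]
  rw [d2] at hcl
  have e1 := fderiv_apply_swap_of_alternating hS'.differentiableAt
    (fun z v ↦ Ω.alternating _ _) v w (dC I e x (X x))
  have e2 := halt v (fderiv ℝ (locV I e X) (e x) w)
  linarith

end Intrinsic

/-! ### Embeddings of codimension zero -/

section InteriorChart

variable {E : Type*} [NormedAddCommGroup E] [NormedSpace ℝ E]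
  {H : Type*} [TopologicalSpace H] (I : ModelWithCorners ℝ E H)
  {M : Type*} [TopologicalSpace M] [ChartedSpace H M]

/-- The chart at a point, restricted to the interior of the manifold. -/
def interiorChartAt (x : M) : OpenPartialHomeomorph M E where
  toFun := extChartAt I x
  invFun := (extChartAt I x).symm
  source := (extChartAt I x).source ∩ extChartAt I x ⁻¹' interior (range I)
  target := (extChartAt I x).target ∩ interior (range I)
  map_source' p hp := ⟨(extChartAt I x).map_source hp.1, hp.2⟩
  map_target' z hz := ⟨(extChartAt I x).map_target hz.1, by
    rw [mem_preimage, (extChartAt I x).right_inv hz.1]; exact hz.2⟩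
  left_inv' p hp := (extChartAt I x).left_inv hp.1
  right_inv' z hz := (extChartAt I x).right_inv hz.1
  open_source := (continuousOn_extChartAt x).isOpen_inter_preimage (isOpen_extChartAt_source x)
    isOpen_interior
  open_target := by
    have h : (extChartAt I x).target ∩ interior (range I)
        = I.symm ⁻¹' (chartAt H x).target ∩ interior (range I) := by
      rw [extChartAt_target, inter_assoc, inter_eq_right.2 interior_subset]
    rw [h]
    exact ((chartAt H x).open_target.preimage I.continuous_symm).inter isOpen_interior
  continuousOn_toFun := (continuousOn_extChartAt x).mono inter_subset_left
  continuousOn_invFun := (continuousOn_extChartAt_symm x).mono inter_subset_left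

lemma isCoord_interiorChartAt [IsManifold I ∞ M] (x : M) : IsCoord I (interiorChartAt I x) := by
  refine ⟨contMDiffOn_extChartAt.mono fun p hp ↦ ?_,
    (contMDiffOn_extChartAt_symm x).mono inter_subset_left⟩
  rw [← extChartAt_source I]
  exact hp.1

variable {I} in
lemma mem_interiorChartAt_source {x : M} (hx : I.IsInteriorPoint x) :
    x ∈ (interiorChartAt I x).source :=
  ⟨mem_extChartAt_source x, hx⟩

end InteriorChart

section Embedding

variable {E : Type*} [NormedAddCommGroup E] [NormedSpace ℝ E] [FiniteDimensional ℝ E]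
  {H : Type*} [TopologicalSpace H] {I : ModelWithCorners ℝ E H}
  {M : Type*} [TopologicalSpace M] [ChartedSpace H M]
  {E' : Type*} [NormedAddCommGroup E'] [NormedSpace ℝ E'] [FiniteDimensional ℝ E']
  {H' : Type*} [TopologicalSpace H'] {J : ModelWithCorners ℝ E' H'}
  {N : Type*} [TopologicalSpace N] [ChartedSpace H' N]
  {G : Type*} [NormedAddCommGroup G] [NormedSpace ℝ G]

section Compare

variable {ε : OpenPartialHomeomorph M G} {e : OpenPartialHomeomorph N G} {f : M → N}

omit [FiniteDimensional ℝ E] [FiniteDimensional ℝ E'] in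
lemma IsCoord.dC_comp_mfderiv (he : IsCoord J e) {p : M} {a : M → G}
    (hfd : MDifferentiableAt I J f p) (hp : f p ∈ e.source)
    (h : ∀ᶠ q in 𝓝 p, e (f q) = a q) (v : TangentSpace I p) :
    dC J e (f p) (mfderiv I J f p v) = mfderiv I 𝓘(ℝ, G) a p v := by
  have h1 := mfderiv_comp (I' := J) p (he.mdifferentiable.mdifferentiableAt hp) hfd
  have h2 : mfderiv I 𝓘(ℝ, G) (e ∘ f) p = mfderiv I 𝓘(ℝ, G) a p :=
    Filter.EventuallyEq.mfderiv_eq h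
  have h3 := congrArg (fun L ↦ L v) h1
  have h4 := congrArg (fun L ↦ L v) h2
  exact h3.symm.trans h4

omit [FiniteDimensional ℝ E] [FiniteDimensional ℝ E'] in
/-- Two fields of bilinear forms which correspond under a local diffeomorphism have the same
coordinate expression in corresponding coordinates. -/
lemma IsCoord.loc2_eq_of_comp (hε : IsCoord I ε) (he : IsCoord J e)
    (h : ∀ q ∈ ε.source, f q ∈ e.source ∧ e (f q) = ε q)
    (hfd : ∀ q ∈ ε.source, MDifferentiableAt I J f q)
    {S : Π y : M, TangentSpace I y →L[ℝ] TangentSpace I y →L[ℝ] ℝ}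
    {S' : Π y : N, TangentSpace J y →L[ℝ] TangentSpace J y →L[ℝ] ℝ}
    (hS : ∀ q v w, S' (f q) (mfderiv I J f q v) (mfderiv I J f q w) = S q v w) {z : G}
    (hz : z ∈ ε.target) : loc2 J e S' z = loc2 I ε S z := by
  have hq := ε.map_target hz
  set q := ε.symm z with hqz
  have h1 : e.symm z = f q := by
    rw [← e.left_inv (h q hq).1, (h q hq).2, hqz, ε.right_inv hz]
  have h2 : ∀ g : G, dCinv J e (f q) g = mfderiv I J f q (dCinv I ε q g) := by
    intro g
    have h3 := he.dC_comp_mfderiv (a := ε) (hfd q hq) (h q hq).1 (by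
      filter_upwards [ε.open_source.mem_nhds hq] with y hy using (h y hy).2) (dCinv I ε q g)
    have h4 : dC J e (f q) (mfderiv I J f q (dCinv I ε q g)) = g :=
      h3.trans (hε.dC_dCinv hq g)
    rw [← he.dCinv_dC (h q hq).1 (mfderiv I J f q (dCinv I ε q g)), h4]
  ext v w
  simp only [loc2, pullForm_apply]
  rw [h1, h2, h2, hS]

omit [FiniteDimensional ℝ E] [FiniteDimensional ℝ E'] in
lemma IsCoord.locV_eq_of_comp (he : IsCoord J e)
    (h : ∀ q ∈ ε.source, f q ∈ e.source ∧ e (f q) = ε q)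
    (hfd : ∀ q ∈ ε.source, MDifferentiableAt I J f q)
    {X : Π y : M, TangentSpace I y} {X' : Π y : N, TangentSpace J y} {z : G}
    (hz : z ∈ ε.target) (hX : X' (f (ε.symm z)) = mfderiv I J f (ε.symm z) (X (ε.symm z))) :
    locV J e X' z = locV I ε X z := by
  have hq := ε.map_target hz
  set q := ε.symm z with hqz
  have h1 : e.symm z = f q := by
    rw [← e.left_inv (h q hq).1, (h q hq).2, hqz, ε.right_inv hz]
  rw [locV, h1, hX]
  exact he.dC_comp_mfderiv (hfd q hq) (h q hq).1 (by
      filter_upwards [ε.open_source.mem_nhds hq] with y hy using (h y hy).2) _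

end Compare

variable [J.Boundaryless] [IsManifold I ∞ M] [IsManifold J ∞ N]
  {ℓ : E →L[ℝ] ℝ} {e₀ : E} {f : M → N}

/-- Near an interior point, an embedding of codimension zero is a local diffeomorphism: it is the
identity in suitable coordinates. -/
lemma exists_isCoord_comp_eq (h₀ : ℓ e₀ = 1)
    (hI : range I = {x | 0 ≤ ℓ x}) (hdim : Module.finrank ℝ E = Module.finrank ℝ E')
    (hf : IsSmoothEmbedding I J ∞ f) {p : M} (hp : I.IsInteriorPoint p) :
    ∃ (ε : OpenPartialHomeomorph M E) (e : OpenPartialHomeomorph N E), IsCoord I ε ∧ IsCoord J e ∧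
      p ∈ ε.source ∧ ∀ q ∈ ε.source, f q ∈ e.source ∧ e (f q) = ε q := by
  obtain ⟨e, he, hpe, hef, -⟩ := exists_isCoord_extending_extChartAt h₀ hI hdim hf p
  have hO := e.open_source.preimage hf.isEmbedding.continuous
  refine ⟨(interiorChartAt I p).restrOpen _ hO, e, (isCoord_interiorChartAt I p).restrOpen hO, he,
    ⟨mem_interiorChartAt_source hp, hpe⟩, fun q hq ↦ ⟨hq.2, ?_⟩⟩
  exact (hef q hq.2).2

lemma apply_mem_interior_range (h₀ : ℓ e₀ = 1)
    (hI : range I = {x | 0 ≤ ℓ x}) (hdim : Module.finrank ℝ E = Module.finrank ℝ E')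
    (hf : IsSmoothEmbedding I J ∞ f) {p : M} (hp : I.IsInteriorPoint p) {s : Set M}
    (hs : s ∈ 𝓝 p) : f '' s ∈ 𝓝 (f p) := by
  obtain ⟨ε, e, hε, he, hpε, h⟩ := exists_isCoord_comp_eq h₀ hI hdim hf hp
  have h1 := e.continuousAt (h p hpε).1
  rw [ContinuousAt, (h p hpε).2] at h1
  have h2 := (ε.symm.continuousAt (ε.map_source hpε))
  rw [ContinuousAt, ε.left_inv hpε] at h2
  filter_upwards [h1.eventually (ε.open_target.mem_nhds (ε.map_source hpε)),
    (h2.comp h1).eventually hs, e.open_source.mem_nhds (h p hpε).1] with y hy hys hye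
  refine ⟨_, hys, e.injOn (h _ (ε.map_target hy)).1 hye ?_⟩
  rw [(h _ (ε.map_target hy)).2, ε.right_inv hy]

/-- An extension of a symplectic form on `M` to `N` is closed at the interior points of `M`. -/
theorem IsCoord.d2_loc2_eq_zero_of_extends [T2Space M] {e : OpenPartialHomeomorph N G}
    [FiniteDimensional ℝ G] (he : IsCoord J e) (h₀ : ℓ e₀ = 1)
    (hI : range I = {x | 0 ≤ ℓ x}) (hdim : Module.finrank ℝ E = Module.finrank ℝ E')
    (hf : IsSmoothEmbedding I J ∞ f) (Ω : SymplecticForm I M)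
    {S : Π y : N, TangentSpace J y →L[ℝ] TangentSpace J y →L[ℝ] ℝ} (halt : ∀ y v, S y v v = 0)
    (hS : ∀ q v w, S (f q) (mfderiv I J f q v) (mfderiv I J f q w) = Ω.form q v w)
    {p : M} (hp : I.IsInteriorPoint p) (hpe : f p ∈ e.source) (u v w : G) :
    d2 (loc2 J e S) (e (f p)) u v w = 0 := by
  obtain ⟨ε, e', hε, he', hpε, h⟩ := exists_isCoord_comp_eq h₀ hI hdim hf hp
  have hfd : ∀ q ∈ ε.source, MDifferentiableAt I J f q := fun q _ ↦
    hf.contMDiff.mdifferentiableAt (by simp)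
  have hev : loc2 J e' S =ᶠ[𝓝 (ε p)] loc2 I ε Ω.form := by
    filter_upwards [ε.open_target.mem_nhds (ε.map_source hpε)] with z hz
    exact hε.loc2_eq_of_comp he' h hfd hS hz
  have hsm := ((hε.contDiffOn_loc2 Ω.smooth.contMDiffOn).contDiffAt
    (ε.open_target.mem_nhds (ε.map_source hpε))).differentiableAt (by simp)
  have hsymm : e.symm (e (f p)) = f p := e.left_inv hpe
  obtain ⟨u', v', w', h1⟩ := he.d2_loc2_change he' (S := S) (e.map_source hpe)
    (by rw [hsymm]; exact (h p hpε).1)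
    (by rw [hsymm, (h p hpε).2]; exact hsm.congr_of_eventuallyEq hev) halt u v w
  rw [h1, hsymm, (h p hpε).2, d2_congr hev, hε.d2_loc2_eq_zero Ω hpε]

/-- At the interior points of `M`, the equation `L_X Ω = c Ω` carries over to extensions of `Ω` and
`X` to `N`. -/
theorem IsCoord.d1_loc2_locV_eq_of_extends [T2Space M] {e : OpenPartialHomeomorph N G}
    [FiniteDimensional ℝ G] (he : IsCoord J e) (h₀ : ℓ e₀ = 1)
    (hI : range I = {x | 0 ≤ ℓ x}) (hdim : Module.finrank ℝ E = Module.finrank ℝ E')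
    (hf : IsSmoothEmbedding I J ∞ f) (Ω : SymplecticForm I M)
    {S : Π y : N, TangentSpace J y →L[ℝ] TangentSpace J y →L[ℝ] ℝ}
    (hS : ∀ q v w, S (f q) (mfderiv I J f q v) (mfderiv I J f q w) = Ω.form q v w)
    {U : Set M} (hU : IsOpen U) {X : Π y : M, TangentSpace I y} (hX : SmoothFieldOn I X U) {c : ℝ}
    (hL : ∀ Y Z : Π x : M, TangentSpace I x, SmoothFieldOn I Y univ → SmoothFieldOn I Z univ →
        ∀ x ∈ U, lieDerivForm I Ω.form X Y Z x = c * Ω.form x (Y x) (Z x))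
    {X' : Π y : N, TangentSpace J y}
    {p : M} (hp : I.IsInteriorPoint p) (hpU : p ∈ U)
    (hX' : ∀ᶠ q in 𝓝 p, X' (f q) = mfderiv I J f q (X q)) (hpe : f p ∈ e.source) (v w : G) :
    d1 (fun z ↦ loc2 J e S z (locV J e X' z)) (e (f p)) v w = c * loc2 J e S (e (f p)) v w := by
  obtain ⟨ε, e', hε, he', hpε, h⟩ := exists_isCoord_comp_eq h₀ hI hdim hf hp
  have hfd : ∀ q ∈ ε.source, MDifferentiableAt I J f q := fun q _ ↦
    hf.contMDiff.mdifferentiableAt (by simp)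
  have hev : loc2 J e' S =ᶠ[𝓝 (ε p)] loc2 I ε Ω.form := by
    filter_upwards [ε.open_target.mem_nhds (ε.map_source hpε)] with z hz
    exact hε.loc2_eq_of_comp he' h hfd hS hz
  have hcont := ε.symm.continuousAt (ε.map_source hpε)
  rw [ContinuousAt, ε.left_inv hpε] at hcont
  have hevX : locV J e' X' =ᶠ[𝓝 (ε p)] locV I ε X := by
    filter_upwards [ε.open_target.mem_nhds (ε.map_source hpε), hcont.eventually hX'] with z hz hz'
    exact he'.locV_eq_of_comp h hfd hz hz'
  have hsm := ((hε.contDiffOn_loc2 Ω.smooth.contMDiffOn).contDiffAt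
    (ε.open_target.mem_nhds (ε.map_source hpε))).differentiableAt (by simp)
  have hsmX := hε.differentiableAt_locV hpε hU hX hpU
  have hsymm : e.symm (e (f p)) = f p := e.left_inv hpe
  refine he.d1_loc2_change he' (e.map_source hpe)
    (by rw [hsymm]; exact (h p hpε).1)
    (by rw [hsymm, (h p hpε).2]; exact hsm.congr_of_eventuallyEq hev)
    (by rw [hsymm, (h p hpε).2]; exact hsmX.congr_of_eventuallyEq hevX) (fun v w ↦ ?_) v w
  rw [hsymm, (h p hpε).2, hev.self_of_nhds, ← hε.d1_loc2_locV_eq Ω hU hX hL hpε hpU]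
  refine d1_congr ?_ v w
  filter_upwards [hev, hevX] with z hz hz'
  rw [hz, hz']

end Embedding

/-! ### Extension of tensor fields from a domain with boundary -/

section Extension

variable {E : Type*} [NormedAddCommGroup E] [NormedSpace ℝ E] [FiniteDimensional ℝ E]
  {H : Type*} [TopologicalSpace H] {I : ModelWithCorners ℝ E H}
  {M : Type*} [TopologicalSpace M] [ChartedSpace H M]
  {E' : Type*} [NormedAddCommGroup E'] [NormedSpace ℝ E'] [FiniteDimensional ℝ E']
  {H' : Type*} [TopologicalSpace H'] {J : ModelWithCorners ℝ E' H'}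
  {N : Type*} [TopologicalSpace N] [ChartedSpace H' N]
  [J.Boundaryless] [IsManifold I ∞ M] [IsManifold J ∞ N]
  {ℓ : E →L[ℝ] ℝ} {e₀ : E} {f : M → N}

/-- A smooth field of bilinear forms on `M` extends to `N`, locally. -/
lemma exists_extension_form_local (h₀ : ℓ e₀ = 1)
    (hI : range I = {x | 0 ≤ ℓ x}) (hdim : Module.finrank ℝ E = Module.finrank ℝ E')
    (hf : IsSmoothEmbedding I J ∞ f) (Ω : SymplecticForm I M) (x : M) :
    ∃ O ∈ 𝓝 (f x), ∃ S : Π y : N, TangentSpace J y →L[ℝ] TangentSpace J y →L[ℝ] ℝ,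
      ContMDiffOn J (J.prod 𝓘(ℝ, E' →L[ℝ] E' →L[ℝ] ℝ)) ∞
        (fun y ↦ TotalSpace.mk' (E' →L[ℝ] E' →L[ℝ] ℝ)
        (E := fun y : N ↦ TangentSpace J y →L[ℝ] TangentSpace J y →L[ℝ] ℝ) y (S y)) O ∧
      ∀ y ∈ O, (∀ v, S y v v = 0) ∧ ∀ q, f q = y → ∀ v w,
        S y (mfderiv I J f q v) (mfderiv I J f q w) = Ω.form q v w := by
  obtain ⟨e, he, hxe, hef, -⟩ := exists_isCoord_extending_extChartAt h₀ hI hdim hf x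
  set φ := extChartAt I x with hφ
  set P : E → E →L[ℝ] E →L[ℝ] ℝ := fun z ↦
    pullForm (mfderivWithin 𝓘(ℝ, E) I φ.symm φ.target z) (Ω.form (φ.symm z)) with hP
  have hPs : ContDiffOn ℝ ∞ P φ.target :=
    contDiffOn_pullForm_mfderivWithin (uniqueDiffOn_extChartAt_target x)
      (contMDiffOn_extChartAt_symm x) (mapsTo_univ _ _) Ω.smooth.contMDiffOn
  obtain ⟨V, hV, hxV, hVs⟩ := mem_nhdsWithin.1 (extChartAt_target_mem_nhdsWithin (I := I) x)
  have : CompleteSpace E := FiniteDimensional.complete ℝ E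
  obtain ⟨g, hg, hgP⟩ := exists_contDiff_eventually_eq_on_halfSpace h₀ hV hxV
    (hPs.mono (hI ▸ hVs))
  set Q : E → E →L[ℝ] E →L[ℝ] ℝ := fun z ↦ (1 / 2 : ℝ) • (g z - (g z).flip) with hQ
  have hQs : ContDiff ℝ ∞ Q := by
    have h1 : ContDiff ℝ ∞ fun z ↦ (g z).flip :=
      (ContinuousLinearMap.flipₗᵢ ℝ E E ℝ).contDiff.comp hg
    exact (hg.sub h1).const_smul _
  have hxe' : e (f x) = φ x := (hef x hxe).2
  have hev : ∀ᶠ y in 𝓝 (f x), 0 ≤ ℓ (e y) → g (e y) = P (e y) := by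
    have h1 := e.continuousAt hxe
    rw [ContinuousAt, hxe'] at h1
    exact h1.eventually hgP
  refine ⟨_, Filter.inter_mem (e.open_source.mem_nhds hxe) hev,
    fun y ↦ pullForm (dC J e y) (Q (e y)), fun y hy ↦ ?_, fun y hy ↦ ⟨fun v ↦ ?_, ?_⟩⟩
  · exact (he.contMDiffAt_pullForm_dC hQs.contDiffOn hy.1).contMDiffWithinAt
  · simp [hQ]
  · rintro q rfl v w
    obtain ⟨hq, hqe⟩ := hef q hy.1
    have hpos : 0 ≤ ℓ (e (f q)) := by
      have : φ q ∈ range I := extChartAt_target_subset_range x (φ.map_source hq)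
      rw [hI] at this
      rwa [hqe]
    have hfd : MDifferentiableAt I J f q := hf.contMDiff.mdifferentiableAt (by simp)
    have h1 : ∀ᶠ p in 𝓝 q, e (f p) = φ p := by
      filter_upwards [(e.open_source.preimage hf.isEmbedding.continuous).mem_nhds hy.1] with p hp
      exact (hef p hp).2
    have h2 : ∀ v : TangentSpace I q, mfderivWithin 𝓘(ℝ, E) I φ.symm φ.target (φ q)
        (dC J e (f q) (mfderiv I J f q v)) = v := by
      intro v
      rw [he.dC_comp_mfderiv hfd hy.1 h1]
      have h3 := MDifferentiableWithinAt.mfderivWithin_mono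
        (mdifferentiableWithinAt_extChartAt_symm (φ.map_source hq))
        (uniqueDiffOn_extChartAt_target x _ (φ.map_source hq)).uniqueMDiffWithinAt
        (extChartAt_target_subset_range x)
      rw [h3]
      exact congrArg (fun L ↦ L v) (mfderivWithin_extChartAt_symm_comp_mfderiv_extChartAt' hq)
    have h4 : φ.symm (φ q) = q := φ.left_inv hq
    have h5 : ∀ v w, P (φ q) (dC J e (f q) (mfderiv I J f q v))
        (dC J e (f q) (mfderiv I J f q w)) = Ω.form q v w := by
      intro v w
      exact (congrArg₂ (fun a b ↦ Ω.form (φ.symm (φ q)) a b) (h2 v) (h2 w)).trans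
        (congrArg (fun p ↦ (Ω.form p : E →L[ℝ] E →L[ℝ] ℝ) v w) h4)
    have h6 := hy.2 hpos
    simp only [pullForm_apply, hQ]
    rw [h6, hqe]
    simp only [smul_apply, sub_apply, ContinuousLinearMap.flip_apply, smul_eq_mul]
    rw [h5, h5, apply_swap_of_alternating (Ω.alternating q) w v]
    ring

/-- A symplectic form on `M` extends to a smooth 2-form on `N`. -/
theorem exists_extension_form [SigmaCompactSpace N] [T2Space N] (h₀ : ℓ e₀ = 1)
    (hI : range I = {x | 0 ≤ ℓ x}) (hdim : Module.finrank ℝ E = Module.finrank ℝ E')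
    (hf : IsSmoothEmbedding I J ∞ f) (hfc : IsClosed (range f)) (Ω : SymplecticForm I M) :
    ∃ S : Π y : N, TangentSpace J y →L[ℝ] TangentSpace J y →L[ℝ] ℝ,
      ContMDiff J (J.prod 𝓘(ℝ, E' →L[ℝ] E' →L[ℝ] ℝ)) ∞
        (fun y ↦ TotalSpace.mk' (E' →L[ℝ] E' →L[ℝ] ℝ)
        (E := fun y : N ↦ TangentSpace J y →L[ℝ] TangentSpace J y →L[ℝ] ℝ) y (S y)) ∧
      (∀ y v, S y v v = 0) ∧ ∀ q v w,
        S (f q) (mfderiv I J f q v) (mfderiv I J f q w) = Ω.form q v w := by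
  set t : ∀ y : N, Set (TangentSpace J y →L[ℝ] TangentSpace J y →L[ℝ] ℝ) :=
    fun y ↦ {S | (∀ v, S v v = 0) ∧ ∀ q, f q = y → ∀ v w,
        S (mfderiv I J f q v) (mfderiv I J f q w) = Ω.form q v w} with ht
  have hconv : ∀ y, Convex ℝ (t y) := by
    refine fun y S hS S' hS' a b _ _ hab ↦ ⟨fun v ↦ ?_, fun q hq v w ↦ ?_⟩
    · have h1 := hS.1 v
      have h2 := hS'.1 v
      simp only [add_apply, smul_apply, h1, h2, smul_zero, add_zero]
    · have h1 := hS.2 q hq v w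
      have h2 := hS'.2 q hq v w
      subst hq
      simp only [add_apply, smul_apply, h1, h2, smul_eq_mul]
      rw [← add_mul, hab, one_mul]
  obtain ⟨s, hs⟩ := exists_contMDiffSection_forall_mem_convex_of_local (I := J) (n := ⊤)
    (F_fiber := E' →L[ℝ] E' →L[ℝ] ℝ)
    (fun y : N ↦ TangentSpace J y →L[ℝ] TangentSpace J y →L[ℝ] ℝ) t hconv fun y ↦ by
      by_cases hy : y ∈ range f
      · obtain ⟨x, rfl⟩ := hy
        exact exists_extension_form_local h₀ hI hdim hf Ω x
      · refine ⟨_, hfc.isOpen_compl.mem_nhds hy, 0, ?_, fun y hy ↦ ⟨fun v ↦ rfl, ?_⟩⟩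
        · exact (contMDiff_zeroSection ℝ
            (fun y : N ↦ TangentSpace J y →L[ℝ] TangentSpace J y →L[ℝ] ℝ)).contMDiffOn
        · rintro q rfl
          exact absurd (mem_range_self q) hy
  exact ⟨s, s.contMDiff, fun y ↦ (hs y).1, fun q ↦ (hs (f q)).2 q rfl⟩

/-- A vector field on an open subset of `M` extends to `N`, locally. -/
lemma exists_extension_field_local (h₀ : ℓ e₀ = 1)
    (hI : range I = {x | 0 ≤ ℓ x}) (hdim : Module.finrank ℝ E = Module.finrank ℝ E')
    (hf : IsSmoothEmbedding I J ∞ f) {U : Set M} (hU : IsOpen U)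
    {X : Π y : M, TangentSpace I y} (hX : SmoothFieldOn I X U) {x : M} (hx : x ∈ U) :
    ∃ O ∈ 𝓝 (f x), ∃ X' : Π y : N, TangentSpace J y, SmoothFieldOn J X' O ∧
      ∀ y ∈ O, ∀ q, f q = y → X' y = mfderiv I J f q (X q) := by
  obtain ⟨e, he, hxe, hef, -⟩ := exists_isCoord_extending_extChartAt h₀ hI hdim hf x
  set φ := extChartAt I x with hφ
  set P : E → E := fun z ↦ mfderiv I 𝓘(ℝ, E) φ (φ.symm z) (X (φ.symm z)) with hP
  have hcoord : ContMDiffOn I 𝓘(ℝ, E) ∞ (fun q ↦ (mfderiv I 𝓘(ℝ, E) φ q (X q) : E))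
      (φ.source ∩ U) := by
    have ho : IsOpen φ.source := isOpen_extChartAt_source x
    have h1 : ContMDiffOn I 𝓘(ℝ, E) ∞ φ φ.source := by
      rw [hφ, extChartAt_source]
      exact contMDiffOn_extChartAt
    have h2 := h1.contMDiffOn_tangentMapWithin (m := ∞) (by simp) ho.uniqueMDiffOn
    have h3 := h2.comp (hX.mono inter_subset_right) (fun q (hq : q ∈ φ.source ∩ U) ↦ hq.1)
    have h4 := (contMDiff_snd_tangentBundle_modelSpace (n := ∞) E 𝓘(ℝ, E)).comp_contMDiffOn h3
    refine h4.congr fun q hq ↦ ?_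
    have h5 : mfderiv I 𝓘(ℝ, E) φ q = mfderivWithin I 𝓘(ℝ, E) φ φ.source q :=
      (mfderivWithin_of_isOpen ho hq.1).symm
    exact congrArg (fun L ↦ L (X q)) h5
  have hPs : ContDiffOn ℝ ∞ P (φ.target ∩ φ.symm ⁻¹' U) := by
    have h1 : ContMDiffOn 𝓘(ℝ, E) I ∞ φ.symm (φ.target ∩ φ.symm ⁻¹' U) :=
      (contMDiffOn_extChartAt_symm x).mono inter_subset_left
    exact (hcoord.comp h1 fun z hz ↦ ⟨φ.map_target hz.1, hz.2⟩).contDiffOn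
  have hmem : φ.target ∩ φ.symm ⁻¹' U ∈ 𝓝[range I] (φ x) := by
    refine Filter.inter_mem (extChartAt_target_mem_nhdsWithin x) (nhdsWithin_le_nhds ?_)
    refine (continuousAt_extChartAt_symm x).preimage_mem_nhds ?_
    rw [extChartAt_to_inv]
    exact hU.mem_nhds hx
  obtain ⟨V, hV, hxV, hVs⟩ := mem_nhdsWithin.1 hmem
  have : CompleteSpace E := FiniteDimensional.complete ℝ E
  obtain ⟨g, hg, hgP⟩ := exists_contDiff_eventually_eq_on_halfSpace h₀ hV hxV
    (hPs.mono (hI ▸ hVs))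
  have hxe' : e (f x) = φ x := (hef x hxe).2
  have hev : ∀ᶠ y in 𝓝 (f x), 0 ≤ ℓ (e y) → g (e y) = P (e y) := by
    have h1 := e.continuousAt hxe
    rw [ContinuousAt, hxe'] at h1
    exact h1.eventually hgP
  refine ⟨_, Filter.inter_mem (e.open_source.mem_nhds hxe) hev,
    fun y ↦ dCinv J e y (g (e y)), ?_, ?_⟩
  · exact (he.contMDiffOn_dCinv hg.contDiffOn).mono inter_subset_left
  · rintro y hy q rfl
    obtain ⟨hq, hqe⟩ := hef q hy.1
    have hpos : 0 ≤ ℓ (e (f q)) := by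
      have : φ q ∈ range I := extChartAt_target_subset_range x (φ.map_source hq)
      rw [hI] at this
      rwa [hqe]
    have hfd : MDifferentiableAt I J f q := hf.contMDiff.mdifferentiableAt (by simp)
    have h1 : ∀ᶠ p in 𝓝 q, e (f p) = φ p := by
      filter_upwards [(e.open_source.preimage hf.isEmbedding.continuous).mem_nhds hy.1] with p hp
      exact (hef p hp).2
    have h4 : φ.symm (φ q) = q := φ.left_inv hq
    have h6 := hy.2 hpos
    have h7 : g (e (f q)) = mfderiv I 𝓘(ℝ, E) φ q (X q) := by
      rw [h6, hqe]
      exact congrArg (fun p ↦ (mfderiv I 𝓘(ℝ, E) φ p (X p) : E)) h4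
    have h8 := he.dC_comp_mfderiv hfd hy.1 h1 (X q)
    change dCinv J e (f q) (g (e (f q))) = _
    rw [h7, ← he.dCinv_dC hy.1 (mfderiv I J f q (X q))]
    exact congrArg (dCinv J e (f q)) h8.symm

/-- A vector field on a neighbourhood `U` of a closed subset `K` of `M` extends from `K` to a smooth
vector field on `N`. -/
theorem exists_extension_field [SigmaCompactSpace N] [T2Space N] (h₀ : ℓ e₀ = 1)
    (hI : range I = {x | 0 ≤ ℓ x}) (hdim : Module.finrank ℝ E = Module.finrank ℝ E')
    (hf : IsSmoothEmbedding I J ∞ f) {U : Set M} (hU : IsOpen U)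
    {X : Π y : M, TangentSpace I y} (hX : SmoothFieldOn I X U) {K : Set M} (hKU : K ⊆ U)
    (hK : IsClosed (f '' K)) :
    ∃ X' : Π y : N, TangentSpace J y, SmoothFieldOn J X' univ ∧
      ∀ q ∈ K, X' (f q) = mfderiv I J f q (X q) := by
  set t : ∀ y : N, Set (TangentSpace J y) :=
    fun y ↦ {v | ∀ q ∈ K, f q = y → v = mfderiv I J f q (X q)} with ht
  have hconv : ∀ y, Convex ℝ (t y) := by
    intro y v hv w hw a b _ _ hab q hqK hq
    subst hq
    rw [hv q hqK rfl, hw q hqK rfl, ← add_smul, hab, one_smul]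
  obtain ⟨s, hs⟩ := exists_contMDiffSection_forall_mem_convex_of_local (I := J) (n := ⊤)
    (F_fiber := E') (fun y : N ↦ TangentSpace J y) t hconv fun y ↦ by
      by_cases hy : y ∈ f '' K
      · obtain ⟨x, hx, rfl⟩ := hy
        obtain ⟨O, hO, X', h1, h2⟩ := exists_extension_field_local h₀ hI hdim hf hU hX (hKU hx)
        exact ⟨O, hO, X', h1, fun y hy q _ hq ↦ h2 y hy q hq⟩
      · refine ⟨_, hK.isOpen_compl.mem_nhds hy, 0, ?_, ?_⟩
        · exact (contMDiff_zeroSection ℝ (fun y : N ↦ TangentSpace J y)).contMDiffOn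
        · rintro y hy q hqK rfl
          exact absurd (mem_image_of_mem f hqK) hy
  exact ⟨s, s.contMDiff.contMDiffOn, fun q hq ↦ hs (f q) q hq rfl⟩

end Extension

/-! ### Collar charts -/

section Flat

variable {G : Type*} [NormedAddCommGroup G] [NormedSpace ℝ G] {ℓ : G →L[ℝ] ℝ} {e₀ : G}

/-- Neighbourhoods of a point of the hyperplane `ℓ = 0` contain open neighbourhoods which are
star-shaped towards the hyperplane along `e₀`. -/
lemma exists_isOpen_subset_starShaped {z₀ : G} (hz₀ : ℓ z₀ = 0) (h₀ : ℓ e₀ = 1)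
    {s : Set G} (hs : s ∈ 𝓝 z₀) : ∃ V : Set G, IsOpen V ∧ z₀ ∈ V ∧ V ⊆ s ∧
      ∀ z ∈ V, ∀ τ ∈ Icc (0 : ℝ) 1, hproj ℓ e₀ z + (τ * ℓ z) • e₀ ∈ V := by
  obtain ⟨r, hr, hrs⟩ := Metric.mem_nhds_iff.1 hs
  have hpos : 0 < 1 + ‖e₀‖ := by positivity
  have hP : hproj ℓ e₀ z₀ = z₀ := by simp [hproj_apply, hz₀]
  refine ⟨{z | ‖hproj ℓ e₀ z - z₀‖ < r / (1 + ‖e₀‖) ∧ |ℓ z| < r / (1 + ‖e₀‖)},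
    (isOpen_lt (f := fun z ↦ ‖hproj ℓ e₀ z - z₀‖) (g := fun _ ↦ r / (1 + ‖e₀‖))
      (by fun_prop) continuous_const).inter
      (isOpen_lt (f := fun z ↦ |ℓ z|) (g := fun _ ↦ r / (1 + ‖e₀‖)) (by fun_prop) continuous_const),
    ?_, fun z hz ↦ hrs ?_, fun z hz τ hτ ↦ ?_⟩
  · simp only [mem_ofPred_eq, hP, sub_self, norm_zero, hz₀, abs_zero, and_self]
    positivity
  · rw [mem_ball_iff_norm]
    calc ‖z - z₀‖ = ‖(hproj ℓ e₀ z - z₀) + ℓ z • e₀‖ := by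
          rw [sub_add_eq_add_sub, hproj_add_smul]
      _ ≤ ‖hproj ℓ e₀ z - z₀‖ + |ℓ z| * ‖e₀‖ := by
          refine (norm_add_le _ _).trans_eq ?_
          rw [norm_smul, Real.norm_eq_abs]
      _ < r / (1 + ‖e₀‖) + r / (1 + ‖e₀‖) * ‖e₀‖ :=
          add_lt_add_of_lt_of_le hz.1 (mul_le_mul_of_nonneg_right hz.2.le (norm_nonneg _))
      _ = r := by field_simp
  · refine ⟨?_, ?_⟩
    · rw [hproj_hproj_add h₀]
      exact hz.1
    · have h1 : ℓ (hproj ℓ e₀ z + (τ * ℓ z) • e₀) = τ * ℓ z := by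
        simp [apply_hproj h₀, h₀]
      rw [h1, abs_mul, abs_of_nonneg hτ.1]
      exact (mul_le_of_le_one_left (abs_nonneg _) hτ.2).trans_lt hz.2

/-- If a function has a local maximum on a half space at a boundary point, its derivative is
positive on outward vectors, unless it vanishes. -/
lemma pos_of_isLocalMaxOn_halfSpace {h : G → ℝ} {L : G →L[ℝ] ℝ} {z₀ : G}
    (hL : HasFDerivAt h L z₀) (hL0 : L ≠ 0) (hz₀ : ℓ z₀ = 0)
    (hmax : ∀ᶠ z in 𝓝 z₀, 0 ≤ ℓ z → h z ≤ h z₀) {v : G} (hv : ℓ v < 0) : 0 < L v := by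
  have hneg : ∀ w, 0 ≤ ℓ w → L w ≤ 0 := by
    intro w hw
    have hm : IsLocalMaxOn h {z | 0 ≤ ℓ z} z₀ := by
      rw [IsLocalMaxOn, IsMaxFilter, eventually_nhdsWithin_iff]
      exact hmax
    refine hm.hasFDerivWithinAt_nonpos hL.hasFDerivWithinAt ?_
    refine mem_posTangentConeAt_of_segment_subset ?_
    rintro z ⟨a, b, ha, hb, hab, rfl⟩
    simp only [mem_ofPred_eq, map_add, map_smul, hz₀, smul_eq_mul, mul_zero, zero_add]
    positivity
  by_contra! hcon
  have hLv : L v = 0 := le_antisymm hcon (by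
    have := hneg (-v) (by rw [map_neg]; linarith)
    rw [map_neg] at this
    linarith)
  refine hL0 (ContinuousLinearMap.ext fun w ↦ ?_)
  have hw : ℓ (w - (ℓ w / ℓ v) • v) = 0 := by
    rw [map_sub, map_smul, smul_eq_mul, div_mul_cancel₀ _ hv.ne, sub_self]
  have h1 := hneg _ hw.ge
  have h2 := hneg (-(w - (ℓ w / ℓ v) • v)) (by rw [map_neg, hw, neg_zero])
  rw [map_neg] at h2
  simp only [map_sub, map_smul, hLv, smul_zero, sub_zero] at h1 h2
  exact le_antisymm h1 (neg_nonpos.1 h2)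

lemma exists_contDiff_cutoff [FiniteDimensional ℝ G] {V : Set G} (hV : IsOpen V) {z₀ : G}
    (hz₀ : z₀ ∈ V) : ∃ χ : G → ℝ, ContDiff ℝ ∞ χ ∧ tsupport χ ⊆ V ∧ ∀ᶠ z in 𝓝 z₀, χ z = 1 := by
  obtain ⟨r, hr, hrV⟩ := Metric.isOpen_iff.1 hV z₀ hz₀
  let φ : ContDiffBump z₀ := ⟨r / 4, r / 2, by linarith, by linarith⟩
  refine ⟨φ, φ.contDiff, ?_, φ.eventuallyEq_one⟩
  rw [ContDiffBump.tsupport_eq]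
  exact (Metric.closedBall_subset_ball (half_lt_self hr)).trans hrV

lemma contDiff_smul_of_tsupport_subset {F : Type*} [NormedAddCommGroup F] [NormedSpace ℝ F]
    {V : Set G} (hV : IsOpen V) {χ : G → ℝ} (hχ : ContDiff ℝ ∞ χ) (hχV : tsupport χ ⊆ V) {f : G → F}
    (hf : ContDiffOn ℝ ∞ f V) : ContDiff ℝ ∞ fun z ↦ χ z • f z := by
  rw [contDiff_iff_contDiffAt]
  intro z
  by_cases hz : z ∈ V
  · exact hχ.contDiffAt.smul (hf.contDiffAt (hV.mem_nhds hz))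
  · refine (contDiffAt_const (c := (0 : F))).congr_of_eventuallyEq ?_
    filter_upwards [notMem_tsupport_iff_eventuallyEq.1 fun h ↦ hz (hχV h)] with x hx
    rw [hx, Pi.zero_apply, zero_smul]

end Flat

section CollarChart

variable {E : Type*} [NormedAddCommGroup E] [NormedSpace ℝ E]
  {H : Type*} [TopologicalSpace H] {J : ModelWithCorners ℝ E H}
  {N : Type*} [TopologicalSpace N] [ChartedSpace H N]
  {G : Type*} [NormedAddCommGroup G] [NormedSpace ℝ G]
  {B : Type*}

variable (J) in
/-- A coordinate system near a boundary point of the domain `R ⊆ N`, adapted to the cylindrical end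
`κ`: there is a normal coordinate `ℓ` which is the height on the end and nonpositive on `R`, and in
these coordinates `κ` is linear in the height. The fields `η` and `a` are the coordinate
expressions of the form `S` and of `S(X, ·)`. On `R` these satisfy `dη = 0` and `da = c η`. The
chart is so small that the extension `collarForm ℓ e₀ η` of `η` is symplectic and that the vector
field dual to `collarOneForm ℓ e₀ c η a` is transverse to the levels of `ℓ`. -/
structure IsCollarChart (κ : B × EuclideanHalfSpace 1 → N) (R : Set N)
    (S : Π y : N, TangentSpace J y →L[ℝ] TangentSpace J y →L[ℝ] ℝ)
    (X : Π y : N, TangentSpace J y) (c : ℝ) (ℓ : G →L[ℝ] ℝ) (e₀ : G)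
    (e : OpenPartialHomeomorph N G) (η : G → G →L[ℝ] G →L[ℝ] ℝ) (a : G → G →L[ℝ] ℝ) : Prop where
  isCoord : IsCoord J e
  exists_lift : ∃ ψ : B → G, ∀ b t, κ (b, t) ∈ e.source →
    ℓ (ψ b) = 0 ∧ e (κ (b, t)) = ψ b + t.1 0 • e₀
  mem_range : ∀ y ∈ e.source, 0 < ℓ (e y) → y ∈ range κ
  mem_iff : ∀ y ∈ e.source, y ∈ R ↔ ℓ (e y) ≤ 0
  lower : ∀ b t s, κ (b, t) ∈ e.source → s.1 0 ≤ t.1 0 → κ (b, s) ∈ e.source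
  starShaped : ∀ z ∈ e.target, ∀ τ ∈ Icc (0 : ℝ) 1, hproj ℓ e₀ z + (τ * ℓ z) • e₀ ∈ e.target
  smooth_form : ContDiff ℝ ∞ η
  smooth_one_form : ContDiff ℝ ∞ a
  alternating : ∀ z v, η z v v = 0
  form_eq : ∀ z ∈ e.target, η z = loc2 J e S z
  one_form_eq : ∀ z ∈ e.target, a z = loc2 J e S z (locV J e X z)
  closed : ∀ z ∈ e.target, ℓ z ≤ 0 → ∀ u v w, d2 η z u v w = 0
  primitive : ∀ z ∈ e.target, ℓ z ≤ 0 → ∀ v w, d1 a z v w = c * η z v w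
  isInvertible : ∀ z ∈ e.target, (collarForm ℓ e₀ η z).IsInvertible
  transverse : ∀ z ∈ e.target,
    0 < ℓ ((collarForm ℓ e₀ η z).inverse (collarOneForm ℓ e₀ c η a z))

variable (J) in
/-- The bivector field on the manifold with a given coordinate expression. -/
def pushBivector (e : OpenPartialHomeomorph N G)
    (Q : G → (G →L[ℝ] ℝ) →L[ℝ] (G →L[ℝ] ℝ) →L[ℝ] ℝ) (y : N) :
    (TangentSpace J y →L[ℝ] ℝ) →L[ℝ] (TangentSpace J y →L[ℝ] ℝ) →L[ℝ] ℝ :=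
  pullForm (ContinuousLinearMap.precomp ℝ (dCinv J e y)) (Q (e y))

/-- The bivector field inverse to a field of bilinear forms. -/
def inverseBivector (η : G → G →L[ℝ] G →L[ℝ] ℝ) (z : G) :
    (G →L[ℝ] ℝ) →L[ℝ] (G →L[ℝ] ℝ) →L[ℝ] ℝ :=
  (ContinuousLinearMap.apply ℝ ℝ).comp (η z).inverse

lemma pushBivector_apply (e : OpenPartialHomeomorph N G)
    (Q : G → (G →L[ℝ] ℝ) →L[ℝ] (G →L[ℝ] ℝ) →L[ℝ] ℝ) (y : N) (α β : TangentSpace J y →L[ℝ] ℝ) :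
    pushBivector J e Q y α β = Q (e y) (α.comp (dCinv J e y)) (β.comp (dCinv J e y)) := rfl

/-- The coordinate expression of the inverse of a nondegenerate form. -/
lemma IsCoord.pushBivector_inverseBivector_apply {e : OpenPartialHomeomorph N G}
    (he : IsCoord J e) {S : Π y : N, TangentSpace J y →L[ℝ] TangentSpace J y →L[ℝ] ℝ} {y : N}
    (hy : y ∈ e.source) (hinv : (loc2 J e S (e y)).IsInvertible) {α : TangentSpace J y →L[ℝ] ℝ}
    {v : TangentSpace J y} (hv : ∀ w, α w = S y v w) (β : TangentSpace J y →L[ℝ] ℝ) :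
    pushBivector J e (inverseBivector (loc2 J e S)) y α β = β v := by
  have h1 : loc2 J e S (e y) (dC J e y v) = α.comp (dCinv J e y) := by
    ext w
    simp only [loc2, pullForm_apply, ContinuousLinearMap.comp_apply]
    rw [e.left_inv hy, he.dCinv_dC hy, hv]
  rw [pushBivector_apply, ← h1]
  simp only [inverseBivector, ContinuousLinearMap.comp_apply]
  rw [hinv.inverse_apply_self]
  simp [he.dCinv_dC hy]

namespace IsCollarChart

variable {κ : B × EuclideanHalfSpace 1 → N} {R : Set N}
    {S : Π y : N, TangentSpace J y →L[ℝ] TangentSpace J y →L[ℝ] ℝ}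
    {X : Π y : N, TangentSpace J y} {c δ : ℝ} {ℓ : G →L[ℝ] ℝ} {e₀ : G}
    {e e' : OpenPartialHomeomorph N G} {η η' : G → G →L[ℝ] G →L[ℝ] ℝ} {a a' : G → G →L[ℝ] ℝ}

lemma hproj_mem (h : IsCollarChart J κ R S X c ℓ e₀ e η a) {z : G} (hz : z ∈ e.target) :
    hproj ℓ e₀ z ∈ e.target := by
  simpa using h.starShaped z hz 0 ⟨le_rfl, zero_le_one⟩

lemma flatSymplectic [FiniteDimensional ℝ G] (h₀ : ℓ e₀ = 1)
    (h : IsCollarChart J κ R S X c ℓ e₀ e η a) :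
    FlatSymplectic (collarForm ℓ e₀ η) e.target where
  smooth := (contDiff_collarForm h.smooth_form).contDiffOn
  alternating z _ := collarForm_alternating h.alternating z
  nondegenerate z hz v hv := by
    obtain ⟨A, hA⟩ := h.isInvertible z hz
    have h1 : A v = 0 := by
      ext w
      rw [← ContinuousLinearEquiv.coe_coe, hA, hv]
      rfl
    exact (map_eq_zero_iff A A.injective).1 h1
  closed z hz := d2_collarForm h.smooth_form h.alternating
    (h.closed _ (h.hproj_mem hz) (apply_hproj h₀ z).le)

/-- The Poisson structure on a collar chart which is the inverse of the symplectic form on the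
domain and vanishes above height `δ`. -/
lemma flatPoisson [FiniteDimensional ℝ G] (h₀ : ℓ e₀ = 1)
    (h : IsCollarChart J κ R S X c ℓ e₀ e η a) {g p r : ℝ → ℝ} (hgpr : IsProfile c δ g p r) :
    FlatPoisson (deformed (collarForm ℓ e₀ η) (collarOneForm ℓ e₀ c η a) ℓ g
      (weight (collarForm ℓ e₀ η) (collarOneForm ℓ e₀ c η a) ℓ p r)) e.target :=
  (h.flatSymplectic h₀).flatPoisson_weight e.open_target
    (contDiff_collarOneForm h.smooth_form h.smooth_one_form).contDiffOn
    (fun z hz ↦ d1_collarOneForm h.smooth_form h.smooth_one_form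
      (h.primitive _ (h.hproj_mem hz) (apply_hproj h₀ z).le)) h.transverse hgpr

lemma collarForm_eq_loc2 [FiniteDimensional ℝ G] (h₀ : ℓ e₀ = 1)
    (h : IsCollarChart J κ R S X c ℓ e₀ e η a) {z : G} (hz : z ∈ e.target) (hℓ : ℓ z ≤ 0) :
    collarForm ℓ e₀ η z = loc2 J e S z := by
  rw [← h.form_eq z hz]
  refine collarForm_eq h₀ h.smooth_form h.alternating fun τ hτ ↦ ?_
  refine h.closed _ (h.starShaped z hz τ hτ) ?_
  simp only [map_add, apply_hproj h₀, map_smul, h₀, smul_eq_mul, mul_one, zero_add]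
  exact mul_nonpos_of_nonneg_of_nonpos hτ.1 hℓ

/-- The change of coordinates between two collar charts is a collar map. -/
lemma isCollarMap (h₀ : ℓ e₀ = 1) (h : IsCollarChart J κ R S X c ℓ e₀ e η a)
    (h' : IsCollarChart J κ R S X c ℓ e₀ e' η' a') :
    IsCollarMap ℓ e₀ η η' a a' (fun z ↦ e' (e.symm z))
      {z | z ∈ e.target ∧ 0 < ℓ z ∧ e.symm z ∈ e'.source} := by
  obtain ⟨ψ, hψ⟩ := h.exists_lift
  obtain ⟨ψ', hψ'⟩ := h'.exists_lift
  -- the points above `x`, in both charts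
  have key : ∀ x, x ∈ e.target ∧ 0 < ℓ x ∧ e.symm x ∈ e'.source → ℓ (e' (e.symm x)) = ℓ x ∧
      ∀ σ ∈ Icc 0 (ℓ x), hproj ℓ e₀ x + σ • e₀ ∈ e.target ∧
        e.symm (hproj ℓ e₀ x + σ • e₀) ∈ e'.source ∧
        e' (e.symm (hproj ℓ e₀ x + σ • e₀)) = hproj ℓ e₀ (e' (e.symm x)) + σ • e₀ := by
    rintro x ⟨hx, hx0, hx'⟩
    have hxe := e.right_inv hx
    have hxs := e.map_target hx
    obtain ⟨⟨b, t⟩, hbt⟩ := h.mem_range _ hxs (by rwa [hxe])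
    rw [← hbt] at hxe hxs hx'
    obtain ⟨hb0, hb⟩ := hψ b t hxs
    obtain ⟨hb0', hb'⟩ := hψ' b t hx'
    have hxt : ℓ x = t.1 0 := by
      rw [← hxe, hb]
      simp [hb0, h₀]
    have hPx : hproj ℓ e₀ x = ψ b := by
      rw [hproj_apply, hxt, ← hxe, hb, add_sub_cancel_right]
    have hxt' : ℓ (e' (κ (b, t))) = t.1 0 := by
      rw [hb']
      simp [hb0', h₀]
    have hPx' : hproj ℓ e₀ (e' (κ (b, t))) = ψ' b := by
      rw [hproj_apply, hxt', hb', add_sub_cancel_right]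
    rw [← hbt]
    refine ⟨hxt'.trans hxt.symm, fun σ hσ ↦ ?_⟩
    let s : EuclideanHalfSpace 1 := ⟨EuclideanSpace.single 0 σ, by simpa using hσ.1⟩
    have hs : s.1 0 = σ := by simp [s]
    have hst : s.1 0 ≤ t.1 0 := by rw [hs, ← hxt]; exact hσ.2
    have h1 := h.lower b t s hxs hst
    have h2 := h'.lower b t s hx' hst
    have h3 := (hψ b s h1).2
    have h4 := (hψ' b s h2).2
    rw [hs] at h3 h4
    rw [hPx, hPx', ← h3, e.left_inv h1]
    exact ⟨e.map_source h1, h2, h4⟩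
  refine ⟨?_, fun x hx ↦ hx.2.1, fun x hx σ hσ ↦ ?_, fun x hx σ hσ ↦ ?_, fun x hx ↦ ?_,
    fun x hx σ hσ ↦ ?_, fun x hx σ hσ ↦ ?_⟩
  · have h1 := e.symm.isOpen_inter_preimage e'.open_source
    have h2 := h1.inter (isOpen_lt (f := fun _ : G ↦ (0 : ℝ)) continuous_const ℓ.continuous)
    convert h2 using 1
    ext z
    exact ⟨fun hz ↦ ⟨⟨hz.1, hz.2.2⟩, hz.2.1⟩, fun hz ↦ ⟨hz.1.1, hz.2, hz.1.2⟩⟩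
  · obtain ⟨h1, h2, -⟩ := (key x hx).2 σ hσ
    exact h.isCoord.contDiffAt_change h'.isCoord h1 h2
  · exact ((key x hx).2 σ hσ).2.2
  · exact (key x hx).1
  · obtain ⟨h1, h2, -⟩ := (key x hx).2 σ hσ
    rw [h.form_eq _ h1, h.isCoord.loc2_change h'.isCoord S h1 h2, h'.form_eq _ (e'.map_source h2)]
  · obtain ⟨h1, h2, -⟩ := (key x hx).2 σ hσ
    rw [h.one_form_eq _ h1, h.isCoord.loc2_locV_change h'.isCoord S X h1 h2,
      h'.one_form_eq _ (e'.map_source h2)]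

/-- The Poisson structures of two collar charts agree on the cylindrical end. -/
lemma pushBivector_deformed_eq [FiniteDimensional ℝ G] (h₀ : ℓ e₀ = 1)
    (h : IsCollarChart J κ R S X c ℓ e₀ e η a)
    (h' : IsCollarChart J κ R S X c ℓ e₀ e' η' a') {g p r : ℝ → ℝ} {y : N} (hy : y ∈ e.source)
    (hy' : y ∈ e'.source) (hℓ : 0 < ℓ (e y)) :
    pushBivector J e (deformed (collarForm ℓ e₀ η) (collarOneForm ℓ e₀ c η a) ℓ g
      (weight (collarForm ℓ e₀ η) (collarOneForm ℓ e₀ c η a) ℓ p r)) y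
    = pushBivector J e' (deformed (collarForm ℓ e₀ η') (collarOneForm ℓ e₀ c η' a') ℓ g
      (weight (collarForm ℓ e₀ η') (collarOneForm ℓ e₀ c η' a') ℓ p r)) y := by
  have hz := e.map_source hy
  have hey := e.left_inv hy
  have hmap := h.isCollarMap h₀ h'
  have hU : e y ∈ {z | z ∈ e.target ∧ 0 < ℓ z ∧ e.symm z ∈ e'.source} :=
    ⟨hz, hℓ, by rwa [hey]⟩
  set T : G → G := fun z ↦ e' (e.symm z) with hT
  have hTy : T (e y) = e' y := by rw [hT]; simp only [hey]
  set L := fderiv ℝ T (e y) with hLdef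
  have hL : ∀ v, L v = dC J e' y (dCinv J e y v) := by
    intro v
    have h1 := h.isCoord.fderiv_change h'.isCoord hz (by rwa [hey])
    rw [hLdef, hT, h1, hey]
    rfl
  have hsurj : Function.Surjective L := fun w ↦ ⟨dC J e y (dCinv J e' y w), by
    rw [hL, h.isCoord.dCinv_dC hy, h'.isCoord.dC_dCinv hy']⟩
  have hform := hmap.collarForm_eq_pullForm h'.smooth_form hU
  have hone := hmap.collarOneForm_eq_comp (c := c) h'.smooth_form hU
  have hℓL : ℓ.comp L = ℓ := ContinuousLinearMap.ext fun u ↦ hmap.apply_fderiv hU u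
  have hcomp : ∀ α : TangentSpace J y →L[ℝ] ℝ,
      α.comp (dCinv J e y) = (α.comp (dCinv J e' y)).comp L := by
    intro α
    ext v
    simp only [ContinuousLinearMap.comp_apply]
    rw [hL, h'.isCoord.dCinv_dC hy']
  rw [hTy] at hform hone
  ext α β
  rw [pushBivector_apply, pushBivector_apply, hcomp, hcomp]
  refine deformed_weight_comp hsurj hform hone hℓL ?_ (h.isInvertible _ hz)
    (h'.isInvertible _ (e'.map_source hy')) _ _
  rw [← hTy]
  exact hmap.apply_map _ hU

end IsCollarChart

end CollarChart

section Nondegenerate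

variable {E : Type*} [NormedAddCommGroup E] [NormedSpace ℝ E]
  {H : Type*} [TopologicalSpace H] {I : ModelWithCorners ℝ E H}
  {M : Type*} [TopologicalSpace M] [ChartedSpace H M]
  {E' : Type*} [NormedAddCommGroup E'] [NormedSpace ℝ E']
  {H' : Type*} [TopologicalSpace H'] {J : ModelWithCorners ℝ E' H'}
  {N : Type*} [TopologicalSpace N] [ChartedSpace H' N]
  {G : Type*} [NormedAddCommGroup G] [NormedSpace ℝ G]
  {ℓ : E →L[ℝ] ℝ} {e₀ : E} {f : M → N}

lemma IsCoord.loc2_nondegenerate {e : OpenPartialHomeomorph N G} (he : IsCoord J e)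
    {S : Π y : N, TangentSpace J y →L[ℝ] TangentSpace J y →L[ℝ] ℝ} {z : G} (hz : z ∈ e.target)
    (h : ∀ v, (∀ w, S (e.symm z) v w = 0) → v = 0) {v : G}
    (hv : ∀ w, loc2 J e S z v w = 0) : v = 0 := by
  have hy := e.map_target hz
  have h1 : dCinv J e (e.symm z) v = 0 := h _ fun w ↦ by
    have h2 := hv (dC J e (e.symm z) w)
    rwa [loc2, pullForm_apply, he.dCinv_dC hy] at h2
  rw [← he.dC_dCinv hy v, h1, map_zero]

variable [FiniteDimensional ℝ E] [FiniteDimensional ℝ E'] [J.Boundaryless] [IsManifold I ∞ M]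
  [IsManifold J ∞ N]

lemma surjective_mfderiv_of_isSmoothEmbedding (h₀ : ℓ e₀ = 1)
    (hI : range I = {x | 0 ≤ ℓ x}) (hdim : Module.finrank ℝ E = Module.finrank ℝ E')
    (hf : IsSmoothEmbedding I J ∞ f) (x : M) : Function.Surjective (mfderiv I J f x) := by
  obtain ⟨e, he, hxe, hef, -⟩ := exists_isCoord_extending_extChartAt h₀ hI hdim hf x
  intro u
  obtain ⟨A, hA⟩ := isInvertible_mfderiv_extChartAt (I := I) (mem_extChartAt_source x)
  have h1 : ∀ᶠ p in 𝓝 x, e (f p) = extChartAt I x p := by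
    filter_upwards [(e.open_source.preimage hf.isEmbedding.continuous).mem_nhds hxe] with p hp
    exact (hef p hp).2
  have h2 := he.dC_comp_mfderiv (hf.contMDiff.mdifferentiableAt (by simp)) hxe h1
    (A.symm (dC J e (f x) u))
  refine ⟨A.symm (dC J e (f x) u), ?_⟩
  have h3 : mfderiv I 𝓘(ℝ, E) (extChartAt I x) x (A.symm (dC J e (f x) u)) = dC J e (f x) u := by
    rw [← hA]
    exact A.apply_symm_apply _
  rw [← he.dCinv_dC hxe (mfderiv I J f x _), h2]
  exact (congrArg (dCinv J e (f x)) h3).trans (he.dCinv_dC hxe u)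

lemma nondegenerate_of_extends (h₀ : ℓ e₀ = 1)
    (hI : range I = {x | 0 ≤ ℓ x}) (hdim : Module.finrank ℝ E = Module.finrank ℝ E')
    (hf : IsSmoothEmbedding I J ∞ f) (Ω : SymplecticForm I M)
    {S : Π y : N, TangentSpace J y →L[ℝ] TangentSpace J y →L[ℝ] ℝ}
    (hS : ∀ q v w, S (f q) (mfderiv I J f q v) (mfderiv I J f q w) = Ω.form q v w) (x : M)
    (v : TangentSpace J (f x)) (hv : ∀ w, S (f x) v w = 0) : v = 0 := by
  obtain ⟨u, rfl⟩ := surjective_mfderiv_of_isSmoothEmbedding h₀ hI hdim hf x v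
  rw [Ω.nondegenerate x u fun w ↦ by rw [← hS, hv], map_zero]

/-- A function on `N` which is nonpositive on the image of `M` and vanishes at a boundary point
increases in the outward directions. -/
lemma pos_apply_dC_of_outward (h₀ : ℓ e₀ = 1)
    (hI : range I = {x | 0 ≤ ℓ x}) (hdim : Module.finrank ℝ E = Module.finrank ℝ E')
    (hf : IsSmoothEmbedding I J ∞ f) {e : OpenPartialHomeomorph N G} (he : IsCoord J e) {x : M}
    (hxe : f x ∈ e.source) {ℓ' : G →L[ℝ] ℝ} (hℓ' : ℓ' ≠ 0) (hx0 : ℓ' (e (f x)) = 0)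
    (hneg : ∀ q, f q ∈ e.source → ℓ' (e (f q)) ≤ 0) (hx : ℓ (extChartAt I x x) = 0)
    {v : TangentSpace I x} (hv : ℓ (mfderiv I 𝓘(ℝ, E) (extChartAt I x) x v) < 0) :
    0 < ℓ' (dC J e (f x) (mfderiv I J f x v)) := by
  obtain ⟨e₂, he₂, hxe₂, hef, hrange⟩ := exists_isCoord_extending_extChartAt h₀ hI hdim hf x
  have h1 : ∀ᶠ p in 𝓝 x, e₂ (f p) = extChartAt I x p := by
    filter_upwards [(e₂.open_source.preimage hf.isEmbedding.continuous).mem_nhds hxe₂] with p hp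
    exact (hef p hp).2
  have h2 := he₂.dC_comp_mfderiv (hf.contMDiff.mdifferentiableAt (by simp)) hxe₂ h1 v
  have hz := e₂.map_source hxe₂
  have hsymm : e₂.symm (e₂ (f x)) = f x := e₂.left_inv hxe₂
  have hz' : e₂.symm (e₂ (f x)) ∈ e.source := by rwa [hsymm]
  set L : E →L[ℝ] ℝ := ℓ'.comp ((dC J e (f x)).comp (dCinv J e₂ (f x))) with hLdef
  have hL : HasFDerivAt (fun z ↦ ℓ' (e (e₂.symm z))) L (e₂ (f x)) := by
    have h3 := ((he₂.contDiffAt_change he hz hz').differentiableAt (by simp)).hasFDerivAt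
    rw [he₂.fderiv_change he hz hz', hsymm] at h3
    exact ℓ'.hasFDerivAt.comp _ h3
  have hL0 : L ≠ 0 := by
    intro hL0
    refine hℓ' (ContinuousLinearMap.ext fun g ↦ ?_)
    have h3 := congrArg (fun A ↦ A (dC J e₂ (f x) (dCinv J e (f x) g))) hL0
    simp only [hLdef, ContinuousLinearMap.comp_apply] at h3
    rwa [he₂.dCinv_dC hxe₂, he.dC_dCinv hxe] at h3
  have hmax : ∀ᶠ z in 𝓝 (e₂ (f x)), 0 ≤ ℓ z → ℓ' (e (e₂.symm z)) ≤ ℓ' (e (e₂.symm (e₂ (f x)))) := by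
    filter_upwards [e₂.open_target.mem_nhds hz, eventually_symm_mem hz e.open_source hz']
      with z hz1 hz2 hz3
    obtain ⟨q, hq⟩ := hrange _ (e₂.map_target hz1)
      (by rw [e₂.right_inv hz1, hI]; exact hz3)
    rw [hsymm, hx0, ← hq]
    exact hneg q (by rwa [hq])
  have h4 := pos_of_isLocalMaxOn_halfSpace hL hL0 (by rw [(hef x hxe₂).2]; exact hx) hmax
    (v := dC J e₂ (f x) (mfderiv I J f x v)) (by rw [h2]; exact hv)
  rw [hLdef] at h4
  simp only [ContinuousLinearMap.comp_apply] at h4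
  rwa [he₂.dCinv_dC hxe₂] at h4

end Nondegenerate

section End

variable (n : ℕ)

/-- The height on the model space of the cylindrical end. -/
def height : EuclideanSpace ℝ (Fin n) × EuclideanSpace ℝ (Fin 1) →L[ℝ] ℝ :=
  (EuclideanSpace.proj 0).comp (ContinuousLinearMap.snd ℝ _ _)

/-- The direction of the half line in the model space of the cylindrical end. -/
def normal : EuclideanSpace ℝ (Fin n) × EuclideanSpace ℝ (Fin 1) :=
  (0, EuclideanSpace.single 0 1)

lemma height_apply (z : EuclideanSpace ℝ (Fin n) × EuclideanSpace ℝ (Fin 1)) :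
    height n z = z.2 0 := rfl

lemma height_normal : height n (normal n) = 1 := by
  simp [height_apply, normal]

lemma range_model_cylinder :
    range ((𝓡 n).prod (𝓡∂ 1)) = {z | 0 ≤ height n z} := by
  rw [modelWithCorners_prod_coe, range_prodMap, ModelWithCorners.range_eq_univ,
    range_modelWithCornersEuclideanHalfSpace]
  ext z
  simp [height_apply]

lemma range_model_halfSpace :
    range (𝓡∂ (n + 1)) = {z | 0 ≤ (EuclideanSpace.proj 0 : EuclideanSpace ℝ (Fin (n + 1)) →L[ℝ] ℝ) z} :=
  range_modelWithCornersEuclideanHalfSpace _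

variable {n}

lemma apply_extChartAt_of_mem_boundary {M : Type*} [TopologicalSpace M]
    [ChartedSpace (EuclideanHalfSpace (n + 1)) M] {x : M} (hx : x ∈ (𝓡∂ (n + 1)).boundary M) :
    (extChartAt (𝓡∂ (n + 1)) x x) 0 = 0 := by
  have h1 : extChartAt (𝓡∂ (n + 1)) x x ∈ frontier (range (𝓡∂ (n + 1))) := hx
  rw [frontier_range_modelWithCornersEuclideanHalfSpace] at h1
  exact h1.symm

lemma extChartAt_cylinder {B : Type*} [TopologicalSpace B]
    [ChartedSpace (EuclideanSpace ℝ (Fin n)) B] (b b' : B) (s t : EuclideanHalfSpace 1) :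
    extChartAt ((𝓡 n).prod (𝓡∂ 1)) (b, s) (b', t) = (extChartAt (𝓡 n) b b', t.1) := by
  rw [extChartAt_prod]
  rfl

end End

/-! ### Existence of collar charts -/

section Continuity

variable {F : Type*} [NormedAddCommGroup F] [NormedSpace ℝ F]

lemma continuous_d2 {η : F → F →L[ℝ] F →L[ℝ] ℝ} (hη : ContDiff ℝ ∞ η) (u v w : F) :
    Continuous fun z ↦ d2 η z u v w := by
  have h : ∀ x y t, Continuous fun z ↦ fderiv ℝ η z x y t := fun x y t ↦
    (((hη.continuous_fderiv (by simp)).clm_apply continuous_const).clm_apply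
      continuous_const).clm_apply continuous_const
  simp only [d2]
  exact ((h u v w).add (h v w u)).add (h w u v)

lemma continuous_d1 {a : F → F →L[ℝ] ℝ} (ha : ContDiff ℝ ∞ a) (v w : F) :
    Continuous fun z ↦ d1 a z v w := by
  have h : ∀ x y, Continuous fun z ↦ fderiv ℝ a z x y := fun x y ↦
    ((ha.continuous_fderiv (by simp)).clm_apply continuous_const).clm_apply continuous_const
  simp only [d1]
  exact (h v w).sub (h w v)

end Continuity

section Existence

variable {n : ℕ}
  {M : Type*} [TopologicalSpace M] [ChartedSpace (EuclideanHalfSpace (n + 1)) M]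
  {B : Type*} [TopologicalSpace B] [ChartedSpace (EuclideanSpace ℝ (Fin n)) B]
  {N : Type*} [TopologicalSpace N] [ChartedSpace (EuclideanSpace ℝ (Fin (n + 1))) N]
  [IsManifold (𝓡 n) ∞ B] [IsManifold (𝓡 (n + 1)) ∞ N]
  {ι : B → M} {j : M → N} {κ : B × EuclideanHalfSpace 1 → N}

/-- Coordinates of the glued manifold near a boundary point, in which the cylindrical end is
standard. -/
lemma IsCylindricalExtension.exists_isCoord (hN : IsCylindricalExtension n ι j κ) (b : B) :
    ∃ e : OpenPartialHomeomorph N (EuclideanSpace ℝ (Fin n) × EuclideanSpace ℝ (Fin 1)),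
      IsCoord (𝓡 (n + 1)) e ∧ κ (b, 0) ∈ e.source ∧
      (∀ b' t, κ (b', t) ∈ e.source → b' ∈ (extChartAt (𝓡 n) b).source ∧
        e (κ (b', t)) = (extChartAt (𝓡 n) b b', 0) + t.1 0 • normal n) ∧
      ∀ y ∈ e.source, 0 ≤ height n (e y) → y ∈ range κ := by
  obtain ⟨e, he, hbe, hκ, hr⟩ := exists_isCoord_extending_extChartAt (height_normal n)
    (range_model_cylinder n) (by simp) hN.outer_embedding ((b, 0) : B × EuclideanHalfSpace 1)
  refine ⟨e, he, hbe, fun b' t ht ↦ ?_, fun y hy hy0 ↦ hr y hy ?_⟩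
  · obtain ⟨h1, h2⟩ := hκ (b', t) ht
    rw [extChartAt_prod, PartialEquiv.prod_source] at h1
    refine ⟨h1.1, ?_⟩
    rw [h2, extChartAt_cylinder]
    have h3 : t.1 = t.1 0 • EuclideanSpace.single 0 (1 : ℝ) := by
      ext i
      fin_cases i
      simp
    ext1
    · simp [normal]
    · simpa [normal] using h3
  · rw [range_model_cylinder]
    exact hy0

lemma height_lift (x : EuclideanSpace ℝ (Fin n)) (s : ℝ) :
    height n ((x, 0) + s • normal n) = s := by
  simp [height_apply, normal]

omit [IsManifold (𝓡 n) ∞ B] [IsManifold (𝓡 (n + 1)) ∞ N] in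
/-- In end coordinates, the image of `M` is the set where the height is not positive. -/
lemma IsCylindricalExtension.mem_range_iff (hN : IsCylindricalExtension n ι j κ) {b : B}
    {e : OpenPartialHomeomorph N (EuclideanSpace ℝ (Fin n) × EuclideanSpace ℝ (Fin 1))}
    (hκ : ∀ b' t, κ (b', t) ∈ e.source → b' ∈ (extChartAt (𝓡 n) b).source ∧
        e (κ (b', t)) = (extChartAt (𝓡 n) b b', 0) + t.1 0 • normal n)
    (hr : ∀ y ∈ e.source, 0 ≤ height n (e y) → y ∈ range κ) {y : N} (hy : y ∈ e.source) :
    y ∈ range j ↔ height n (e y) ≤ 0 := by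
  constructor
  · rintro ⟨x, rfl⟩
    by_contra! hcon
    obtain ⟨⟨b', t⟩, hbt⟩ := hr _ hy hcon.le
    have h1 := ((hN.glued x b' t).1 hbt.symm).2
    rw [← hbt, (hκ b' t (by rwa [hbt])).2, height_lift, h1] at hcon
    exact lt_irrefl _ hcon
  · intro hy0
    have h1 : y ∈ range j ∪ range κ := by rw [hN.covers]; exact mem_univ y
    rcases h1 with h1 | ⟨⟨b', t⟩, rfl⟩
    · exact h1
    · rw [(hκ b' t hy).2, height_lift] at hy0
      exact ⟨ι b', (hN.glued _ b' t).2 ⟨rfl, le_antisymm hy0 t.2⟩⟩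

omit [IsManifold (𝓡 n) ∞ B] [IsManifold (𝓡 (n + 1)) ∞ N]
  [ChartedSpace (EuclideanSpace ℝ (Fin (n + 1))) N] in
/-- Arbitrarily small end coordinates which are star-shaped towards the boundary. -/
lemma exists_restrOpen_starShaped {b : B}
    {e : OpenPartialHomeomorph N (EuclideanSpace ℝ (Fin n) × EuclideanSpace ℝ (Fin 1))}
    (hb : κ (b, 0) ∈ e.source)
    (hκ : ∀ b' t, κ (b', t) ∈ e.source → b' ∈ (extChartAt (𝓡 n) b).source ∧
        e (κ (b', t)) = (extChartAt (𝓡 n) b b', 0) + t.1 0 • normal n)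
    (hr : ∀ y ∈ e.source, 0 ≤ height n (e y) → y ∈ range κ)
    {s : Set (EuclideanSpace ℝ (Fin n) × EuclideanSpace ℝ (Fin 1))}
    (hs : s ∈ 𝓝 (e (κ (b, 0)))) :
    ∃ W : Set N, ∃ hW : IsOpen W, κ (b, 0) ∈ (e.restrOpen W hW).source ∧
      (e.restrOpen W hW).target ⊆ s ∧
      (∀ b' t s, κ (b', t) ∈ (e.restrOpen W hW).source → s.1 0 ≤ t.1 0 →
        κ (b', s) ∈ (e.restrOpen W hW).source) ∧
      ∀ z ∈ (e.restrOpen W hW).target, ∀ τ ∈ Icc (0 : ℝ) 1,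
        hproj (height n) (normal n) z + (τ * height n z) • normal n ∈ (e.restrOpen W hW).target := by
  have h0 : height n (e (κ (b, 0))) = 0 := by
    rw [(hκ b 0 hb).2, height_lift]
    rfl
  obtain ⟨V, hV, hbV, hVs, hVstar⟩ := exists_isOpen_subset_starShaped (e₀ := normal n) h0
    (height_normal n) (Filter.inter_mem hs (e.open_target.mem_nhds (e.map_source hb)))
  have hW : IsOpen (e.source ∩ e ⁻¹' V) := e.isOpen_inter_preimage hV
  have htarget : ∀ z, z ∈ (e.restrOpen _ hW).target ↔ z ∈ V := by
    intro z
    constructor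
    · intro hz
      have h1 := (e.restrOpen _ hW).map_target hz
      have h2 : e (e.symm z) = z := (e.restrOpen _ hW).right_inv hz
      rw [← h2]
      exact h1.2.2
    · intro hz
      have h1 := (hVs hz).2
      have h2 : e.symm z ∈ (e.restrOpen _ hW).source :=
        ⟨e.map_target h1, e.map_target h1, by rwa [mem_preimage, e.right_inv h1]⟩
      have h3 : e (e.symm z) ∈ (e.restrOpen _ hW).target := (e.restrOpen _ hW).map_source h2
      rwa [e.right_inv h1] at h3
  refine ⟨_, hW, ⟨hb, hb, hbV⟩, fun z hz ↦ (hVs ((htarget z).1 hz)).1, fun b' t s ht hst ↦ ?_,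
    fun z hz τ hτ ↦ (htarget _).2 (hVstar z ((htarget z).1 hz) τ hτ)⟩
  obtain ⟨hb', hbt⟩ := hκ b' t ht.1
  set p := ((extChartAt (𝓡 n) b b', 0) : EuclideanSpace ℝ (Fin n) × EuclideanSpace ℝ (Fin 1))
    + s.1 0 • normal n with hp
  have hpV : p ∈ V := by
    have hz : e (κ (b', t)) ∈ V := ht.2.2
    have h1 : height n (e (κ (b', t))) = t.1 0 := by rw [hbt, height_lift]
    have h2 : hproj (height n) (normal n) (e (κ (b', t))) = (extChartAt (𝓡 n) b b', 0) := by
      rw [hproj_apply, h1, hbt, add_sub_cancel_right]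
    rcases eq_or_lt_of_le t.2 with h3 | h3
    · have h4 := hVstar _ hz 0 ⟨le_rfl, zero_le_one⟩
      have h5 : s.1 0 = 0 := le_antisymm (hst.trans_eq h3.symm) s.2
      rw [h2, zero_mul] at h4
      rwa [hp, h5]
    · have h4 := hVstar _ hz (s.1 0 / t.1 0) ⟨div_nonneg s.2 t.2, (div_le_one h3).2 hst⟩
      rwa [h2, h1, div_mul_cancel₀ _ h3.ne'] at h4
  have hpt := (hVs hpV).2
  have hps := e.map_target hpt
  obtain ⟨⟨b'', s'⟩, hbs⟩ := hr _ hps (by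
    rw [e.right_inv hpt, hp, height_lift]
    exact s.2)
  rw [← hbs] at hps
  obtain ⟨hb'', h1⟩ := hκ b'' s' hps
  have h2 : (extChartAt (𝓡 n) b b'', 0) + s'.1 0 • normal n = p := by
    rw [← h1, hbs, e.right_inv hpt]
  have h3 : s'.1 0 = s.1 0 := by
    have h4 := congrArg (height n) h2
    rwa [hp, height_lift, height_lift] at h4
  have h5 : s' = s := by
    ext i
    fin_cases i
    exact h3
  have h6 : b'' = b' := by
    rw [hp, h3] at h2
    exact (extChartAt (𝓡 n) b).injOn hb'' hb' (congrArg Prod.fst (add_right_cancel h2))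
  rw [h5, h6] at hbs hps
  refine ⟨hps, hps, ?_⟩
  rw [mem_preimage, hbs, e.right_inv hpt]
  exact hpV

variable [IsManifold (𝓡∂ (n + 1)) ∞ M] [T2Space M]

set_option maxHeartbeats 1000000 in
/-- Every boundary point has a collar chart. -/
theorem IsCylindricalExtension.exists_isCollarChart (hN : IsCylindricalExtension n ι j κ)
    (Ω : SymplecticForm (𝓡∂ (n + 1)) M) {c : ℝ}
    {S : Π y : N, TangentSpace (𝓡 (n + 1)) y →L[ℝ] TangentSpace (𝓡 (n + 1)) y →L[ℝ] ℝ}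
    (hSs : ContMDiff (𝓡 (n + 1)) ((𝓡 (n + 1)).prod
        𝓘(ℝ, EuclideanSpace ℝ (Fin (n + 1)) →L[ℝ] EuclideanSpace ℝ (Fin (n + 1)) →L[ℝ] ℝ)) ∞
        (fun y ↦ TotalSpace.mk'
          (EuclideanSpace ℝ (Fin (n + 1)) →L[ℝ] EuclideanSpace ℝ (Fin (n + 1)) →L[ℝ] ℝ)
          (E := fun y : N ↦ TangentSpace (𝓡 (n + 1)) y →L[ℝ] TangentSpace (𝓡 (n + 1)) y →L[ℝ] ℝ)
          y (S y)))
    (halt : ∀ y v, S y v v = 0)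
    (hS : ∀ q v w, S (j q) (mfderiv (𝓡∂ (n + 1)) (𝓡 (n + 1)) j q v)
      (mfderiv (𝓡∂ (n + 1)) (𝓡 (n + 1)) j q w) = Ω.form q v w)
    {U : Set M} (hU : IsOpen U) {X : Π x : M, TangentSpace (𝓡∂ (n + 1)) x}
    (hX : SmoothFieldOn (𝓡∂ (n + 1)) X U)
    (hout : ∀ x ∈ (𝓡∂ (n + 1)).boundary M, PointsOutward x (X x))
    (hL : ∀ Y Z : Π x : M, TangentSpace (𝓡∂ (n + 1)) x, SmoothFieldOn (𝓡∂ (n + 1)) Y univ →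
      SmoothFieldOn (𝓡∂ (n + 1)) Z univ → ∀ x ∈ U,
        lieDerivForm (𝓡∂ (n + 1)) Ω.form X Y Z x = c * Ω.form x (Y x) (Z x))
    {u : Set M} (hu : IsOpen u) (hbu : (𝓡∂ (n + 1)).boundary M ⊆ u) (huU : u ⊆ U)
    {X' : Π y : N, TangentSpace (𝓡 (n + 1)) y} (hX's : SmoothFieldOn (𝓡 (n + 1)) X' univ)
    (hX' : ∀ q ∈ u, X' (j q) = mfderiv (𝓡∂ (n + 1)) (𝓡 (n + 1)) j q (X q)) (b : B) :
    ∃ (e : OpenPartialHomeomorph N (EuclideanSpace ℝ (Fin n) × EuclideanSpace ℝ (Fin 1)))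
      (η : EuclideanSpace ℝ (Fin n) × EuclideanSpace ℝ (Fin 1) →
        EuclideanSpace ℝ (Fin n) × EuclideanSpace ℝ (Fin 1) →L[ℝ]
        EuclideanSpace ℝ (Fin n) × EuclideanSpace ℝ (Fin 1) →L[ℝ] ℝ)
      (a : EuclideanSpace ℝ (Fin n) × EuclideanSpace ℝ (Fin 1) →
        EuclideanSpace ℝ (Fin n) × EuclideanSpace ℝ (Fin 1) →L[ℝ] ℝ),
      IsCollarChart (𝓡 (n + 1)) κ (range j) S X' c (height n) (normal n) e η a ∧
        κ (b, 0) ∈ e.source := by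
  obtain ⟨e₁, he₁, hb, hκ, hr⟩ := hN.exists_isCoord b
  have hrange := fun {y} (hy : y ∈ e₁.source) ↦ hN.mem_range_iff hκ hr hy
  have hh : range (𝓡∂ (n + 1)) = _ := range_model_halfSpace n
  have hp0 : (EuclideanSpace.proj 0 : EuclideanSpace ℝ (Fin (n + 1)) →L[ℝ] ℝ)
      (EuclideanSpace.single 0 1) = 1 := by simp
  have hjx : j (ι b) = κ (b, 0) := (hN.glued _ b 0).2 ⟨rfl, rfl⟩
  have hbd : ∀ b, ι b ∈ (𝓡∂ (n + 1)).boundary M := fun b ↦ hN.range_boundary ▸ mem_range_self b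
  set z₀ := e₁ (κ (b, 0)) with hz₀
  have hz₀t : z₀ ∈ e₁.target := e₁.map_source hb
  have hsymm : e₁.symm z₀ = κ (b, 0) := e₁.left_inv hb
  have h0 : height n z₀ = 0 := by
    rw [hz₀, (hκ b 0 hb).2, height_lift]
    rfl
  -- the coordinate expressions, cut off outside a neighbourhood of `z₀`
  obtain ⟨χ, hχ, hχt, hχ1⟩ := exists_contDiff_cutoff e₁.open_target hz₀t
  have hSl : ContDiffOn ℝ ∞ (loc2 (𝓡 (n + 1)) e₁ S) e₁.target :=
    he₁.contDiffOn_loc2 hSs.contMDiffOn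
  have hXl : ContDiffOn ℝ ∞ (locV (𝓡 (n + 1)) e₁ X') e₁.target :=
    he₁.contDiffOn_locV (hX's.mono (subset_univ _))
  set η := fun z ↦ χ z • loc2 (𝓡 (n + 1)) e₁ S z with hη
  set a := fun z ↦ χ z • loc2 (𝓡 (n + 1)) e₁ S z (locV (𝓡 (n + 1)) e₁ X' z) with ha
  have hηs : ContDiff ℝ ∞ η := contDiff_smul_of_tsupport_subset e₁.open_target hχ hχt hSl
  have has : ContDiff ℝ ∞ a :=
    contDiff_smul_of_tsupport_subset e₁.open_target hχ hχt (hSl.clm_apply hXl)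
  have hηalt : ∀ z v, η z v v = 0 := fun z v ↦ by
    simp only [hη, smul_apply, loc2, pullForm_apply, halt, smul_zero]
  -- the conditions at `z₀`
  have hη0 : η z₀ = loc2 (𝓡 (n + 1)) e₁ S z₀ := by
    rw [hη]
    simp only [hχ1.self_of_nhds, one_smul]
  have hnd : ∀ v, (∀ w, η z₀ v w = 0) → v = 0 := by
    intro v hv
    rw [hη0] at hv
    refine he₁.loc2_nondegenerate hz₀t ?_ hv
    rw [hsymm, ← hjx]
    exact nondegenerate_of_extends hp0 hh (by simp) hN.inner_embedding Ω hS (ι b)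
  have ha0 : a z₀ = η z₀ (locV (𝓡 (n + 1)) e₁ X' z₀) := by
    rw [hη0, ha]
    simp only [hχ1.self_of_nhds, one_smul]
  have hpos : 0 < height n (locV (𝓡 (n + 1)) e₁ X' z₀) := by
    rw [locV, hsymm, ← hjx, hX' _ (hbu (hbd b))]
    refine pos_apply_dC_of_outward hp0 hh (by simp) hN.inner_embedding he₁
      (by rwa [hjx]) ?_ (by rwa [hjx]) (fun q hq ↦ (hrange hq).1 (mem_range_self q))
      (apply_extChartAt_of_mem_boundary (hbd b)) (hout _ (hbd b))
    intro h
    have h1 := height_normal n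
    rw [h] at h1
    exact zero_ne_one h1
  have hev := eventually_nondegenerate_collarForm (c := c) (height_normal n) hηs has hηalt h0 hnd
    ha0 hpos
  -- near `z₀`, the domain lies in the image of `u`
  obtain ⟨O, hO, hbO, hOu⟩ : ∃ O : Set N, IsOpen O ∧ κ (b, 0) ∈ O ∧ j ⁻¹' O ⊆ u := by
    obtain ⟨O, hO, hOu⟩ := hN.inner_embedding.isEmbedding.isInducing.isOpen_iff.1 hu
    refine ⟨O, hO, ?_, hOu.le⟩
    have h1 : ι b ∈ j ⁻¹' O := by rw [hOu]; exact hbu (hbd b)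
    rwa [mem_preimage, hjx] at h1
  obtain ⟨W, hW, hbW, hWs, hlower, hstar⟩ := exists_restrOpen_starShaped hb hκ hr
    (Filter.inter_mem hχ1.eventually_nhds
      (Filter.inter_mem hev (eventually_symm_mem hz₀t hO (by rwa [hsymm]))))
  set e := e₁.restrOpen W hW with he
  have hsub : ∀ {z}, z ∈ e.target → z ∈ e₁.target := fun hz ↦ hz.1
  have hηe : ∀ z ∈ e.target, η =ᶠ[𝓝 z] loc2 (𝓡 (n + 1)) e₁ S := fun z hz ↦ by
    filter_upwards [(hWs hz).1] with x hx
    rw [hη]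
    simp only [hx, one_smul]
  have hae : ∀ z ∈ e.target, a =ᶠ[𝓝 z]
      fun x ↦ loc2 (𝓡 (n + 1)) e₁ S x (locV (𝓡 (n + 1)) e₁ X' x) := fun z hz ↦ by
    filter_upwards [(hWs hz).1] with x hx
    rw [ha]
    simp only [hx, one_smul]
  -- the points of negative height are interior points of `M`
  have hint : ∀ z ∈ e.target, height n z < 0 → ∃ q, (𝓡∂ (n + 1)).IsInteriorPoint q ∧ q ∈ u ∧
      j q ∈ e₁.source ∧ e₁ (j q) = z := by
    intro z hz hz0
    have h1 := e₁.map_target (hsub hz)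
    have h2 := e₁.right_inv (hsub hz)
    obtain ⟨q, hq⟩ := (hrange h1).2 (by rw [h2]; exact hz0.le)
    refine ⟨q, ?_, hOu (by rw [mem_preimage, hq]; exact (hWs hz).2.2), by rwa [hq], by rwa [hq]⟩
    rw [ModelWithCorners.isInteriorPoint_iff_not_isBoundaryPoint]
    intro hqb
    have h3 : q ∈ range ι := by rw [hN.range_boundary]; exact hqb
    obtain ⟨b', rfl⟩ := h3
    rw [(hN.glued _ b' 0).2 ⟨rfl, rfl⟩] at hq
    rw [← hq] at h1 h2
    rw [← h2, (hκ b' 0 h1).2, height_lift] at hz0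
    exact lt_irrefl _ hz0
  -- identities which hold at negative heights hold at height zero
  have hclosure : ∀ C : Set (EuclideanSpace ℝ (Fin n) × EuclideanSpace ℝ (Fin 1)), IsClosed C →
      (∀ z ∈ e.target, height n z < 0 → z ∈ C) → ∀ z ∈ e.target, height n z ≤ 0 → z ∈ C := by
    intro C hC hCz z hz hz0
    have h1 : z ∈ closure {x | height n x < 0} := by
      rw [closure_setOf_apply_lt (height_normal n)]
      exact hz0
    have h2 := e.open_target.inter_closure ⟨hz, h1⟩
    exact closure_minimal (fun x hx ↦ hCz x hx.1 hx.2) hC h2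
  refine ⟨e, η, a, ⟨he₁.restrOpen hW, ⟨fun b' ↦ (extChartAt (𝓡 n) b b', 0), fun b' t ht ↦
    ⟨by simp [height_apply], (hκ b' t ht.1).2⟩⟩, fun y hy hy0 ↦ hr y hy.1 hy0.le,
    fun y hy ↦ hrange hy.1, hlower, hstar, hηs, has, hηalt, fun z hz ↦ (hηe z hz).self_of_nhds,
    fun z hz ↦ (hae z hz).self_of_nhds, fun z hz hz0 u v w ↦ ?_, fun z hz hz0 v w ↦ ?_,
    fun z hz ↦ (hWs hz).2.1.1, fun z hz ↦ (hWs hz).2.1.2⟩, hbW⟩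
  · refine hclosure {z | d2 η z u v w = 0} ?_ (fun z hz hz0 ↦ ?_) z hz hz0
    · exact isClosed_eq (continuous_d2 hηs u v w) continuous_const
    · obtain ⟨q, hq, -, hqe, hqz⟩ := hint z hz hz0
      rw [mem_ofPred_eq, d2_congr (hηe z hz), ← hqz]
      exact he₁.d2_loc2_eq_zero_of_extends hp0 hh (by simp) hN.inner_embedding Ω halt hS hq hqe
        u v w
  · refine hclosure {z | d1 a z v w = c * η z v w} ?_ (fun z hz hz0 ↦ ?_) z hz hz0
    · exact isClosed_eq (continuous_d1 has v w) (continuous_const.mul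
        ((hηs.continuous.clm_apply continuous_const).clm_apply continuous_const))
    · obtain ⟨q, hq, hqu, hqe, hqz⟩ := hint z hz hz0
      rw [mem_ofPred_eq, d1_congr (hae z hz), (hηe z hz).self_of_nhds, ← hqz]
      refine he₁.d1_loc2_locV_eq_of_extends hp0 hh (by simp) hN.inner_embedding Ω hS hU hX hL hq
        (huU hqu) ?_ hqe v w
      filter_upwards [hu.mem_nhds hqu] with x hx using hX' x hx

end Existence

/-! ### Gluing the local Poisson structures -/

section Gluing

variable {E : Type*} [NormedAddCommGroup E] [NormedSpace ℝ E]
  {H : Type*} [TopologicalSpace H] {I : ModelWithCorners ℝ E H}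
  {M : Type*} [TopologicalSpace M] [ChartedSpace H M]
  {E' : Type*} [NormedAddCommGroup E'] [NormedSpace ℝ E']
  {H' : Type*} [TopologicalSpace H'] {J : ModelWithCorners ℝ E' H'}
  {N : Type*} [TopologicalSpace N] [ChartedSpace H' N]
  {G : Type*} [NormedAddCommGroup G] [NormedSpace ℝ G]
  {S : Π y : N, TangentSpace J y →L[ℝ] TangentSpace J y →L[ℝ] ℝ}

/-- The bivector on a tangent space inverse to a bilinear form: `(α, β) ↦ β (S⁻¹ α)`. -/
def inverseBivectorAt (S : Π y : N, TangentSpace J y →L[ℝ] TangentSpace J y →L[ℝ] ℝ) (y : N) :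
    (TangentSpace J y →L[ℝ] ℝ) →L[ℝ] (TangentSpace J y →L[ℝ] ℝ) →L[ℝ] ℝ :=
  (ContinuousLinearMap.apply ℝ ℝ : E' →L[ℝ] (E' →L[ℝ] ℝ) →L[ℝ] ℝ).comp
    (S y : E' →L[ℝ] E' →L[ℝ] ℝ).inverse

variable [FiniteDimensional ℝ E']

lemma inverseBivectorAt_apply {y : N} (hS : ∀ v, (∀ w, S y v w = 0) → v = 0)
    {α : TangentSpace J y →L[ℝ] ℝ} {v : TangentSpace J y} (hv : ∀ w, α w = S y v w)
    (β : TangentSpace J y →L[ℝ] ℝ) : inverseBivectorAt S y α β = β v := by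
  have hinv : (S y : E' →L[ℝ] E' →L[ℝ] ℝ).IsInvertible :=
    isInvertible_of_nondegenerate (G := E') hS
  have h1 : α = S y v := ContinuousLinearMap.ext hv
  rw [h1]
  exact congrArg β (hinv.inverse_apply_self v)

/-- The inverse bivector, in local coordinates. -/
lemma IsCoord.inverseBivectorAt_eq [FiniteDimensional ℝ G] {e : OpenPartialHomeomorph N G}
    (he : IsCoord J e) {y : N} (hy : y ∈ e.source) (hS : ∀ v, (∀ w, S y v w = 0) → v = 0) :
    inverseBivectorAt S y = pushBivector J e (inverseBivector (loc2 J e S)) y := by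
  have hinv : (S y).IsInvertible := isInvertible_of_nondegenerate (G := E') (S := S y) hS
  have hinv' : (loc2 J e S (e y)).IsInvertible := isInvertible_of_nondegenerate fun v hv ↦
    he.loc2_nondegenerate (e.map_source hy) (by rwa [e.left_inv hy]) hv
  ext α β
  obtain ⟨A, hA⟩ := hinv
  have hv : ∀ w, α w = S y (A.symm α) w := fun w ↦ by
    rw [← hA]
    exact congrArg (fun L ↦ L w) (A.apply_symm_apply α).symm
  rw [inverseBivectorAt_apply hS hv, he.pushBivector_inverseBivector_apply hy hinv' hv]

open Classical in
/-- The bivector field which is inverse to the form `S` on the set `R`, is given on the domains of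
the coordinates `e b` by their coordinate expressions `Q b`, and vanishes elsewhere. -/
def gluedBivector {β : Type*} (R : Set N)
    (S : Π y : N, TangentSpace J y →L[ℝ] TangentSpace J y →L[ℝ] ℝ)
    (e : β → OpenPartialHomeomorph N G) (Q : β → G → (G →L[ℝ] ℝ) →L[ℝ] (G →L[ℝ] ℝ) →L[ℝ] ℝ)
    (y : N) : (TangentSpace J y →L[ℝ] ℝ) →L[ℝ] (TangentSpace J y →L[ℝ] ℝ) →L[ℝ] ℝ :=
  if y ∈ R then inverseBivectorAt S y
  else if h : ∃ b, y ∈ (e b).source then pushBivector J (e h.choose) (Q h.choose) y else 0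

variable {β : Type*} {R : Set N} {e : β → OpenPartialHomeomorph N G}
  {Q : β → G → (G →L[ℝ] ℝ) →L[ℝ] (G →L[ℝ] ℝ) →L[ℝ] ℝ}

omit [FiniteDimensional ℝ E'] in
lemma gluedBivector_of_mem {y : N} (hy : y ∈ R) :
    gluedBivector R S e Q y = inverseBivectorAt S y := if_pos hy

/-- The inverse of an extension of a symplectic form on `M` is a Poisson structure on the interior
of `M`. -/
lemma isPoissonAt_inverseBivectorAt [FiniteDimensional ℝ E] [J.Boundaryless] [IsManifold I ∞ M]
    [IsManifold J ∞ N] [T2Space M] {f : M → N} {ℓ : E →L[ℝ] ℝ} {e₀ : E} (h₀ : ℓ e₀ = 1)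
    (hI : range I = {x | 0 ≤ ℓ x}) (hdim : Module.finrank ℝ E = Module.finrank ℝ E')
    (hf : IsSmoothEmbedding I J ∞ f) (Ω : SymplecticForm I M)
    (hSs : ContMDiff J (J.prod 𝓘(ℝ, E' →L[ℝ] E' →L[ℝ] ℝ)) ∞
      (fun y ↦ TotalSpace.mk' (E' →L[ℝ] E' →L[ℝ] ℝ)
        (E := fun y : N ↦ TangentSpace J y →L[ℝ] TangentSpace J y →L[ℝ] ℝ) y (S y)))
    (halt : ∀ y v, S y v v = 0)
    (hS : ∀ q v w, S (f q) (mfderiv I J f q v) (mfderiv I J f q w) = Ω.form q v w)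
    {P : Π y : N, (TangentSpace J y →L[ℝ] ℝ) →L[ℝ] (TangentSpace J y →L[ℝ] ℝ) →L[ℝ] ℝ}
    (hP : ∀ q, P (f q) = inverseBivectorAt S (f q)) {p : M} (hp : I.IsInteriorPoint p) :
    IsPoissonAt P (f p) := by
  -- coordinates at `f p` with domain in the image of the interior of `M`
  obtain ⟨W, hWs, hW, hpW⟩ := mem_nhds_iff.1 (apply_mem_interior_range h₀ hI hdim hf hp
    ((ModelWithCorners.isOpen_interior (I := I) (M := M) (n := ∞) (by simp)).mem_nhds hp))
  have he := (isCoord_coordAt (J := J) (f p)).restrOpen hW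
  set e := (coordAt J (f p)).restrOpen W hW with he_def
  have hpe : f p ∈ e.source := ⟨mem_coordAt_source (f p), hpW⟩
  have hsymp : FlatSymplectic (loc2 J e S) e.target := by
    refine ⟨he.contDiffOn_loc2 hSs.contMDiffOn, fun z _ v ↦ ?_, fun z hz v hv ↦ ?_,
      fun z hz u v w ↦ ?_⟩
    · simp only [loc2, pullForm_apply, halt]
    · obtain ⟨q, -, hq⟩ := hWs (e.map_target hz).2
      refine he.loc2_nondegenerate hz ?_ hv
      rw [← hq]
      exact nondegenerate_of_extends h₀ hI hdim hf Ω hS q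
    · obtain ⟨q, hqi, hq⟩ := hWs (e.map_target hz).2
      have h1 := e.map_target hz
      have h2 := e.right_inv hz
      rw [← hq] at h1 h2
      rw [← h2]
      exact he.d2_loc2_eq_zero_of_extends h₀ hI hdim hf Ω halt hS hqi h1 u v w
  have hpoisson : FlatPoisson (inverseBivector (loc2 J e S)) e.target := by
    -- no deformation: `w = 0` and `g = 1`
    have h1 := hsymp.flatPoisson_deformed e.open_target (α := 0) (c := 0) (ℓ := 0)
      contDiffOn_const (by simp [d1]) (g := fun _ ↦ 1) contDiff_const (w := fun _ ↦ 0)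
      contDiffOn_const (fun z _ ↦ ⟨0, by simp⟩) (by simp)
    convert h1 using 1
    ext z
    simp [deformed, inverseBivector]
  refine he.isPoissonAt hpoisson (fun y hy ↦ ?_) hpe
  obtain ⟨q, -, rfl⟩ := hWs hy.2
  rw [hP]
  exact he.inverseBivectorAt_eq hy (nondegenerate_of_extends h₀ hI hdim hf Ω hS q)

section Collar

variable [FiniteDimensional ℝ G] {D : Type*} {κ : D × EuclideanHalfSpace 1 → N}
    {X : Π y : N, TangentSpace J y} {c δ : ℝ} {ℓ : G →L[ℝ] ℝ} {e₀ : G}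
    {η : β → G → G →L[ℝ] G →L[ℝ] ℝ} {a : β → G → G →L[ℝ] ℝ} {g p r : ℝ → ℝ}

/-- In each collar chart, the glued bivector field is the Poisson structure of this chart. -/
lemma gluedBivector_eq_pushBivector (h₀ : ℓ e₀ = 1)
    (h : ∀ b, IsCollarChart J κ R S X c ℓ e₀ (e b) (η b) (a b)) (hgpr : IsProfile c δ g p r)
    (hnd : ∀ y ∈ R, ∀ v, (∀ w, S y v w = 0) → v = 0) {b : β} {y : N} (hy : y ∈ (e b).source) :
    gluedBivector R S e (fun b ↦ deformed (collarForm ℓ e₀ (η b)) (collarOneForm ℓ e₀ c (η b) (a b))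
        ℓ g (weight (collarForm ℓ e₀ (η b)) (collarOneForm ℓ e₀ c (η b) (a b)) ℓ p r)) y
      = pushBivector J (e b) (deformed (collarForm ℓ e₀ (η b)) (collarOneForm ℓ e₀ c (η b) (a b))
        ℓ g (weight (collarForm ℓ e₀ (η b)) (collarOneForm ℓ e₀ c (η b) (a b)) ℓ p r)) y := by
  by_cases hyR : y ∈ R
  · have hℓ := ((h b).mem_iff y hy).1 hyR
    rw [gluedBivector_of_mem hyR, (h b).isCoord.inverseBivectorAt_eq hy (hnd y hyR), pushBivector,
      pushBivector, deformed_of_nonpos hgpr hℓ,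
      (h b).collarForm_eq_loc2 h₀ ((e b).map_source hy) hℓ]
    rfl
  · have hex : ∃ b, y ∈ (e b).source := ⟨b, hy⟩
    rw [gluedBivector, if_neg hyR, dif_pos hex]
    -- off `R`, the choice of a collar chart does not matter
    have hpos : 0 < ℓ (e hex.choose y) := by
      by_contra! hcon
      exact hyR (((h _).mem_iff y hex.choose_spec).2 hcon)
    exact (h _).pushBivector_deformed_eq h₀ (h b) hex.choose_spec hy hpos

end Collar

end Gluing

/-! ### The Poisson structure on the glued manifold -/

section Topology

variable {n : ℕ}
  {M : Type*} [TopologicalSpace M] [ChartedSpace (EuclideanHalfSpace (n + 1)) M]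
  {B : Type*} [TopologicalSpace B] [ChartedSpace (EuclideanSpace ℝ (Fin n)) B]
  {N : Type*} [TopologicalSpace N] [ChartedSpace (EuclideanSpace ℝ (Fin (n + 1))) N]
  {ι : B → M} {j : M → N} {κ : B × EuclideanHalfSpace 1 → N}

lemma norm_halfLine (t : EuclideanHalfSpace 1) : ‖t.1‖ = t.1 0 := by
  rw [EuclideanSpace.norm_eq, Fin.sum_univ_one, Real.norm_eq_abs, sq_abs, Real.sqrt_sq t.2]

lemma isCompact_halfLine_le (k : ℝ) : IsCompact {t : EuclideanHalfSpace 1 | t.1 0 ≤ k} := by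
  have hcl : IsClosed {x : EuclideanSpace ℝ (Fin 1) | 0 ≤ x 0} :=
    isClosed_le continuous_const (by fun_prop)
  have h : IsCompact ((fun t : EuclideanHalfSpace 1 ↦ t.1) ⁻¹' Metric.closedBall 0 k) :=
    (IsClosedEmbedding.subtypeVal hcl).isCompact_preimage
      (isCompact_closedBall (0 : EuclideanSpace ℝ (Fin 1)) k)
  convert h using 1
  ext t
  rw [mem_preimage, mem_closedBall_zero_iff, norm_halfLine]
  rfl

variable [IsManifold (𝓡∂ (n + 1)) ∞ M] [CompactSpace M]

lemma IsCylindricalExtension.compactSpace (hN : IsCylindricalExtension n ι j κ) :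
    CompactSpace B := by
  have h : IsClosedEmbedding ι := by
    refine ⟨hN.boundary_embedding.isEmbedding, ?_⟩
    rw [hN.range_boundary]
    exact ModelWithCorners.isClosed_boundary (n := ∞) (by simp)
  exact h.compactSpace

lemma IsCylindricalExtension.isCompact_image_le (hN : IsCylindricalExtension n ι j κ) (k : ℝ) :
    IsCompact (range j ∪ κ '' {x | x.2.1 0 ≤ k}) := by
  have := hN.compactSpace
  refine (isCompact_range hN.inner_embedding.isEmbedding.continuous).union
    (IsCompact.image ?_ hN.outer_embedding.isEmbedding.continuous)
  have h := (isCompact_univ (X := B)).prod (isCompact_halfLine_le k)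
  rwa [univ_prod] at h

lemma IsCylindricalExtension.sigmaCompactSpace (hN : IsCylindricalExtension n ι j κ) :
    SigmaCompactSpace N := by
  refine ⟨fun k ↦ range j ∪ κ '' {x | x.2.1 0 ≤ k}, fun k ↦ hN.isCompact_image_le k, ?_⟩
  refine eq_univ_of_forall fun y ↦ ?_
  have h1 : y ∈ range j ∪ range κ := by rw [hN.covers]; exact mem_univ y
  rcases h1 with h1 | ⟨x, rfl⟩
  · exact mem_iUnion.2 ⟨0, Or.inl h1⟩
  · obtain ⟨k, hk⟩ := exists_nat_ge (x.2.1 0)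
    exact mem_iUnion.2 ⟨k, Or.inr (mem_image_of_mem κ hk)⟩

/-- A neighbourhood of the boundary contains a uniform collar of it. -/
lemma IsCylindricalExtension.exists_pos_collar_subset (hN : IsCylindricalExtension n ι j κ)
    {V : Set N} (hV : IsOpen V) (hκ : ∀ b, κ (b, 0) ∈ V) :
    ∃ δ > 0, ∀ b t, t.1 0 < δ → κ (b, t) ∈ V := by
  have := hN.compactSpace
  obtain ⟨u, v, -, hv, hu', hv0, huv⟩ := generalized_tube_lemma (s := (univ : Set B))
    (t := {(0 : EuclideanHalfSpace 1)}) isCompact_univ isCompact_singleton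
    (hV.preimage hN.outer_embedding.isEmbedding.continuous) (by
      rintro ⟨b, t⟩ ⟨-, ht⟩
      obtain rfl : t = 0 := ht
      exact hκ b)
  obtain ⟨w, hw, hwv⟩ := isOpen_induced_iff.1 hv
  have h0 : (0 : EuclideanSpace ℝ (Fin 1)) ∈ w := by
    have h1 := singleton_subset_iff.1 hv0
    rw [← hwv] at h1
    exact h1
  obtain ⟨δ, hδ, hδw⟩ := Metric.isOpen_iff.1 hw 0 h0
  refine ⟨δ, hδ, fun b t ht ↦ huv ⟨hu' (mem_univ b), ?_⟩⟩
  rw [← hwv]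
  refine hδw ?_
  rwa [mem_ball_zero_iff, norm_halfLine]

end Topology

/-- The inverse of a symplectic form extends from `M` to a compactly supported Poisson structure on
the glued manifold as soon as the boundary has an outward field `X` with `L_X Ω = c Ω` for a
constant `c` for which there are profiles. -/
theorem IsCylindricalExtension.exists_poissonStructure {n : ℕ}
    {M : Type*} [TopologicalSpace M] [ChartedSpace (EuclideanHalfSpace (n + 1)) M]
    [IsManifold (𝓡∂ (n + 1)) ∞ M] [T2Space M] [CompactSpace M]
    {Ω : SymplecticForm (𝓡∂ (n + 1)) M} {c : ℝ} (hΩ : HasOutwardHomogeneousField Ω c)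
    (hprof : ∀ δ > 0, ∃ g p r, IsProfile c δ g p r)
    {B : Type*} [TopologicalSpace B] [ChartedSpace (EuclideanSpace ℝ (Fin n)) B]
    [IsManifold (𝓡 n) ∞ B]
    {N : Type*} [TopologicalSpace N] [ChartedSpace (EuclideanSpace ℝ (Fin (n + 1))) N]
    [IsManifold (𝓡 (n + 1)) ∞ N] [T2Space N]
    {ι : B → M} {j : M → N} {κ : B × EuclideanHalfSpace 1 → N}
    (hN : IsCylindricalExtension n ι j κ) :
    ∃ P : PoissonStructure (𝓡 (n + 1)) N, P.HasCompactSupport ∧ P.ExtendsSymplectic Ω j := by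
  obtain ⟨U, X, hU, hbU, hX, hout, hL⟩ := hΩ
  have := hN.sigmaCompactSpace
  have hh : range (𝓡∂ (n + 1)) = _ := range_model_halfSpace n
  have hp0 : (EuclideanSpace.proj 0 : EuclideanSpace ℝ (Fin (n + 1)) →L[ℝ] ℝ)
      (EuclideanSpace.single 0 1) = 1 := by simp
  have hjc : Continuous j := hN.inner_embedding.isEmbedding.continuous
  have hjcl : IsClosed (range j) := (isCompact_range hjc).isClosed
  -- extensions of the form and of the vector field
  obtain ⟨S, hSs, halt, hS⟩ := exists_extension_form hp0 hh (by simp) hN.inner_embedding hjcl Ω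
  obtain ⟨u, hu, hbu, huU⟩ := normal_exists_closure_subset
    (ModelWithCorners.isClosed_boundary (I := 𝓡∂ (n + 1)) (M := M) (n := ∞) (by simp)) hU hbU
  obtain ⟨X', hX's, hX'⟩ := exists_extension_field hp0 hh (by simp) hN.inner_embedding hU hX huU
    (isClosed_closure.isCompact.image hjc).isClosed
  choose e η a hchart hb using hN.exists_isCollarChart Ω hSs halt hS hU hX hout hL hu hbu
    (subset_closure.trans huU) hX's (fun q hq ↦ hX' q (subset_closure hq))
  have hnd : ∀ y ∈ range j, ∀ v, (∀ w, S y v w = 0) → v = 0 := by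
    rintro _ ⟨q, rfl⟩
    exact nondegenerate_of_extends hp0 hh (by simp) hN.inner_embedding Ω hS q
  obtain ⟨δ, hδ, hκδ⟩ := hN.exists_pos_collar_subset (isOpen_iUnion fun b ↦ (e b).open_source)
    fun b ↦ mem_iUnion.2 ⟨b, hb b⟩
  -- the profile vanishes on the upper half of the collar
  obtain ⟨g, p, r, hgpr⟩ := hprof (δ / 2) (half_pos hδ)
  set P := gluedBivector (range j) S e (fun b ↦ deformed (collarForm (height n) (normal n) (η b))
    (collarOneForm (height n) (normal n) c (η b) (a b)) (height n) g
    (weight (collarForm (height n) (normal n) (η b))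
      (collarOneForm (height n) (normal n) c (η b) (a b)) (height n) p r)) with hP
  set C : Set N := range j ∪ κ '' {x | x.2.1 0 ≤ δ / 2} with hC
  have hCc : IsCompact C := hN.isCompact_image_le _
  -- off the compact set `C` there is no point of `M`, and the height exceeds `δ / 2`
  have hPC : ∀ y, y ∉ C → P y = 0 := by
    intro y hy
    have hyR : y ∉ range j := fun h ↦ hy (Or.inl h)
    by_cases hex : ∃ b, y ∈ (e b).source
    · obtain ⟨b, hyb⟩ := hex
      have hpos : 0 < height n (e b y) := by
        by_contra! hcon
        exact hyR (((hchart b).mem_iff y hyb).2 hcon)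
      obtain ⟨x, rfl⟩ := (hchart b).mem_range y hyb hpos
      have hx : δ / 2 < x.2.1 0 := by
        by_contra! hcon
        exact hy (Or.inr (mem_image_of_mem κ hcon))
      obtain ⟨ψ, hψ⟩ := (hchart b).exists_lift
      obtain ⟨h1, h2⟩ := hψ x.1 x.2 hyb
      have h3 : height n (e b (κ x)) = x.2.1 0 := by
        rw [h2, map_add, h1, map_smul, height_normal, smul_eq_mul, mul_one, zero_add]
      rw [hP, gluedBivector_eq_pushBivector (height_normal n) hchart hgpr hnd hyb, pushBivector,
        deformed_of_le hgpr (by rw [h3]; exact hx.le)]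
      ext
      rfl
    · rw [hP, gluedBivector, if_neg hyR, dif_neg hex]
  have hpoisson : ∀ y, IsPoissonAt P y := by
    intro y
    by_cases hex : ∃ b, y ∈ (e b).source
    · obtain ⟨b, hyb⟩ := hex
      exact (hchart b).isCoord.isPoissonAt ((hchart b).flatPoisson (height_normal n) hgpr)
        (fun x hx ↦ gluedBivector_eq_pushBivector (height_normal n) hchart hgpr hnd hx) hyb
    by_cases hy : y ∈ range j
    · obtain ⟨q, rfl⟩ := hy
      -- `q` is an interior point, since the collar charts cover the boundary
      refine isPoissonAt_inverseBivectorAt hp0 hh (by simp) hN.inner_embedding Ω hSs halt hS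
        (fun q ↦ gluedBivector_of_mem (mem_range_self q)) ?_
      rw [ModelWithCorners.isInteriorPoint_iff_not_isBoundaryPoint]
      intro hq
      have h1 : q ∈ range ι := by rw [hN.range_boundary]; exact hq
      obtain ⟨b, rfl⟩ := h1
      rw [(hN.glued _ b 0).2 ⟨rfl, rfl⟩] at hex
      exact hex ⟨b, hb b⟩
    · have hyC : y ∉ C := by
        rintro (h | ⟨x, hx, rfl⟩)
        · exact hy h
        · exact hex (mem_iUnion.1 (hκδ x.1 x.2 (lt_of_le_of_lt hx (half_lt_self hδ))))
      have hW := hCc.isClosed.isOpen_compl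
      have he := (isCoord_coordAt (J := 𝓡 (n + 1)) y).restrOpen hW
      refine he.isPoissonAt (Q := 0) ⟨contDiffOn_const, fun _ _ _ ↦ rfl, fun _ _ _ _ _ _ _ _ ↦ ?_⟩
        (fun x hx ↦ ?_) ⟨mem_coordAt_source y, hyC⟩
      · simp
      · rw [hPC x hx.2]
        ext
        rfl
  refine ⟨PoissonStructure.ofIsPoissonAt hpoisson, ?_, ?_⟩
  · refine hCc.of_isClosed_subset isClosed_closure (closure_minimal (fun y hy ↦ ?_) hCc.isClosed)
    by_contra hyC
    exact hy (hPC y hyC)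
  · intro x v α hα β
    change P (j x) α β = _
    rw [hP, gluedBivector_of_mem (mem_range_self x)]
    refine inverseBivectorAt_apply (hnd _ (mem_range_self x)) (fun w ↦ ?_) β
    obtain ⟨w, rfl⟩ := surjective_mfderiv_of_isSmoothEmbedding hp0 hh (by simp)
      hN.inner_embedding x w
    rw [hα, hS]

end PoissonExtension

end

theorem mainTheorem6 {n : ℕ}
    {M : Type*} [TopologicalSpace M] [ChartedSpace (EuclideanHalfSpace (n + 1)) M]
    [IsManifold (𝓡∂ (n + 1)) ∞ M] [T2Space M] [CompactSpace M]
    (Ω : PoissonExtension.SymplecticForm (𝓡∂ (n + 1)) M)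
    (hΩ : Ω.HasContactBoundary ∨ Ω.HasCosymplecticBoundary)
    {B : Type*} [TopologicalSpace B] [ChartedSpace (EuclideanSpace ℝ (Fin n)) B]
    [IsManifold (𝓡 n) ∞ B]
    {N : Type*} [TopologicalSpace N] [ChartedSpace (EuclideanSpace ℝ (Fin (n + 1))) N]
    [IsManifold (𝓡 (n + 1)) ∞ N] [T2Space N]
    (ι : B → M) (j : M → N) (κ : B × EuclideanHalfSpace 1 → N)
    (hN : PoissonExtension.IsCylindricalExtension n ι j κ) :
    ∃ P : PoissonExtension.PoissonStructure (𝓡 (n + 1)) N,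
      P.HasCompactSupport ∧ P.ExtendsSymplectic Ω j := by
  rcases hΩ with h | h
  · exact hN.exists_poissonStructure h fun δ hδ ↦ PoissonExtension.exists_isProfile_one hδ
  · exact hN.exists_poissonStructure h fun δ hδ ↦ PoissonExtension.exists_isProfile_zero hδ
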